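/- \textbf{Conventions.} Theories are many-sorted first-order theories. "Definable" means definable without parameters; a definable set of a theory is given by a formula modulo a definable equivalence relation (so imaginaries are allowed, i.e. we work in $T^{eq}$). An interpretation $i$ of $T_0$ in $T$ assigns to every sort and every basic relation of $T_0$ a definable set of $T$, so that every model $N$ of $T$ yields a model $N_0$ of $T_0$; it is \emph{stably embedded} if for all definable sets $Y$ of $T_0$ and $X$, $Z\subseteq X\times i(Y)$ of $T$ there are definable sets $W$ and $Z_0\subseteq W\times Y$ of $T_0$ such that in every model of $T$ each fibre $Z_x$, $x\in X$, equals $i(Z_0)_w$ for some $w\in i(W)$. It is an \emph{internal cover} if it is stably embedded and there is a stably embedded interpretation $\pi$ of $T$ in $T_0$ with $\pi\circ i$ equal to the identity (up to a $T_0$-definable isomorphism). A \emph{pro-group} in a theory is a filtering inverse system $(H_k)$ of definable groups and definable homomorphisms; its points in a model are the inverse limit of the groups of points, and a \emph{definable action} of it on a definable set is a definable action of one of the $H_k$. \textbf{Assumptions.} Let $i$ be an internal cover $T$ of $T_0$ such that $T$ induces no new structure on $T_0$: every subset of $i(Y)$ definable in $T$ comes from a subset of $Y$ definable in $T_0$.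 Let $M\models T$, and let $A\subseteq M^{eq}$ be a set of internality parameters, that is, $A$ is definably closed and $\mathrm{dcl}(N_0\cup A)=N^{eq}$ for every model $N$ of $T(M)_A$, the theory of $M$ with constants for $A$. Assume that the restriction $A_0$ of $A$ to $T_0$ is $\mathrm{dcl}(\emptyset)$. Below, definable sets, groups and maps of $T$ and of $T_0$ are taken in the complete theories $T(M)$ of $M$ and $T(M_0)$ of $M_0$ (which are $T$ and $T_0$ themselves, up to equivalence, when $T$ is complete). \textbf{Statement.} (0) There is a pro-group $G$ in $T$ with a definable action on every definable set of $T$, through which $G(N)$ is identified with the group $\mathrm{Aut}(N/N_0)$ of automorphisms of $N$ fixing $N_0$ pointwise, for every model $N$ of $T(M)$; and there is a pro-group $G_A$ in $T_0$ with an $A$-definable isomorphism $\theta\colon G\to i(G_A)$. For any such $G$, $G_A$ and $\theta$, where the actions of $G$ are regarded as actions of $G_A$ through $\theta$: (1) For every definable action of $G_A$ on a definable set $D$ of $T_0$ there are a definable set $X_D$ of $T$ and an $A$-definable bijection $\alpha_D\colon X_D\to i(D)$ that is an isomorphism from the canonical action of $G$ on $X_D$ to the action of $G_A$ on $D$, i.e.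 $\alpha_D(gx)=\theta(g)\,\alpha_D(x)$ for all $g\in G(N)$, $x\in X_D(N)$ and all models $N$ of $T(M)_A$. (2) Let $D$ and $E$ be definable sets of $T_0$ with definable actions of $G_A$, let $(X_D,\alpha_D)$ and $(X_E,\alpha_E)$ be any pairs as in (1), and let $f\colon D\to E$ be a $G_A$-equivariant map definable in $T_0$. Then $f$ comes from a map $F\colon X_D\to X_E$ definable in $T$ (without parameters): $\alpha_E\circ F=f\circ\alpha_D$ in every model of $T(M)_A$. -/

import Mathlib

universe u

/-! ## Many-sorted first-order logic -/

/-- A many-sorted relational language: sorts, and relation symbols whose arity is a finite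
sequence of sorts. -/
structure MSLang where
  Srt : Type u
  Rel : Type u
  ar : Rel → ℕ
  arSrt : (R : Rel) → Fin (ar R) → Srt

namespace MSLang

/-- A structure: a (possibly empty) set for every sort, a relation for every relation symbol. -/
structure Str (L : MSLang.{u}) where
  car : L.Srt → Type u
  rel : (R : L.Rel) → ((j : Fin (L.ar R)) → car (L.arSrt R j)) → Prop

/-- Tuples of elements of the sorts prescribed by `σ`. -/
abbrev Str.Tup {L : MSLang.{u}} (N : L.Str) {α : Type} (σ : α → L.Srt) : Type u :=
  (a : α) → N.car (σ a)

/-- Concatenation of two tuples. -/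
def Str.Tup.app {L : MSLang.{u}} {N : L.Str} {α β : Type} {σ : α → L.Srt} {τ : β → L.Srt}
    (v : N.Tup σ) (w : N.Tup τ) : N.Tup (Sum.elim σ τ)
  | .inl a => v a
  | .inr b => w b

/-- Variables of sort `s`, among free variables with sorts `σ` and bound variables with
sorts `τ`. -/
def Vr {L : MSLang.{u}} {α : Type} (σ : α → L.Srt) {n : ℕ} (τ : Fin n → L.Srt)
    (s : L.Srt) : Type :=
  {x : α ⊕ Fin n // Sum.elim σ τ x = s}

/-- The value of a variable under an assignment. -/
def Vr.val {L : MSLang.{u}} {N : L.Str} {α : Type} {σ : α → L.Srt} {n : ℕ} {τ : Fin n → L.Srt}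
    {s : L.Srt} (v : N.Tup σ) (w : N.Tup τ) (x : Vr σ τ s) : N.car s :=
  cast (congrArg N.car x.2) (Str.Tup.app v w x.1)

/-- First-order formulas with free variables of sorts `σ` and bound variables in scope of
sorts `τ`. -/
inductive BFml (L : MSLang.{u}) {α : Type} (σ : α → L.Srt) :
    (n : ℕ) → (Fin n → L.Srt) → Type u
  | bot {n : ℕ} {τ : Fin n → L.Srt} : BFml L σ n τ
  | eq {n : ℕ} {τ : Fin n → L.Srt} (s : L.Srt) (x y : Vr σ τ s) : BFml L σ n τ
  | rel {n : ℕ} {τ : Fin n → L.Srt} (R : L.Rel)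
      (x : (j : Fin (L.ar R)) → Vr σ τ (L.arSrt R j)) : BFml L σ n τ
  | imp {n : ℕ} {τ : Fin n → L.Srt} (φ ψ : BFml L σ n τ) : BFml L σ n τ
  | all {n : ℕ} {τ : Fin n → L.Srt} (s : L.Srt)
      (φ : BFml L σ (n + 1) (Fin.cons s τ : Fin (n + 1) → L.Srt)) : BFml L σ n τ

/-- Truth of a formula in a structure. -/
def BFml.Realize {L : MSLang.{u}} (N : L.Str) {α : Type} {σ : α → L.Srt} (v : N.Tup σ) :
    {n : ℕ} → {τ : Fin n → L.Srt} → BFml L σ n τ → N.Tup τ → Prop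
  | _, _, .bot, _ => False
  | _, _, .eq _ x y, w => x.val v w = y.val v w
  | _, _, .rel R x, w => N.rel R fun j => (x j).val v w
  | _, _, .imp φ ψ, w => φ.Realize N v w → ψ.Realize N v w
  | _, τ, .all s φ, w => ∀ x : N.car s, φ.Realize N v
      (Fin.cons (α := fun k => N.car ((Fin.cons s τ : Fin _ → L.Srt) k)) x w)

/-- Formulas with free variables of sorts `σ`. -/
abbrev Fml (L : MSLang.{u}) {α : Type} (σ : α → L.Srt) : Type u :=
  BFml L σ 0 (fun k => k.elim0)

/-- Truth of a formula at a tuple. -/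
def Str.Sat {L : MSLang.{u}} (N : L.Str) {α : Type} {σ : α → L.Srt} (φ : L.Fml σ)
    (v : N.Tup σ) : Prop :=
  BFml.Realize N v φ (fun k => k.elim0)

/-- Sentences. -/
abbrev Sen (L : MSLang.{u}) : Type u := L.Fml (fun e : Empty => e.elim)

/-- Theories. -/
abbrev Theory (L : MSLang.{u}) : Type u := Set L.Sen

/-- The theory of a structure: all sentences true in it. -/
def Str.thry {L : MSLang.{u}} (N : L.Str) : L.Theory :=
  {φ | N.Sat φ (fun e => e.elim)}

/-- `N` is a model of `T`. -/
def Str.Models {L : MSLang.{u}} (N : L.Str) (T : L.Theory) : Prop := T ⊆ N.thry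

/-- Isomorphisms of structures. -/
structure StrIso {L : MSLang.{u}} (N N' : L.Str) where
  map : (s : L.Srt) → N.car s ≃ N'.car s
  rel_iff : ∀ (R : L.Rel) (x : (j : Fin (L.ar R)) → N.car (L.arSrt R j)),
    N'.rel R (fun j => map _ (x j)) ↔ N.rel R x

/-! ## Definable sets (with imaginaries) -/

/-- A definable set of `T^eq`, without parameters: a formula `dom` in finitely many variables,
modulo a formula `eqv` (which is to define an equivalence relation, see `DSet.IsValid`). -/
structure DSet (L : MSLang.{u}) where
  n : ℕ
  srt : Fin n → L.Srt
  dom : L.Fml srt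
  eqv : L.Fml (Sum.elim srt srt)

namespace DSet

/-- Representatives of the points of a definable set in a structure. -/
def Rep {L : MSLang.{u}} (X : DSet L) (N : L.Str) : Type u :=
  {v : N.Tup X.srt // N.Sat X.dom v}

/-- The relation by which representatives are identified. -/
def Eqv {L : MSLang.{u}} (X : DSet L) (N : L.Str) (v w : X.Rep N) : Prop :=
  N.Sat X.eqv (Str.Tup.app v.1 w.1)

/-- The points of a definable set in a structure. -/
def Pt {L : MSLang.{u}} (X : DSet L) (N : L.Str) : Type u := Quot (X.Eqv N)

/-- `X` is a definable set of the theory `T`: its relation is an equivalence relation in every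
model. -/
def IsValid {L : MSLang.{u}} (X : DSet L) (T : L.Theory) : Prop :=
  ∀ N : L.Str, N.Models T → Equivalence (X.Eqv N)

/-- A sort, as a definable set. -/
def ofSrt {L : MSLang.{u}} (s : L.Srt) : DSet L where
  n := 1
  srt := fun _ => s
  dom := .imp .bot .bot
  eqv := .eq s ⟨.inl (.inl 0), rfl⟩ ⟨.inl (.inr 0), rfl⟩

/-- An element of a sort, as a point of the corresponding definable set. -/
def ofElt {L : MSLang.{u}} {N : L.Str} {s : L.Srt} (x : N.car s) : (ofSrt s).Pt N :=
  Quot.mk _ ⟨fun _ => x, fun h => h⟩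

end DSet

/-- Tuples of points of a family of definable sets. -/
abbrev Pts {L : MSLang.{u}} (N : L.Str) {β : Type} (X : β → DSet L) : Type u :=
  (b : β) → (X b).Pt N

/-- Concatenation of tuples of points. -/
def Pts.app {L : MSLang.{u}} {N : L.Str} {β γ : Type} {X : β → DSet L} {Y : γ → DSet L}
    (p : Pts N X) (q : Pts N Y) : Pts N (Sum.elim X Y)
  | .inl b => p b
  | .inr c => q c

/-- The empty tuple of points. -/
def pt0 {L : MSLang.{u}} {N : L.Str} : Pts N (![] : Fin 0 → DSet L) := fun j => j.elim0

/-- A tuple of one point. -/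
def pt1 {L : MSLang.{u}} {N : L.Str} {X : DSet L} (p : X.Pt N) : Pts N ![X]
  | 0 => p

/-- A tuple of two points. -/
def pt2 {L : MSLang.{u}} {N : L.Str} {X Y : DSet L} (p : X.Pt N) (q : Y.Pt N) : Pts N ![X, Y]
  | 0 => p
  | 1 => q

/-- A tuple of three points. -/
def pt3 {L : MSLang.{u}} {N : L.Str} {X Y Z : DSet L} (p : X.Pt N) (q : Y.Pt N) (r : Z.Pt N) :
    Pts N ![X, Y, Z]
  | 0 => p
  | 1 => q
  | 2 => r

/-- Definable relations (without parameters) on the product of a family of definable sets, given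
by a formula on representatives. -/
def DRel {L : MSLang.{u}} {β : Type} (X : β → DSet L) : Type u :=
  L.Fml (fun jk : (j : β) × Fin (X j).n => (X jk.1).srt jk.2)

/-- A definable relation holds at a tuple of points if the formula holds at some
representatives. -/
def DRel.Holds {L : MSLang.{u}} {β : Type} {X : β → DSet L} (φ : DRel X) (N : L.Str)
    (p : Pts N X) : Prop :=
  ∃ r : (j : β) → (X j).Rep N, (∀ j, Quot.mk _ (r j) = p j) ∧
    N.Sat (σ := fun jk : (j : β) × Fin (X j).n => (X jk.1).srt jk.2) φ
      (fun jk => (r jk.1).1 jk.2)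

/-- Elements of `N^eq`: points of arbitrary definable sets. -/
abbrev Str.Elt {L : MSLang.{u}} (N : L.Str) : Type u := (X : DSet L) × X.Pt N

/-- The point `y` is definable over the set `B`: it is the only point that satisfies some
formula with parameters from `B`. -/
def DefOver {L : MSLang.{u}} (N : L.Str) (B : Set N.Elt) {Y : DSet L} (y : Y.Pt N) : Prop :=
  ∃ (m : ℕ) (P : Fin m → DSet L) (b : Pts N P), (∀ j, (⟨P j, b j⟩ : N.Elt) ∈ B) ∧
    ∃ φ : DRel (Sum.elim P ![Y]), ∀ y' : Y.Pt N, φ.Holds N (Pts.app b (pt1 y')) ↔ y' = y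

/-! ## Relations that are graphs -/

/-- `R` is the graph of a function. -/
def IsFn {α β : Type u} (R : α → β → Prop) : Prop := ∀ a, ∃! b, R a b

/-- `R` is the graph of the multiplication of a group. -/
def IsGroupLaw {α : Type u} (R : α → α → α → Prop) : Prop :=
  ∃ _ : Group α, ∀ a b c, R a b c ↔ a * b = c

/-- `R` is the graph of the multiplication of a group and `S` that of an action of this group. -/
def IsActionLaw {α β : Type u} (R : α → α → α → Prop) (S : α → β → β → Prop) : Prop :=
  ∃ (_ : Group α) (_ : MulAction α β), (∀ a b c, R a b c ↔ a * b = c) ∧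
    ∀ a x y, S a x y ↔ a • x = y

/-! ## Interpretations -/

/-- The data of an interpretation of the language `L₀` in (imaginary sorts of) `L`. -/
structure Interp (L₀ L : MSLang.{u}) where
  srt : L₀.Srt → DSet L
  rel : (R : L₀.Rel) → DRel (fun j => srt (L₀.arSrt R j))

namespace Interp

/-- The `L₀`-structure `N₀` that an interpretation yields in an `L`-structure `N`. -/
def pull {L₀ L : MSLang.{u}} (i : Interp L₀ L) (N : L.Str) : L₀.Str where
  car s := (i.srt s).Pt N
  rel R p := (i.rel R).Holds N p

/-- `i` is an interpretation of the theory `T₀` in the theory `T`. -/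
structure IsInterp {L₀ L : MSLang.{u}} (i : Interp L₀ L) (T₀ : L₀.Theory) (T : L.Theory) :
    Prop where
  valid : ∀ s, (i.srt s).IsValid T
  models : ∀ N : L.Str, N.Models T → (i.pull N).Models T₀

/-- Relations, definable in `L` without parameters, between the definable sets `X` of `L` and the
definable sets `i(Y)`, for definable sets `Y` of `L₀`. -/
def MRel {L₀ L : MSLang.{u}} (i : Interp L₀ L) {β γ : Type} (X : β → DSet L)
    (Y : γ → DSet L₀) : Type u :=
  DRel (Sum.elim X (fun jk : (j : γ) × Fin (Y j).n => i.srt ((Y jk.1).srt jk.2)))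

/-- Truth of such a relation, where the points of `i(Y)` in `N` are the points of `Y` in `N₀`. -/
def MRel.Holds {L₀ L : MSLang.{u}} {i : Interp L₀ L} {β γ : Type} {X : β → DSet L}
    {Y : γ → DSet L₀} (φ : i.MRel X Y) (N : L.Str) (p : Pts N X) (q : Pts (i.pull N) Y) : Prop :=
  ∃ r : (j : γ) → (Y j).Rep (i.pull N), (∀ j, Quot.mk _ (r j) = q j) ∧
    DRel.Holds (X := Sum.elim X (fun jk : (j : γ) × Fin (Y j).n => i.srt ((Y jk.1).srt jk.2)))
      φ N (Pts.app p (fun jk => (r jk.1).1 jk.2))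

/-- Stably embedded interpretations: every `T`-definable family of subsets of `i(Y)` is, uniformly,
a family of subsets definable in `T₀` with parameters from `T₀`. -/
def IsStablyEmbedded {L₀ L : MSLang.{u}} (i : Interp L₀ L) (T₀ : L₀.Theory) (T : L.Theory) :
    Prop :=
  ∀ (Y : DSet L₀), Y.IsValid T₀ → ∀ X : DSet L, X.IsValid T → ∀ Z : i.MRel ![X] ![Y],
    ∃ W : DSet L₀, W.IsValid T₀ ∧ ∃ Z₀ : DRel ![W, Y],
      ∀ N : L.Str, N.Models T → ∀ x : X.Pt N, ∃ w : W.Pt (i.pull N), ∀ y : Y.Pt (i.pull N),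
        Z.Holds N (pt1 x) (pt1 y) ↔ Z₀.Holds (i.pull N) (pt2 w y)

/-- The composite `π ∘ i` is the identity interpretation of `T₀` in itself, up to an isomorphism
definable in `T₀`. -/
def CompIsId {L₀ L : MSLang.{u}} (i : Interp L₀ L) (π : Interp L L₀) (T₀ : L₀.Theory) : Prop :=
  ∃ h : (s : L₀.Srt) → π.MRel ![DSet.ofSrt s] ![i.srt s],
    ∀ N₀ : L₀.Str, N₀.Models T₀ → ∃ e : StrIso N₀ (i.pull (π.pull N₀)),
      ∀ (s : L₀.Srt) (x : N₀.car s) (y : (i.srt s).Pt (π.pull N₀)),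
        (h s).Holds N₀ (pt1 (DSet.ofElt x)) (pt1 y) ↔ e.map s x = y

/-- Internal covers: `T` is, through `i`, an internal cover of `T₀`. -/
structure IsInternalCover {L₀ L : MSLang.{u}} (i : Interp L₀ L) (T₀ : L₀.Theory)
    (T : L.Theory) : Prop where
  interp : i.IsInterp T₀ T
  stab : i.IsStablyEmbedded T₀ T
  inverse : ∃ π : Interp L L₀, π.IsInterp T T₀ ∧ π.IsStablyEmbedded T T₀ ∧ i.CompIsId π T₀

/-- `T` induces no new structure on `T₀`: every subset of a set `i(Y)` that is definable in `T`
without parameters comes from a subset of `Y` definable in `T₀` without parameters. -/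
def NoNewStructure {L₀ L : MSLang.{u}} (i : Interp L₀ L) (T₀ : L₀.Theory) (T : L.Theory) :
    Prop :=
  ∀ (Y : DSet L₀), Y.IsValid T₀ → ∀ Z : i.MRel ![] ![Y], ∃ Z₀ : DRel ![Y],
    ∀ N : L.Str, N.Models T → ∀ y : Y.Pt (i.pull N),
      Z.Holds N pt0 (pt1 y) ↔ Z₀.Holds (i.pull N) (pt1 y)

end Interp

/-! ## Parameters -/

/-- Finite tuples from a set `A` of elements of `M^eq`. -/
structure ATup {L : MSLang.{u}} {M : L.Str} (A : Set M.Elt) where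
  m : ℕ
  P : Fin m → DSet L
  a : Pts M P
  mem : ∀ j, (⟨P j, a j⟩ : M.Elt) ∈ A

/-- Models of the theory `T(M)_A` in the language with constants for `A`: structures `N`, with an
interpretation of the elements of `A` in `N` that preserves the truth of all formulas. -/
structure AModel {L : MSLang.{u}} {M : L.Str} (A : Set M.Elt) where
  N : L.Str
  e : (x : A) → x.1.1.Pt N
  elem : ∀ (t : ATup A) (φ : DRel t.P),
    φ.Holds M t.a ↔ φ.Holds N (fun j => e ⟨⟨t.P j, t.a j⟩, t.mem j⟩)

/-- The tuple `t` from `A` in a model containing `A`. -/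
def ATup.inModel {L : MSLang.{u}} {M : L.Str} {A : Set M.Elt} (t : ATup A) (N : AModel A) :
    Pts N.N t.P :=
  fun j => N.e ⟨⟨t.P j, t.a j⟩, t.mem j⟩

namespace Interp

/-- The elements of `N₀`, as elements of `N^eq`. -/
def baseElts {L₀ L : MSLang.{u}} (i : Interp L₀ L) (N : L.Str) : Set N.Elt :=
  {x | ∃ (s : L₀.Srt) (y : (i.srt s).Pt N), x = ⟨i.srt s, y⟩}

/-- `A` is a set of internality parameters: a definably closed set `A` of elements of `M^eq` such
that `dcl(N₀ ∪ A) = N` for every model `N` containing `A`. -/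
structure IsInternalityParams {L₀ L : MSLang.{u}} (i : Interp L₀ L) {M : L.Str}
    (A : Set M.Elt) : Prop where
  valid : ∀ x ∈ A, x.1.IsValid M.thry
  closed : ∀ (Y : DSet L) (y : Y.Pt M), Y.IsValid M.thry → DefOver M A y →
    (⟨Y, y⟩ : M.Elt) ∈ A
  generates : ∀ (N : AModel A) (Y : DSet L) (y : Y.Pt N.N), Y.IsValid M.thry →
    DefOver N.N (i.baseElts N.N ∪ Set.range fun x : A => (⟨x.1.1, N.e x⟩ : N.N.Elt)) y

/-- The restriction `A₀` of `A` to `T₀` is the definable closure of the empty set: every point,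
definable over `A`, of a definable set of `T₀` is definable in `M₀` without parameters. -/
def RestrictionTrivial {L₀ L : MSLang.{u}} (i : Interp L₀ L) {M : L.Str} (A : Set M.Elt) : Prop :=
  ∀ (Y : DSet L₀), Y.IsValid (i.pull M).thry → ∀ y : Y.Pt (i.pull M),
    (∃ (t : ATup A) (φ : i.MRel t.P ![Y]), ∀ y', φ.Holds M t.a (pt1 y') ↔ y' = y) →
      DefOver (i.pull M) ∅ y

/-- Relations between `X` and `i(Y)` that are definable over `A`. -/
structure ARel {L₀ L : MSLang.{u}} (i : Interp L₀ L) {M : L.Str} (A : Set M.Elt) {β γ : Type}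
    (X : β → DSet L) (Y : γ → DSet L₀) where
  t : ATup A
  φ : i.MRel (Sum.elim t.P X) Y

/-- Truth of an `A`-definable relation in a model containing `A`. -/
def ARel.Holds {L₀ L : MSLang.{u}} {i : Interp L₀ L} {M : L.Str} {A : Set M.Elt} {β γ : Type}
    {X : β → DSet L} {Y : γ → DSet L₀} (ρ : i.ARel A X Y) (N : AModel A) (p : Pts N.N X)
    (q : Pts (i.pull N.N) Y) : Prop :=
  ρ.φ.Holds N.N (Pts.app (ρ.t.inModel N) p) q

end Interp

/-! ## Pro-groups -/

/-- A pro-group in `T`: a filtering inverse system of groups and homomorphisms definable in `T`. -/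
structure ProGroup {L : MSLang.{u}} (T : L.Theory) where
  I : Type u
  [pre : Preorder I]
  nonempty : Nonempty I
  directed : ∀ k l : I, ∃ m, k ≤ m ∧ l ≤ m
  G : I → DSet L
  valid : ∀ k, (G k).IsValid T
  mul : (k : I) → DRel ![G k, G k, G k]
  tr : {k l : I} → k ≤ l → DRel ![G l, G k]
  isGroup : ∀ (N : L.Str), N.Models T → ∀ k,
    IsGroupLaw (fun a b c : (G k).Pt N => (mul k).Holds N (pt3 a b c))
  tr_fn : ∀ (N : L.Str), N.Models T → ∀ {k l : I} (h : k ≤ l),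
    IsFn (fun (a : (G l).Pt N) (b : (G k).Pt N) => (tr h).Holds N (pt2 a b))
  tr_mul : ∀ (N : L.Str), N.Models T → ∀ {k l : I} (h : k ≤ l)
    (a b c : (G l).Pt N) (a' b' c' : (G k).Pt N),
    (tr h).Holds N (pt2 a a') → (tr h).Holds N (pt2 b b') → (tr h).Holds N (pt2 c c') →
      (mul l).Holds N (pt3 a b c) → (mul k).Holds N (pt3 a' b' c')
  tr_refl : ∀ (N : L.Str), N.Models T → ∀ (k : I) (a : (G k).Pt N),
    (tr (le_refl k)).Holds N (pt2 a a)
  tr_trans : ∀ (N : L.Str), N.Models T → ∀ {k l m : I} (h : k ≤ l) (h' : l ≤ m)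
    (a : (G m).Pt N) (b : (G l).Pt N) (c : (G k).Pt N),
    (tr h').Holds N (pt2 a b) → (tr h).Holds N (pt2 b c) → (tr (h.trans h')).Holds N (pt2 a c)

attribute [instance] ProGroup.pre

namespace ProGroup

/-- The points of a pro-group in a structure: the inverse limit of the groups of points. -/
def Pt {L : MSLang.{u}} {T : L.Theory} (H : ProGroup T) (N : L.Str) : Type u :=
  {g : (k : H.I) → (H.G k).Pt N // ∀ (k l : H.I) (h : k ≤ l), (H.tr h).Holds N (pt2 (g l) (g k))}

/-- The graph of the multiplication of points. -/
def MulRel {L : MSLang.{u}} {T : L.Theory} (H : ProGroup T) {N : L.Str} (a b c : H.Pt N) : Prop :=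
  ∀ k, (H.mul k).Holds N (pt3 (a.1 k) (b.1 k) (c.1 k))

/-- A definable action of a pro-group on a definable set `Q`: a definable action of one of the
groups of the system. -/
structure Act {L : MSLang.{u}} {T : L.Theory} (H : ProGroup T) (Q : DSet L) where
  k : H.I
  act : DRel ![H.G k, Q, Q]
  isAct : ∀ N : L.Str, N.Models T →
    IsActionLaw (fun a b c : (H.G k).Pt N => (H.mul k).Holds N (pt3 a b c))
      (fun (a : (H.G k).Pt N) (x y : Q.Pt N) => act.Holds N (pt3 a x y))

/-- The graph of the action of the points of the pro-group: `g` takes `x` to `y`. -/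
def Act.Rel {L : MSLang.{u}} {T : L.Theory} {H : ProGroup T} {Q : DSet L} (m : H.Act Q)
    {N : L.Str} (g : H.Pt N) (x y : Q.Pt N) : Prop :=
  m.act.Holds N (pt3 (g.1 m.k) x y)

end ProGroup

/-! ## Automorphisms and the definable Galois group -/

/-- Automorphisms: bijections that preserve all sets definable without parameters. -/
structure Aut {L : MSLang.{u}} (N : L.Str) where
  map : (s : L.Srt) → N.car s ≃ N.car s
  sat_iff : ∀ {α : Type} (σ : α → L.Srt) (φ : L.Fml σ) (v : N.Tup σ),
    N.Sat φ (fun a => map _ (v a)) ↔ N.Sat φ v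

/-- The action of an automorphism on the points of a definable set. -/
def Aut.onPt {L : MSLang.{u}} {N : L.Str} (f : Aut N) {X : DSet L} : X.Pt N → X.Pt N :=
  Quot.map (fun r => ⟨fun k => f.map _ (r.1 k), (f.sat_iff _ X.dom r.1).2 r.2⟩) (by
    intro v w h
    have h' := (f.sat_iff _ X.eqv (Str.Tup.app v.1 w.1)).2 h
    have e : (fun a => f.map _ (Str.Tup.app v.1 w.1 a)) =
        Str.Tup.app (fun k => f.map _ (v.1 k)) (fun k => f.map _ (w.1 k)) := by
      funext a
      cases a <;> rfl
    rw [e] at h'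
    exact h')

namespace Interp

/-- The automorphism fixes `N₀` pointwise. -/
def FixesBase {L₀ L : MSLang.{u}} (i : Interp L₀ L) {N : L.Str} (f : Aut N) : Prop :=
  ∀ (s : L₀.Srt) (x : (i.srt s).Pt N), f.onPt x = x

/-- The definable Galois group of `T` over `T₀`: a pro-group `G` in `T` with a definable action on
every definable set of `T`, through which `G(N)` is identified with `Aut(N/N₀)` for every model
`N` of `T`. -/
structure GaloisGroup {L₀ L : MSLang.{u}} (i : Interp L₀ L) (T : L.Theory) where
  grp : ProGroup T
  act : (Q : DSet L) → Q.IsValid T → grp.Act Q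
  exists_aut : ∀ N : L.Str, N.Models T → ∀ g : grp.Pt N, ∃ f : Aut N, i.FixesBase f ∧
    ∀ (Q : DSet L) (hQ : Q.IsValid T) (x y : Q.Pt N), (act Q hQ).Rel g x y ↔ f.onPt x = y
  exists_pt : ∀ N : L.Str, N.Models T → ∀ f : Aut N, i.FixesBase f → ∃! g : grp.Pt N,
    ∀ (Q : DSet L) (hQ : Q.IsValid T) (x y : Q.Pt N), (act Q hQ).Rel g x y ↔ f.onPt x = y

/-- An `A`-definable isomorphism `θ` from a pro-group `G` in `T(M)` to `i(H)`, for a pro-group `H`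
in `T(M₀)`: an isomorphism of the groups of points in all models containing `A` such that every
coordinate of `θ` is an `A`-definable function of some coordinate of its argument, and likewise
for the inverse of `θ`. -/
structure ProIso {L₀ L : MSLang.{u}} (i : Interp L₀ L) {M : L.Str} (A : Set M.Elt)
    (G : ProGroup M.thry) (H : ProGroup (i.pull M).thry) where
  θ : (N : AModel A) → G.Pt N.N ≃ H.Pt (i.pull N.N)
  map_mul : ∀ (N : AModel A) (a b c : G.Pt N.N), G.MulRel a b c →
    H.MulRel (θ N a) (θ N b) (θ N c)
  fwdIdx : H.I → G.I
  fwd : (l : H.I) → i.ARel A ![G.G (fwdIdx l)] ![H.G l]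
  fwd_fn : ∀ (N : AModel A) (l : H.I),
    IsFn (fun (a : (G.G (fwdIdx l)).Pt N.N) (b : (H.G l).Pt (i.pull N.N)) =>
      (fwd l).Holds N (pt1 a) (pt1 b))
  fwd_spec : ∀ (N : AModel A) (l : H.I) (g : G.Pt N.N),
    (fwd l).Holds N (pt1 (g.1 (fwdIdx l))) (pt1 ((θ N g).1 l))
  bwdIdx : G.I → H.I
  bwd : (k : G.I) → i.ARel A ![G.G k] ![H.G (bwdIdx k)]
  bwd_fn : ∀ (N : AModel A) (k : G.I),
    IsFn (fun (b : (H.G (bwdIdx k)).Pt (i.pull N.N)) (a : (G.G k).Pt N.N) =>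
      (bwd k).Holds N (pt1 a) (pt1 b))
  bwd_spec : ∀ (N : AModel A) (k : G.I) (g : G.Pt N.N),
    (bwd k).Holds N (pt1 (g.1 k)) (pt1 ((θ N g).1 (bwdIdx k)))

/-- `α` is (the graph of) an `A`-definable isomorphism, from the set `X` with the canonical action
of `G` to the set `D` with the action `m` of `H`, where `H` is identified with `G` through `θ`. -/
structure IsActIso {L₀ L : MSLang.{u}} {i : Interp L₀ L} {M : L.Str} {A : Set M.Elt}
    (G : i.GaloisGroup M.thry) {H : ProGroup (i.pull M).thry} (θ : i.ProIso A G.grp H)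
    {X : DSet L} (hX : X.IsValid M.thry) {D : DSet L₀} (m : H.Act D)
    (α : i.ARel A ![X] ![D]) : Prop where
  fn : ∀ N : AModel A, IsFn (fun (x : X.Pt N.N) (d : D.Pt (i.pull N.N)) =>
    α.Holds N (pt1 x) (pt1 d))
  inv : ∀ N : AModel A, IsFn (fun (d : D.Pt (i.pull N.N)) (x : X.Pt N.N) =>
    α.Holds N (pt1 x) (pt1 d))
  equivariant : ∀ (N : AModel A) (g : G.grp.Pt N.N) (x x' : X.Pt N.N)
    (d d' : D.Pt (i.pull N.N)), α.Holds N (pt1 x) (pt1 d) → α.Holds N (pt1 x') (pt1 d') →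
      (G.act X hX).Rel g x x' → m.Rel (θ.θ N g) d d'

end Interp

/-- `f` is (the graph of) a definable map `D → E` that is equivariant for the actions `m`, `m'` of
the pro-group `H`. -/
structure IsEquivariantMap {L : MSLang.{u}} {T : L.Theory} {H : ProGroup T} {D E : DSet L}
    (m : H.Act D) (m' : H.Act E) (f : DRel ![D, E]) : Prop where
  fn : ∀ N : L.Str, N.Models T →
    IsFn (fun (d : D.Pt N) (e : E.Pt N) => f.Holds N (pt2 d e))
  equivariant : ∀ N : L.Str, N.Models T → ∀ (g : H.Pt N) (d d' : D.Pt N) (e e' : E.Pt N),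
    f.Holds N (pt2 d e) → m.Rel g d d' → m'.Rel g e e' → f.Holds N (pt2 d' e')

end MSLang

namespace MSLang

/-! ## First-order definable families of relations on tuples -/

/-! Naming the parameters `A` trivializes the cover. Stable embeddedness gives each definable family
of subsets of a base set a definable map to canonical parameters in the base
(`IsStablyEmbedded.isCanonicallyEmbedded`). Since dcl(N₀ ∪ A) = N^eq in every model containing `A`,
compactness embeds each definable set of T, over `A`, in some i(W)
(`IsInternalityParams.exists_injective`). Since A₀ = dcl(∅), each `A`-definable subset of i(W) is
∅-definable in the base, because its canonical parameter lies in A₀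
(`RestrictionTrivial.exists_base_def`). So each U is in `A`-definable bijection with some i(D), and
all structure transported through these bijections is ∅-definable in the base
(`IsInternalityParams.exists_equiv`).

If `A` is interpreted in one structure N in two ways, one system of bijections followed by the
inverse of the other is an automorphism of N over N₀ that takes the first interpretation to the
second (`IsInternalityParams.exists_aut`). By compactness, an `A`-definable set that is invariant
under Aut(N/N₀) for all N is therefore ∅-definable (`IsInternalityParams.exists_def_of_invariant`).
This is the Galois descent behind (1) and (2).

For (2), the map α_E⁻¹ ∘ f ∘ α_D is `A`-definable, and equivariance makes it invariant, so it
descends (`IsActIso.exists_map`).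

For (1), X_D is a twist of D by an orbit of parameters. Let the action come from the group H_l of
the system. By compactness there are an index k and a finite tuple t from `A` such that on G_k the
coordinate θ_l is multiplicative and θ_l(g) depends only on gt (`ProIso.exists_uniform`). Then V(gt,
d) = θ_l(g)d is a well-defined `A`-definable map onto i(D), from pairs of a conjugate of t and a
point of i(D). An automorphism γ over the base fixes the second coordinate, and V(γp) = θ(γ)V(p). So
the kernel of V is invariant, hence ∅-definable; X_D is the quotient by this kernel, and α_D is
induced by V (`exists_isActIso`).

For (0), G is the inverse limit of all ∅-definable groups of permutations of finitely many definable
sets that contain the restrictions of Aut(N/N₀). Given a ∅-definable relation R, the bijections over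
`A` lie in a ∅-definable family of frames that carry R to a fixed relation of the base. The
permutations g for which b ↦ b ∘ g maps the set of frames onto itself form a definable group that
preserves R and contains the automorphisms over the base (`IsInternalityParams.exists_permGroup`).
Hence a compatible system of such permutations is an automorphism; it fixes the base because the
trivial group on a base sort belongs to the system. Finally G_A is the copy of G in the base under
the `A`-definable bijections (`IsInternalityParams.exists_proIso`).

To keep formulas out of these arguments, definability is treated semantically: a `USet` is a family
of sets with a definable representation by tuples. These are closed under products, subsets,
quotients and pullback along i, and `USet.exists_dset` leads back to formulas. -/

theorem Vr.val_eq_of_heq {L : MSLang.{u}} {N : L.Str} {α α' : Type} {σ : α → L.Srt}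
    {σ' : α' → L.Srt} {n n' : ℕ} {τ : Fin n → L.Srt} {τ' : Fin n' → L.Srt} {s : L.Srt}
    {v : N.Tup σ} {w : N.Tup τ} {v' : N.Tup σ'} {w' : N.Tup τ'} (x : Vr σ τ s) (x' : Vr σ' τ' s)
    (h : HEq (Str.Tup.app v' w' x'.1) (Str.Tup.app v w x.1)) : x'.val v' w' = x.val v w :=
  eq_of_heq ((cast_heq _ _).trans (h.trans (cast_heq _ _).symm))

/-- The renaming may exchange free variables and bound variables in scope, which is what later lets
a free variable be quantified. Sorts match only up to propositional equality, so assignments are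
compared by `HEq`. -/
theorem BFml.exists_rename {L : MSLang.{u}} {α : Type} {σ : α → L.Srt} {n : ℕ}
    {τ : Fin n → L.Srt} (φ : BFml L σ n τ) :
    ∀ {α' : Type} {σ' : α' → L.Srt} {n' : ℕ} {τ' : Fin n' → L.Srt}
      (ρ : α ⊕ Fin n → α' ⊕ Fin n'), (∀ x, Sum.elim σ' τ' (ρ x) = Sum.elim σ τ x) →
      ∃ φ' : BFml L σ' n' τ', ∀ (N : L.Str) (v : N.Tup σ) (w : N.Tup τ) (v' : N.Tup σ')
        (w' : N.Tup τ'), (∀ x, HEq (Str.Tup.app v' w' (ρ x)) (Str.Tup.app v w x)) →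
          (φ'.Realize N v' w' ↔ φ.Realize N v w) := by
  induction φ with
  | bot => exact fun _ _ => ⟨.bot, fun _ _ _ _ _ _ => Iff.rfl⟩
  | eq s x y =>
    intro α' σ' n' τ' ρ hρ
    refine ⟨.eq s ⟨ρ x.1, (hρ _).trans x.2⟩ ⟨ρ y.1, (hρ _).trans y.2⟩, fun N v w v' w' h => ?_⟩
    simp only [BFml.Realize]
    rw [Vr.val_eq_of_heq x ⟨ρ x.1, (hρ _).trans x.2⟩ (h _),
      Vr.val_eq_of_heq y ⟨ρ y.1, (hρ _).trans y.2⟩ (h _)]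
  | rel R x =>
    intro α' σ' n' τ' ρ hρ
    refine ⟨.rel R fun j => ⟨ρ (x j).1, (hρ _).trans (x j).2⟩, fun N v w v' w' h => ?_⟩
    simp only [BFml.Realize]
    rw [show (fun j => Vr.val v' w' ⟨ρ (x j).1, (hρ _).trans (x j).2⟩) =
      fun j => (x j).val v w from funext fun j => Vr.val_eq_of_heq (x j) _ (h _)]
  | imp φ ψ ih₁ ih₂ =>
    intro α' σ' n' τ' ρ hρ
    obtain ⟨φ', h₁⟩ := ih₁ ρ hρ
    obtain ⟨ψ', h₂⟩ := ih₂ ρ hρ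
    exact ⟨.imp φ' ψ', fun N v w v' w' h => imp_congr (h₁ N v w v' w' h) (h₂ N v w v' w' h)⟩
  | @all n τ s φ ih =>
    intro α' σ' n' τ' ρ hρ
    have hs : ∀ z : α' ⊕ Fin n', Sum.elim σ' (Fin.cons s τ' : Fin (n' + 1) → L.Srt)
        (Sum.map id Fin.succ z) = Sum.elim σ' τ' z := by
      rintro (z | z) <;> rfl
    obtain ⟨φ', h'⟩ := ih (σ' := σ') (τ' := (Fin.cons s τ' : Fin (n' + 1) → L.Srt))
      (Sum.elim (fun a => Sum.map id Fin.succ (ρ (.inl a)))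
        (Fin.cases (.inr 0) fun k => Sum.map id Fin.succ (ρ (.inr k)))) (by
        rintro (a | k)
        · exact (hs _).trans (hρ (.inl a))
        · refine Fin.cases rfl (fun k => ?_) k
          exact (hs _).trans (hρ (.inr k)))
    refine ⟨.all s φ', fun N v w v' w' h => forall_congr' fun x => h' N v _ v' _ ?_⟩
    have ha : ∀ z : α' ⊕ Fin n', HEq (Str.Tup.app v' (Fin.cons (α := fun k => N.car
        ((Fin.cons s τ' : Fin _ → L.Srt) k)) x w' : N.Tup (Fin.cons s τ' : Fin (n' + 1) → L.Srt))
        (Sum.map id Fin.succ z)) (Str.Tup.app v' w' z) := by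
      rintro (z | z) <;> rfl
    rintro (a | k)
    · exact (ha _).trans (h (.inl a))
    · refine Fin.cases HEq.rfl (fun k => ?_) k
      exact (ha _).trans (h (.inr k))

/-- Models of a theory. -/
abbrev Mod {L : MSLang.{u}} (T : L.Theory) : Type (u + 1) := {N : L.Str // N.Models T}

/-- A family of relations on tuples, in all models of `T`, is given by a formula. -/
def FO {L : MSLang.{u}} (T : L.Theory) {ι : Type} (σ : ι → L.Srt)
    (R : (N : Mod T) → N.1.Tup σ → Prop) : Prop :=
  ∃ φ : L.Fml σ, ∀ N v, N.1.Sat φ v ↔ R N v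

namespace FO

variable {L : MSLang.{u}} {T : L.Theory} {ι κ : Type} {σ : ι → L.Srt} {τ : κ → L.Srt}
  {R S : (N : Mod T) → N.1.Tup σ → Prop}

theorem congr (hR : FO T σ R) (h : ∀ N v, R N v ↔ S N v) : FO T σ S :=
  hR.imp fun _ hφ N v => (hφ N v).trans (h N v)

theorem of_fml (φ : L.Fml σ) : FO T σ (fun N v => N.1.Sat φ v) := ⟨φ, fun _ _ => Iff.rfl⟩

theorem bot : FO T σ (fun _ _ => False) := ⟨.bot, fun _ _ => Iff.rfl⟩

theorem imp (hR : FO T σ R) (hS : FO T σ S) : FO T σ (fun N v => R N v → S N v) := by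
  obtain ⟨φ, hφ⟩ := hR
  obtain ⟨ψ, hψ⟩ := hS
  exact ⟨.imp φ ψ, fun N v => imp_congr (hφ N v) (hψ N v)⟩

theorem not (hR : FO T σ R) : FO T σ (fun N v => ¬ R N v) := hR.imp FO.bot

theorem top : FO T σ (fun _ _ => True) := FO.bot.not.congr fun _ _ => by simp

theorem and (hR : FO T σ R) (hS : FO T σ S) : FO T σ (fun N v => R N v ∧ S N v) :=
  (hR.imp hS.not).not.congr fun _ _ => by tauto

theorem finite_all {β : Type*} [Finite β] {R : β → (N : Mod T) → N.1.Tup σ → Prop}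
    (h : ∀ b, FO T σ (R b)) : FO T σ (fun N v => ∀ b, R b N v) := by
  have key : ∀ s : Set β, FO T σ (fun N v => ∀ b ∈ s, R b N v) := fun s => by
    induction s, s.toFinite using Set.Finite.induction_on with
    | empty => exact FO.top.congr fun _ _ => by simp
    | @insert a _ _ _ ih => exact ((h a).and ih).congr fun _ _ => by simp
  exact (key Set.univ).congr fun _ _ => by simp

/-- Characterizing `S` by heterogeneous equality avoids transporting tuples along the equalities of
sorts. -/
theorem reindex_heq (hR : FO T σ R) (ρ : ι → κ) (hρ : ∀ j, τ (ρ j) = σ j) :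
    ∃ S : (N : Mod T) → N.1.Tup τ → Prop, FO T τ S ∧
      ∀ (N : Mod T) (v : N.1.Tup σ) (w : N.1.Tup τ), (∀ j, HEq (w (ρ j)) (v j)) →
        (S N w ↔ R N v) := by
  obtain ⟨φ, hφ⟩ := hR
  obtain ⟨φ', h'⟩ := φ.exists_rename (σ' := τ) (τ' := fun k : Fin 0 => k.elim0)
    (Sum.map ρ id) (by
      rintro (a | k)
      · exact hρ a
      · exact k.elim0)
  refine ⟨_, of_fml φ', fun N v w h => Iff.trans (h' N.1 v _ w _ ?_) (hφ N v)⟩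
  rintro (a | k)
  · exact h a
  · exact k.elim0

theorem reindex {ρ : ι → κ} {R : (N : Mod T) → N.1.Tup (fun j => τ (ρ j)) → Prop}
    (hR : FO T (fun j => τ (ρ j)) R) : FO T τ (fun N w => R N fun j => w (ρ j)) := by
  obtain ⟨S, hS, h⟩ := hR.reindex_heq (τ := τ) ρ fun _ => rfl
  exact hS.congr fun N w => h N _ w fun _ => HEq.rfl

theorem eq_var (a b : ι) (h : σ a = σ b) : FO T σ (fun _ v => HEq (v a) (v b)) :=
  ⟨.eq (σ b) ⟨.inl a, h⟩ ⟨.inl b, rfl⟩, fun N v =>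
    ⟨fun e => (cast_heq (congrArg N.1.car h) (v a)).symm.trans (heq_of_eq e),
      fun e => eq_of_heq ((cast_heq (congrArg N.1.car h) (v a)).trans e)⟩⟩

theorem rel (R : L.Rel) : FO T (L.arSrt R) (fun N v => N.1.rel R v) :=
  ⟨.rel R fun j => ⟨.inl j, rfl⟩, fun _ _ => Iff.rfl⟩

theorem all_one {s : L.Srt} {R : (N : Mod T) → N.1.Tup (Sum.elim σ fun _ : Unit => s) → Prop}
    (hR : FO T (Sum.elim σ fun _ : Unit => s) R) :
    FO T σ (fun N v => ∀ x : N.1.car s, R N (Str.Tup.app v fun _ => x)) := by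
  obtain ⟨φ, hφ⟩ := hR
  obtain ⟨φ', h'⟩ := φ.exists_rename (σ' := σ)
    (τ' := (Fin.cons s (fun k : Fin 0 => k.elim0) : Fin 1 → L.Srt))
    (Sum.elim (Sum.elim .inl fun _ => .inr 0) fun k => k.elim0) (by
      rintro ((a | k) | k)
      · rfl
      · rfl
      · exact k.elim0)
  refine ⟨.all s φ', fun N v => forall_congr' fun x => Iff.trans
    (h' N.1 (Str.Tup.app v fun _ => x) (fun k => k.elim0) v _ ?_) (hφ N _)⟩
  rintro ((a | k) | k)
  · rfl
  · rfl
  · exact k.elim0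

theorem all_fin {n : ℕ} : ∀ {ι : Type} {σ : ι → L.Srt} {τ : Fin n → L.Srt}
    {R : (N : Mod T) → N.1.Tup (Sum.elim σ τ) → Prop}, FO T (Sum.elim σ τ) R →
    FO T σ (fun N v => ∀ w : N.1.Tup τ, R N (Str.Tup.app v w)) := by
  induction n with
  | zero =>
    intro ι σ τ R hR
    obtain ⟨S, hS, h⟩ := hR.reindex_heq (τ := σ) (Sum.elim id fun k => k.elim0) (by
      rintro (a | k)
      · rfl
      · exact k.elim0)
    refine hS.congr fun N v => ⟨fun hv w => (h N _ v ?_).1 hv, fun hv =>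
      (h N (Str.Tup.app v fun k => k.elim0) v ?_).2 (hv _)⟩
    · rintro (a | k)
      · rfl
      · exact k.elim0
    · rintro (a | k)
      · rfl
      · exact k.elim0
  | succ n ih =>
    intro ι σ τ R hR
    obtain ⟨S, hS, h⟩ := hR.reindex_heq
      (τ := Sum.elim (Sum.elim σ fun _ : Unit => τ 0) fun k : Fin n => τ k.succ)
      (Sum.elim (fun a => .inl (.inl a)) (Fin.cases (.inl (.inr ())) fun k => .inr k)) (by
        rintro (a | k)
        · rfl
        · exact Fin.cases rfl (fun _ => rfl) k)
    refine (ih hS).all_one.congr fun N v => ⟨fun hv w => ?_, fun hv x w => ?_⟩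
    · refine (h N _ _ ?_).1 (hv (w 0) fun k => w k.succ)
      rintro (a | k)
      · rfl
      · exact Fin.cases HEq.rfl (fun _ => HEq.rfl) k
    · refine (h N (Str.Tup.app v (Fin.cases x w : (k : Fin (n + 1)) → N.1.car (τ k))) _ ?_).2 (hv _)
      rintro (a | k)
      · rfl
      · exact Fin.cases HEq.rfl (fun _ => HEq.rfl) k

theorem all [Finite κ] {R : (N : Mod T) → N.1.Tup (Sum.elim σ τ) → Prop}
    (hR : FO T (Sum.elim σ τ) R) :
    FO T σ (fun N v => ∀ w : N.1.Tup τ, R N (Str.Tup.app v w)) := by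
  obtain ⟨n, ⟨e⟩⟩ := Finite.exists_equiv_fin κ
  obtain ⟨S, hS, h⟩ := hR.reindex_heq (τ := Sum.elim σ fun k => τ (e.symm k)) (Sum.map id e) (by
    rintro (a | k)
    · rfl
    · exact congrArg τ (e.symm_apply_apply k))
  refine hS.all_fin.congr fun N v => ⟨fun hv w => ?_, fun hv w => ?_⟩
  · refine (h N _ _ ?_).1 (hv fun k => w (e.symm k))
    rintro (a | k)
    · rfl
    · show HEq (w (e.symm (e k))) (w k)
      rw [e.symm_apply_apply]
  · refine (h N (Str.Tup.app v fun k => cast (by simp) (w (e k))) _ ?_).2 (hv _)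
    rintro (a | k)
    · rfl
    · exact (cast_heq _ _).symm

end FO

end MSLang

namespace MSLang

/-! ## Uniformly definable sets -/

/-- A set `car N` for every model `N` of `T`, with a definable way of representing its points by
tuples. -/
structure USet {L : MSLang.{u}} (T : L.Theory) where
  car : Mod T → Type u
  ι : Type
  fin : Finite ι
  srt : ι → L.Srt
  val : (N : Mod T) → N.1.Tup srt → car N → Prop
  surj : ∀ N s, ∃ v, val N v s
  func : ∀ N v s s', val N v s → val N v s' → s = s'
  dom : FO T srt (fun N v => ∃ s, val N v s)
  eqv : FO T (Sum.elim srt srt) (fun N v => ∃ s, val N (fun j => v (.inl j)) s ∧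
    val N (fun j => v (.inr j)) s)

attribute [instance] USet.fin

variable {L : MSLang.{u}} {T : L.Theory}

/-- A family of subsets of `U` is definable. -/
def BDef (U : USet T) (R : (N : Mod T) → U.car N → Prop) : Prop :=
  FO T U.srt (fun N v => ∃ s, U.val N v s ∧ R N s)

/-- A family of maps is given by a choice of coordinates. -/
def StructMap (U V : USet T) (f : (N : Mod T) → U.car N → V.car N) : Prop :=
  ∃ ρ : V.ι → U.ι, (∀ j, U.srt (ρ j) = V.srt j) ∧
    ∀ (N : Mod T) (v : N.1.Tup U.srt) (w : N.1.Tup V.srt) (s : U.car N), U.val N v s →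
      (∀ j, HEq (v (ρ j)) (w j)) → V.val N w (f N s)

namespace BDef

variable {U V : USet T} {R S : (N : Mod T) → U.car N → Prop}

theorem iff_of_val (R : (N : Mod T) → U.car N → Prop) {N : Mod T} {v : N.1.Tup U.srt}
    {s : U.car N} (h : U.val N v s) : (∃ s, U.val N v s ∧ R N s) ↔ R N s :=
  ⟨fun ⟨_, h', hs⟩ => U.func N v _ _ h' h ▸ hs, fun hs => ⟨s, h, hs⟩⟩

theorem of_fo {F : (N : Mod T) → N.1.Tup U.srt → Prop} (hF : FO T U.srt F)
    (h : ∀ N v s, U.val N v s → (F N v ↔ R N s)) : BDef U R :=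
  (U.dom.and hF).congr fun N v => ⟨fun ⟨⟨s, hs⟩, hv⟩ => ⟨s, hs, (h N v s hs).1 hv⟩,
    fun ⟨s, hs, hR⟩ => ⟨⟨s, hs⟩, (h N v s hs).2 hR⟩⟩

theorem congr (hR : BDef U R) (h : ∀ N s, R N s ↔ S N s) : BDef U S := by
  rwa [show S = R from funext fun N => funext fun s => propext (h N s).symm]

theorem bot : BDef U (fun _ _ => False) := of_fo .bot fun _ _ _ _ => Iff.rfl

theorem imp (hR : BDef U R) (hS : BDef U S) : BDef U (fun N s => R N s → S N s) :=
  of_fo (FO.imp hR hS) fun _ _ _ h => imp_congr (iff_of_val R h) (iff_of_val S h)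

theorem reindex {R : (N : Mod T) → V.car N → Prop} (hR : BDef V R)
    {f : (N : Mod T) → U.car N → V.car N} (hf : StructMap U V f) : BDef U (fun N s => R N (f N s)) := by
  obtain ⟨ρ, hρ, hv⟩ := hf
  obtain ⟨S, hS, h⟩ := FO.reindex_heq hR ρ hρ
  refine of_fo hS fun N v s hs => ?_
  have e : ∀ j, HEq (v (ρ j)) (cast (congrArg N.1.car (hρ j)) (v (ρ j))) :=
    fun j => (cast_heq _ _).symm
  rw [h N (fun j => cast (congrArg N.1.car (hρ j)) (v (ρ j))) v e]
  exact iff_of_val R (hv N v _ s hs e)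

end BDef

namespace USet

/-- Tuples. -/
@[reducible] def raw (T : L.Theory) {ι : Type} [Finite ι] (σ : ι → L.Srt) : USet T where
  car N := N.1.Tup σ
  ι := ι
  fin := inferInstance
  srt := σ
  val _ v s := v = s
  surj _ s := ⟨s, rfl⟩
  func _ _ _ _ h h' := h.symm.trans h'
  dom := FO.top.congr fun _ _ => by simp
  eqv := (FO.finite_all fun j => FO.eq_var (σ := Sum.elim σ σ) (.inl j) (.inr j) rfl).congr
    fun N v => ⟨fun h => ⟨_, funext fun j => eq_of_heq (h j), rfl⟩,
      fun ⟨_, h, h'⟩ j => heq_of_eq ((congrFun h j).trans (congrFun h' j).symm)⟩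

/-- Products of two sets. -/
@[reducible] def prod (U V : USet T) : USet T where
  car N := U.car N × V.car N
  ι := U.ι ⊕ V.ι
  fin := inferInstance
  srt := Sum.elim U.srt V.srt
  val N v p := U.val N (fun j => v (.inl j)) p.1 ∧ V.val N (fun j => v (.inr j)) p.2
  surj N p := by
    obtain ⟨v, hv⟩ := U.surj N p.1
    obtain ⟨w, hw⟩ := V.surj N p.2
    exact ⟨Str.Tup.app v w, hv, hw⟩
  func N v p q h h' := Prod.ext (U.func N _ _ _ h.1 h'.1) (V.func N _ _ _ h.2 h'.2)
  dom := (FO.and (FO.reindex (ρ := Sum.inl) (τ := Sum.elim U.srt V.srt) U.dom)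
    (FO.reindex (ρ := Sum.inr) (τ := Sum.elim U.srt V.srt) V.dom)).congr fun N v =>
      ⟨fun ⟨⟨s, hs⟩, ⟨t, ht⟩⟩ => ⟨(s, t), hs, ht⟩, fun ⟨p, h, h'⟩ => ⟨⟨_, h⟩, ⟨_, h'⟩⟩⟩
  eqv := by
    obtain ⟨R, hR, h⟩ := U.eqv.reindex_heq
      (τ := Sum.elim (Sum.elim U.srt V.srt) (Sum.elim U.srt V.srt))
      (Sum.map Sum.inl Sum.inl) (by rintro (j | j) <;> rfl)
    obtain ⟨R', hR', h'⟩ := V.eqv.reindex_heq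
      (τ := Sum.elim (Sum.elim U.srt V.srt) (Sum.elim U.srt V.srt))
      (Sum.map Sum.inr Sum.inr) (by rintro (j | j) <;> rfl)
    refine (hR.and hR').congr fun N v => ?_
    rw [h N (Str.Tup.app (fun j => v (.inl (.inl j))) (fun j => v (.inr (.inl j)))) v
        (by rintro (j | j) <;> rfl),
      h' N (Str.Tup.app (fun j => v (.inl (.inr j))) (fun j => v (.inr (.inr j)))) v
        (by rintro (j | j) <;> rfl)]
    exact ⟨fun ⟨⟨s, hs⟩, ⟨t, ht⟩⟩ => ⟨(s, t), ⟨hs.1, ht.1⟩, hs.2, ht.2⟩,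
      fun ⟨p, h, h'⟩ => ⟨⟨p.1, h.1, h'.1⟩, ⟨p.2, h.2, h'.2⟩⟩⟩

/-- Finite products. -/
@[reducible] def pi {β : Type} [Finite β] (U : β → USet T) : USet T where
  car N := (b : β) → (U b).car N
  ι := (b : β) × (U b).ι
  fin := inferInstance
  srt x := (U x.1).srt x.2
  val N v p := ∀ b, (U b).val N (fun j => v ⟨b, j⟩) (p b)
  surj N p := by
    choose v hv using fun b => (U b).surj N (p b)
    exact ⟨fun x => v x.1 x.2, hv⟩
  func N v p q h h' := funext fun b => (U b).func N _ _ _ (h b) (h' b)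
  dom := (FO.finite_all fun b => FO.reindex (ρ := Sigma.mk b)
    (τ := fun x : (b : β) × (U b).ι => (U x.1).srt x.2) (U b).dom).congr fun N v =>
      ⟨fun h => by choose p hp using h; exact ⟨p, hp⟩, fun ⟨p, hp⟩ b => ⟨p b, hp b⟩⟩
  eqv := by
    choose R hR h using fun b => (U b).eqv.reindex_heq
      (τ := Sum.elim (fun x : (b : β) × (U b).ι => (U x.1).srt x.2)
        (fun x : (b : β) × (U b).ι => (U x.1).srt x.2))
      (Sum.map (fun j => ⟨b, j⟩) (fun j => ⟨b, j⟩)) (by rintro (j | j) <;> rfl)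
    refine (FO.finite_all hR).congr fun N v => ?_
    have h := fun b => h b N (Str.Tup.app (fun j => v (.inl ⟨b, j⟩)) (fun j => v (.inr ⟨b, j⟩))) v
        (by rintro (j | j) <;> rfl)
    simp only [h]
    exact ⟨fun h => by choose p hp using h; exact ⟨p, fun b => (hp b).1, fun b => (hp b).2⟩,
      fun ⟨p, hp, hp'⟩ b => ⟨p b, hp b, hp' b⟩⟩

/-- A one-point set. -/
@[reducible] def unit (T : L.Theory) : USet T := raw T (fun e : Empty => e.elim)

end USet

namespace StructMap

variable {U V W : USet T}

theorem id : StructMap U U (fun _ x => x) :=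
  ⟨fun j => j, fun _ => rfl, fun _ v w _ h e => by
    rwa [← show v = w from funext fun j => eq_of_heq (e j)]⟩

theorem fst' {f : (N : Mod T) → W.car N → U.car N × V.car N} (h : StructMap W (U.prod V) f) :
    StructMap W U (fun N x => (f N x).1) := by
  obtain ⟨ρ, hρ, hv⟩ := h
  refine ⟨fun j => ρ (.inl j), fun j => hρ (.inl j), fun N v w s hs e => ?_⟩
  have := (hv N v (fun j => cast (congrArg N.1.car (hρ j)) (v (ρ j))) s hs
    fun j => (cast_heq _ _).symm).1
  rwa [show (fun j : U.ι => cast (congrArg N.1.car (hρ (.inl j))) (v (ρ (.inl j)))) = w from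
    funext fun j => eq_of_heq ((cast_heq _ _).trans (e j))] at this

theorem snd' {f : (N : Mod T) → W.car N → U.car N × V.car N} (h : StructMap W (U.prod V) f) :
    StructMap W V (fun N x => (f N x).2) := by
  obtain ⟨ρ, hρ, hv⟩ := h
  refine ⟨fun j => ρ (.inr j), fun j => hρ (.inr j), fun N v w s hs e => ?_⟩
  have := (hv N v (fun j => cast (congrArg N.1.car (hρ j)) (v (ρ j))) s hs
    fun j => (cast_heq _ _).symm).2
  rwa [show (fun j : V.ι => cast (congrArg N.1.car (hρ (.inr j))) (v (ρ (.inr j)))) = w from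
    funext fun j => eq_of_heq ((cast_heq _ _).trans (e j))] at this

theorem pair {f : (N : Mod T) → W.car N → U.car N} {g : (N : Mod T) → W.car N → V.car N}
    (hf : StructMap W U f) (hg : StructMap W V g) :
    StructMap W (U.prod V) (fun N x => (f N x, g N x)) := by
  obtain ⟨ρ, hρ, hv⟩ := hf
  obtain ⟨ρ', hρ', hv'⟩ := hg
  refine ⟨Sum.elim ρ ρ', by rintro (j | j); exacts [hρ j, hρ' j], fun N v w s hs e => ⟨?_, ?_⟩⟩
  · exact hv N v _ s hs fun j => e (.inl j)
  · exact hv' N v _ s hs fun j => e (.inr j)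

theorem app {β : Type} [Finite β] {V : β → USet T} {f : (N : Mod T) → W.car N → (USet.pi V).car N}
    (h : StructMap W (USet.pi V) f) (b : β) : StructMap W (V b) (fun N x => f N x b) := by
  obtain ⟨ρ, hρ, hv⟩ := h
  refine ⟨fun j => ρ ⟨b, j⟩, fun j => hρ ⟨b, j⟩, fun N v w s hs e => ?_⟩
  have := (hv N v (fun j => cast (congrArg N.1.car (hρ j)) (v (ρ j))) s hs
    fun j => (cast_heq _ _).symm) b
  rwa [show (fun j : (V b).ι => cast (congrArg N.1.car (hρ ⟨b, j⟩)) (v (ρ ⟨b, j⟩))) = w from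
    funext fun j => eq_of_heq ((cast_heq _ _).trans (e j))] at this

theorem tuple {β : Type} [Finite β] {V : β → USet T}
    {f : (N : Mod T) → W.car N → (USet.pi V).car N}
    (h : ∀ b, StructMap W (V b) (fun N x => f N x b)) : StructMap W (USet.pi V) f := by
  choose ρ hρ hv using h
  exact ⟨fun x => ρ x.1 x.2, fun x => hρ x.1 x.2, fun N v w s hs e b =>
    hv b N v _ s hs fun j => e ⟨b, j⟩⟩

theorem to_unit : StructMap W (USet.unit T) (fun _ _ (e : Empty) => e.elim) :=
  ⟨fun e => e.elim, fun e => e.elim, fun _ _ _ _ _ _ => funext fun e => e.elim⟩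

end StructMap

namespace BDef

variable {U V : USet T}

theorem all {R : (N : Mod T) → U.car N → V.car N → Prop}
    (hR : BDef (U.prod V) (fun N p => R N p.1 p.2)) : BDef U (fun N x => ∀ y, R N x y) := by
  -- A quantifier over points becomes a quantifier over tuples, relativized to the tuples that
  -- represent a point.
  have h := FO.all (σ := U.srt) (τ := V.srt)
    ((FO.reindex (ρ := Sum.inr) (τ := Sum.elim U.srt V.srt) V.dom).imp hR)
  refine of_fo h fun N v s hs => ⟨fun h' y => ?_, fun h' w hw => ?_⟩
  · obtain ⟨w, hw⟩ := V.surj N y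
    exact (iff_of_val (U := U.prod V) (fun N p => R N p.1 p.2) (s := (s, y))
      (v := Str.Tup.app v w) ⟨hs, hw⟩).1 (h' w ⟨y, hw⟩)
  · obtain ⟨y, hy⟩ := hw
    exact ⟨(s, y), ⟨hs, hy⟩, h' y⟩

theorem eq : BDef (U.prod U) (fun _ p => p.1 = p.2) :=
  U.eqv.congr fun _ _ => ⟨fun ⟨s, h⟩ => ⟨(s, s), h, rfl⟩,
    fun ⟨⟨s, _⟩, h, e⟩ => by cases e; exact ⟨s, h⟩⟩

theorem val : BDef ((USet.raw T U.srt).prod U) (fun N p => U.val N p.1 p.2) :=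
  of_fo (U := (USet.raw T U.srt).prod U) (F := fun N v => ∃ s, U.val N (fun j => v (.inl j)) s ∧
    U.val N (fun j => v (.inr j)) s) U.eqv fun N v p hp => by
      obtain ⟨h, h'⟩ := hp
      rw [← h]
      exact ⟨fun ⟨s, e, e'⟩ => U.func N _ _ _ e' h' ▸ e, fun e => ⟨_, e, h'⟩⟩

end BDef

end MSLang

namespace MSLang

variable {L : MSLang.{u}} {T : L.Theory}

theorem StructMap.comp {U V W : USet T} {f : (N : Mod T) → U.car N → V.car N}
    {g : (N : Mod T) → V.car N → W.car N} (hg : StructMap V W g) (hf : StructMap U V f) :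
    StructMap U W (fun N x => g N (f N x)) := by
  obtain ⟨ρ, hρ, hv⟩ := hf
  obtain ⟨ρ', hρ', hv'⟩ := hg
  refine ⟨fun j => ρ (ρ' j), fun j => (hρ _).trans (hρ' j), fun N v w s hs e => ?_⟩
  exact hv' N (fun j => cast (congrArg N.1.car (hρ j)) (v (ρ j))) w _
    (hv N v _ s hs fun j => (cast_heq _ _).symm) fun j => (cast_heq _ _).trans (e j)

/-! ## Definability with parameters -/

/-- A class of models of `T`, with a set of named points of uniformly definable sets. -/
structure Ctx (T : L.Theory) where
  Md : Type (u + 1)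
  mod : Md → Mod T
  K : Type u
  P : K → USet T
  pt : (p : K) → (N : Md) → (P p).car (mod N)

/-- All models, no parameters. -/
@[reducible] def Ctx.triv (T : L.Theory) : Ctx T where
  Md := Mod T
  mod N := N
  K := PEmpty
  P p := p.elim
  pt p := p.elim

/-- Definability of a family of subsets of `U`, with the parameters of `C`. -/
def Def (C : Ctx T) (U : USet T) (R : (N : C.Md) → U.car (C.mod N) → Prop) : Prop :=
  ∃ (β : Type) (_ : Finite β) (t : β → C.K)
    (R' : (N : Mod T) → ((b : β) → (C.P (t b)).car N) × U.car N → Prop),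
    BDef ((USet.pi fun b => C.P (t b)).prod U) R' ∧
      ∀ N u, R N u ↔ R' (C.mod N) (fun b => C.pt (t b) N, u)

/-- Definability of a family of maps. -/
def DefMap (C : Ctx T) (U V : USet T)
    (f : (N : C.Md) → U.car (C.mod N) → V.car (C.mod N)) : Prop :=
  Def C (U.prod V) (fun N p => f N p.1 = p.2)

namespace Def

variable {C : Ctx T} {U V W : USet T} {R S : (N : C.Md) → U.car (C.mod N) → Prop}

theorem congr (hR : Def C U R) (h : ∀ N s, R N s ↔ S N s) : Def C U S := by
  rwa [show S = R from funext fun N => funext fun s => propext (h N s).symm]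

theorem of_bdef {R : (N : Mod T) → U.car N → Prop} (hR : BDef U R) :
    Def C U (fun N s => R (C.mod N) s) :=
  ⟨Empty, inferInstance, fun e => e.elim, fun N p => R N p.2, hR.reindex (.snd' .id),
    fun _ _ => Iff.rfl⟩

/-- The trivial context names no point, so the index type of its parameter tuple is empty and the
tuple can be dropped. -/
theorem bdef {R : (N : Mod T) → U.car N → Prop} (h : Def (Ctx.triv T) U R) : BDef U R := by
  obtain ⟨β, _, t, R', hR', h⟩ := h
  have : IsEmpty β := ⟨fun b => (t b).elim⟩
  have hf : StructMap U ((USet.pi fun b => (Ctx.triv T).P (t b)).prod U)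
      (fun N s => (fun b => (Ctx.triv T).pt (t b) N, s)) :=
    StructMap.pair (.tuple fun b => isEmptyElim b) .id
  exact (hR'.reindex hf).congr fun N s => (h N s).symm

theorem lift {R : (N : Mod T) → U.car N → Prop} (h : Def (Ctx.triv T) U R) :
    Def C U (fun N s => R (C.mod N) s) := of_bdef h.bdef

theorem bot : Def C U (fun _ _ => False) := of_bdef .bot

theorem imp (hR : Def C U R) (hS : Def C U S) : Def C U (fun N s => R N s → S N s) := by
  obtain ⟨β, _, t, R', hR', h⟩ := hR
  obtain ⟨γ, _, t', S', hS', h'⟩ := hS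
  refine ⟨β ⊕ γ, inferInstance, Sum.elim t t', fun N p =>
    R' N (fun b => p.1 (.inl b), p.2) → S' N (fun b => p.1 (.inr b), p.2), ?_,
    fun N u => imp_congr (h N u) (h' N u)⟩
  refine BDef.imp ?_ ?_
  · exact hR'.reindex (U := (USet.pi fun b => C.P (Sum.elim t t' b)).prod U)
      (f := fun N p => (fun b => p.1 (.inl b), p.2))
      (.pair (.tuple fun b => .app (.fst' .id) (Sum.inl b)) (.snd' .id))
  · exact hS'.reindex (U := (USet.pi fun b => C.P (Sum.elim t t' b)).prod U)
      (f := fun N p => (fun b => p.1 (.inr b), p.2))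
      (.pair (.tuple fun b => .app (.fst' .id) (Sum.inr b)) (.snd' .id))

theorem all {R : (N : C.Md) → U.car (C.mod N) → V.car (C.mod N) → Prop}
    (hR : Def C (U.prod V) (fun N p => R N p.1 p.2)) : Def C U (fun N x => ∀ y, R N x y) := by
  obtain ⟨β, _, t, R', hR', h⟩ := hR
  refine ⟨β, inferInstance, t, fun N p => ∀ y, R' N (p.1, (p.2, y)), BDef.all ?_,
    fun N u => forall_congr' fun y => h N (u, y)⟩
  exact hR'.reindex (U := ((USet.pi fun b => C.P (t b)).prod U).prod V)
    (f := fun N p => (p.1.1, (p.1.2, p.2)))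
    (.pair (.fst' (.fst' .id)) (.pair (.snd' (.fst' .id)) (.snd' .id)))

theorem reindex {R : (N : C.Md) → V.car (C.mod N) → Prop} (hR : Def C V R)
    {f : (N : Mod T) → U.car N → V.car N} (hf : StructMap U V f) :
    Def C U (fun N s => R N (f (C.mod N) s)) := by
  obtain ⟨β, _, t, R', hR', h⟩ := hR
  refine ⟨β, inferInstance, t, fun N p => R' N (p.1, f N p.2), ?_, fun N u => h N _⟩
  exact hR'.reindex (U := (USet.pi fun b => C.P (t b)).prod U) (f := fun N p => (p.1, f N p.2))
    (.pair (StructMap.fst' .id) (hf.comp (StructMap.snd' .id)))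

theorem eq : Def C (U.prod U) (fun _ p => p.1 = p.2) := of_bdef .eq

theorem not (hR : Def C U R) : Def C U (fun N v => ¬ R N v) := hR.imp Def.bot

theorem top : Def C U (fun _ _ => True) := Def.bot.not.congr fun _ _ => by simp

theorem and (hR : Def C U R) (hS : Def C U S) : Def C U (fun N v => R N v ∧ S N v) :=
  (hR.imp hS.not).not.congr fun _ _ => by tauto

theorem iff (hR : Def C U R) (hS : Def C U S) : Def C U (fun N v => R N v ↔ S N v) :=
  ((hR.imp hS).and (hS.imp hR)).congr fun _ _ => by tauto

theorem ex {R : (N : C.Md) → U.car (C.mod N) → V.car (C.mod N) → Prop}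
    (hR : Def C (U.prod V) (fun N p => R N p.1 p.2)) : Def C U (fun N x => ∃ y, R N x y) :=
  (Def.all (R := fun N x y => ¬ R N x y) hR.not).not.congr fun _ _ => by simp

theorem finite_all {β : Type*} [Finite β] {R : β → (N : C.Md) → U.car (C.mod N) → Prop}
    (h : ∀ b, Def C U (R b)) : Def C U (fun N v => ∀ b, R b N v) := by
  have key : ∀ s : Set β, Def C U (fun N v => ∀ b ∈ s, R b N v) := fun s => by
    induction s, s.toFinite using Set.Finite.induction_on with
    | empty => exact Def.top.congr fun _ _ => by simp
    | @insert a _ _ _ ih => exact ((h a).and ih).congr fun _ _ => by simp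
  exact (key Set.univ).congr fun _ _ => by simp

/-- In contrast to `reindex`, which only selects coordinates, substituting an arbitrary definable
map costs an existential quantifier over its value. -/
theorem comp {f : (N : C.Md) → U.car (C.mod N) → V.car (C.mod N)}
    {R : (N : C.Md) → V.car (C.mod N) → Prop} (hR : Def C V R) (hf : DefMap C U V f) :
    Def C U (fun N x => R N (f N x)) :=
  (Def.ex (R := fun N x y => f N x = y ∧ R N y)
    (Def.and hf (hR.reindex (U := U.prod V) (.snd' .id)))).congr fun _ _ => by simp

end Def

namespace DefMap

variable {C : Ctx T} {U V W : USet T}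

theorem of_struct {f : (N : Mod T) → U.car N → V.car N} (hf : StructMap U V f) :
    DefMap C U V (fun N x => f (C.mod N) x) :=
  Def.eq.reindex (U := U.prod V) (f := fun N p => (f N p.1, p.2))
    (.pair (hf.comp (.fst' .id)) (.snd' .id))

theorem id : DefMap C U U (fun _ x => x) := of_struct .id

theorem lift {f : (N : Mod T) → U.car N → V.car N} (hf : DefMap (Ctx.triv T) U V f) :
    DefMap C U V (fun N x => f (C.mod N) x) := Def.lift hf

theorem congr {f g : (N : C.Md) → U.car (C.mod N) → V.car (C.mod N)} (hf : DefMap C U V f)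
    (h : ∀ N x, f N x = g N x) : DefMap C U V g := by
  rwa [show g = f from funext fun N => funext fun s => (h N s).symm]

theorem comp {g : (N : C.Md) → V.car (C.mod N) → W.car (C.mod N)}
    {f : (N : C.Md) → U.car (C.mod N) → V.car (C.mod N)} (hg : DefMap C V W g)
    (hf : DefMap C U V f) : DefMap C U W (fun N x => g N (f N x)) := by
  refine Def.congr (R := fun N (p : U.car _ × W.car _) => ∃ y : V.car _, f N p.1 = y ∧ g N y = p.2)
    (Def.ex (Def.and ?_ ?_)) fun _ _ => by simp
  · exact Def.reindex (U := (U.prod W).prod V) hf (f := fun N p => (p.1.1, p.2))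
      (.pair (.fst' (.fst' .id)) (.snd' .id))
  · exact Def.reindex (U := (U.prod W).prod V) hg (f := fun N p => (p.2, p.1.2))
      (.pair (.snd' .id) (.snd' (.fst' .id)))

theorem fst' {f : (N : C.Md) → W.car (C.mod N) → U.car (C.mod N) × V.car (C.mod N)}
    (h : DefMap C W (U.prod V) f) : DefMap C W U (fun N x => (f N x).1) :=
  (of_struct (U := U.prod V) (f := fun _ p => p.1) (.fst' .id)).comp h

theorem snd' {f : (N : C.Md) → W.car (C.mod N) → U.car (C.mod N) × V.car (C.mod N)}
    (h : DefMap C W (U.prod V) f) : DefMap C W V (fun N x => (f N x).2) :=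
  (of_struct (U := U.prod V) (f := fun _ p => p.2) (.snd' .id)).comp h

theorem fst : DefMap C (U.prod V) U (fun _ p => p.1) := of_struct (.fst' .id)

theorem snd : DefMap C (U.prod V) V (fun _ p => p.2) := of_struct (.snd' .id)

theorem pair {f : (N : C.Md) → W.car (C.mod N) → U.car (C.mod N)}
    {g : (N : C.Md) → W.car (C.mod N) → V.car (C.mod N)}
    (hf : DefMap C W U f) (hg : DefMap C W V g) :
    DefMap C W (U.prod V) (fun N x => (f N x, g N x)) := by
  refine Def.congr (R := fun N (p : W.car _ × U.car _ × V.car _) => f N p.1 = p.2.1 ∧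
    g N p.1 = p.2.2) (Def.and ?_ ?_) fun _ _ => by simp [Prod.ext_iff]
  · exact Def.reindex (U := W.prod (U.prod V)) hf (f := fun N p => (p.1, p.2.1))
      (.pair (.fst' .id) (.fst' (.snd' .id)))
  · exact Def.reindex (U := W.prod (U.prod V)) hg (f := fun N p => (p.1, p.2.2))
      (.pair (.fst' .id) (.snd' (.snd' .id)))

theorem app {β : Type} [Finite β] {V : β → USet T}
    {f : (N : C.Md) → W.car (C.mod N) → (b : β) → (V b).car (C.mod N)}
    (h : DefMap C W (USet.pi V) f) (b : β) : DefMap C W (V b) (fun N x => f N x b) :=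
  (of_struct (U := USet.pi V) (f := fun _ p => p b) (.app .id b)).comp h

theorem tuple {β : Type} [Finite β] {V : β → USet T}
    {f : (N : C.Md) → W.car (C.mod N) → (b : β) → (V b).car (C.mod N)}
    (h : ∀ b, DefMap C W (V b) (fun N x => f N x b)) : DefMap C W (USet.pi V) f := by
  refine Def.congr (R := fun N (p : W.car _ × ((b : β) → (V b).car _)) => ∀ b, f N p.1 b = p.2 b)
    (Def.finite_all fun b => ?_) fun _ _ => by simp [funext_iff]
  exact Def.reindex (U := W.prod (USet.pi V)) (h b) (f := fun N p => (p.1, p.2 b))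
      (.pair (.fst' .id) (.app (.snd' .id) b))

theorem param (p : C.K) : DefMap C U (C.P p) (fun N _ => C.pt p N) := by
  refine ⟨Unit, inferInstance, fun _ => p, fun N q => q.1 () = q.2.2, ?_, fun N u => Iff.rfl⟩
  exact BDef.eq.reindex (U := (USet.pi fun _ : Unit => C.P p).prod (U.prod (C.P p)))
    (f := fun N q => (q.1 (), q.2.2)) (.pair (.app (.fst' .id) ()) (.snd' (.snd' .id)))

theorem symm {f : (N : C.Md) → U.car (C.mod N) → V.car (C.mod N)}
    {g : (N : C.Md) → V.car (C.mod N) → U.car (C.mod N)} (hf : DefMap C U V f)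
    (h : ∀ N x y, f N x = y ↔ g N y = x) : DefMap C V U g :=
  (Def.reindex (U := V.prod U) hf (f := fun N p => (p.2, p.1))
    (.pair (.snd' .id) (.fst' .id))).congr fun N p => h N p.2 p.1

end DefMap

namespace Def

variable {C : Ctx T} {U V W X : USet T}

theorem comp2 {R : (N : C.Md) → V.car (C.mod N) → W.car (C.mod N) → Prop}
    (hR : Def C (V.prod W) (fun N p => R N p.1 p.2))
    {f : (N : C.Md) → U.car (C.mod N) → V.car (C.mod N)}
    {g : (N : C.Md) → U.car (C.mod N) → W.car (C.mod N)}
    (hf : DefMap C U V f) (hg : DefMap C U W g) : Def C U (fun N x => R N (f N x) (g N x)) :=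
  hR.comp (hf.pair hg)

theorem comp3 {R : (N : C.Md) → V.car (C.mod N) → W.car (C.mod N) → X.car (C.mod N) → Prop}
    (hR : Def C (V.prod (W.prod X)) (fun N p => R N p.1 p.2.1 p.2.2))
    {f : (N : C.Md) → U.car (C.mod N) → V.car (C.mod N)}
    {g : (N : C.Md) → U.car (C.mod N) → W.car (C.mod N)}
    {h : (N : C.Md) → U.car (C.mod N) → X.car (C.mod N)}
    (hf : DefMap C U V f) (hg : DefMap C U W g) (hh : DefMap C U X h) :
    Def C U (fun N x => R N (f N x) (g N x) (h N x)) :=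
  hR.comp (hf.pair (hg.pair hh))

theorem eq2 {f g : (N : C.Md) → U.car (C.mod N) → V.car (C.mod N)}
    (hf : DefMap C U V f) (hg : DefMap C U V g) : Def C U (fun N x => f N x = g N x) :=
  Def.eq.comp (hf.pair hg)

end Def

end MSLang

namespace MSLang

variable {L : MSLang.{u}} {T : L.Theory}

/-! ## Definable sets as uniformly definable sets -/

/-- Definable subquotients: `r` is the graph of a surjection from a definable subset of `P`, with
definable kernel. -/
@[reducible] def USet.quot (P : USet T) (S : Mod T → Type u) (r : (N : Mod T) → P.car N → S N → Prop)
    (surj : ∀ N s, ∃ p, r N p s) (func : ∀ N p s s', r N p s → r N p s' → s = s')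
    (dom : Def (Ctx.triv T) P (fun N p => ∃ s, r N p s))
    (eqv : Def (Ctx.triv T) (P.prod P) (fun N p => ∃ s, r N p.1 s ∧ r N p.2 s)) : USet T where
  car := S
  ι := P.ι
  fin := P.fin
  srt := P.srt
  val N v s := ∃ p, P.val N v p ∧ r N p s
  surj N s := by
    obtain ⟨p, hp⟩ := surj N s
    obtain ⟨v, hv⟩ := P.surj N p
    exact ⟨v, p, hv, hp⟩
  func N v s s' := by
    rintro ⟨p, hp, h⟩ ⟨p', hp', h'⟩
    obtain rfl := P.func N _ _ _ hp hp'
    exact func N p s s' h h'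
  dom := FO.congr dom.bdef fun N v =>
    ⟨fun ⟨p, hp, s, hs⟩ => ⟨s, p, hp, hs⟩, fun ⟨s, p, hp, hs⟩ => ⟨p, hp, s, hs⟩⟩
  eqv := FO.congr eqv.bdef fun N v =>
    ⟨fun ⟨p, hp, s, hs⟩ => ⟨s, ⟨p.1, hp.1, hs.1⟩, ⟨p.2, hp.2, hs.2⟩⟩,
      fun ⟨s, ⟨p, hp, hs⟩, ⟨q, hq, hs'⟩⟩ => ⟨(p, q), ⟨hp, hq⟩, s, hs, hs'⟩⟩

/-- On representatives (p, p') of a pair (p, s), the relation r(p, s) says that p and p' have a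
common image, which is the definable kernel. -/
theorem Def.quot_rel {C : Ctx T} {P : USet T} {S : Mod T → Type u}
    {r : (N : Mod T) → P.car N → S N → Prop} {surj func dom eqv} :
    Def C (P.prod (P.quot S r surj func dom eqv)) (fun N p => r (C.mod N) p.1 p.2) := by
  refine Def.of_bdef (U := P.prod (P.quot S r surj func dom eqv)) (R := fun N p => r N p.1 p.2)
    (BDef.of_fo (U := P.prod (P.quot S r surj func dom eqv)) eqv.bdef ?_)
  rintro N v ⟨p, s⟩ ⟨hp, p', hp', hs⟩
  refine (BDef.iff_of_val (U := P.prod P) (s := (p, p'))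
    (fun N q => ∃ s, r N q.1 s ∧ r N q.2 s) ⟨hp, hp'⟩).trans ?_
  exact ⟨fun ⟨t, ht, ht'⟩ => func N _ _ _ ht' hs ▸ ht, fun h => ⟨s, h, hs⟩⟩

namespace DSet

/-- The tuple `v` represents the point `x`. -/
def Repr (X : DSet L) (N : L.Str) (v : N.Tup X.srt) (x : X.Pt N) : Prop :=
  ∃ h : N.Sat X.dom v, Quot.mk _ ⟨v, h⟩ = x

theorem exists_repr {X : DSet L} {N : L.Str} (x : X.Pt N) : ∃ v, X.Repr N v x := by
  obtain ⟨⟨v, h⟩, rfl⟩ := Quot.exists_rep x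
  exact ⟨v, h, rfl⟩

theorem def_dom (X : DSet L) :
    Def (Ctx.triv T) (USet.raw T X.srt) (fun N v => ∃ s, X.Repr N.1 v s) := by
  refine Def.of_bdef (C := Ctx.triv T) (U := USet.raw T X.srt)
    (R := fun N v => ∃ s, X.Repr N.1 v s) (BDef.of_fo (FO.of_fml X.dom) ?_)
  rintro N v s (rfl : v = s)
  exact ⟨fun h => ⟨_, h, rfl⟩, fun ⟨_, h, _⟩ => h⟩

theorem def_eqv (X : DSet L) (hX : X.IsValid T) :
    Def (Ctx.triv T) ((USet.raw T X.srt).prod (USet.raw T X.srt))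
      (fun N p => ∃ s, X.Repr N.1 p.1 s ∧ X.Repr N.1 p.2 s) := by
  have h₁ := FO.reindex (ρ := Sum.inl) (τ := Sum.elim X.srt X.srt) (FO.of_fml (T := T) X.dom)
  have h₂ := FO.reindex (ρ := Sum.inr) (τ := Sum.elim X.srt X.srt) (FO.of_fml (T := T) X.dom)
  refine Def.of_bdef (C := Ctx.triv T) (U := (USet.raw T X.srt).prod (USet.raw T X.srt))
    (R := fun N p => ∃ s, X.Repr N.1 p.1 s ∧ X.Repr N.1 p.2 s)
    (BDef.of_fo ((h₁.and h₂).and (FO.of_fml X.eqv)) ?_)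
  rintro N v ⟨p, q⟩ ⟨h, h'⟩
  dsimp only at h h'
  subst h h'
  have e : v = Str.Tup.app (fun j => v (.inl j)) (fun j => v (.inr j)) := by
    funext x
    cases x <;> rfl
  constructor
  · rintro ⟨⟨a, b⟩, c⟩
    refine ⟨_, ⟨a, rfl⟩, ⟨b, (Quot.sound ?_).symm⟩⟩
    rw [e] at c
    exact c
  · rintro ⟨_, ⟨a, rfl⟩, ⟨b, c⟩⟩
    refine ⟨⟨a, b⟩, ?_⟩
    rw [e]
    exact ((hX N.1 N.2).quot_mk_eq_iff _ _).1 c.symm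

/-- A valid definable set, as a uniformly definable set. -/
@[reducible] def toUSet (X : DSet L) (hX : X.IsValid T) : USet T :=
  (USet.raw T X.srt).quot (fun N => X.Pt N.1) (fun N => X.Repr N.1)
    (fun _ => exists_repr) (fun _ _ _ _ ⟨_, h⟩ ⟨_, h'⟩ => h.symm.trans h')
    X.def_dom (X.def_eqv hX)

end DSet

theorem Def.repr {C : Ctx T} {X : DSet L} {hX : X.IsValid T} :
    Def C ((USet.raw T X.srt).prod (X.toUSet hX)) (fun N p => X.Repr (C.mod N).1 p.1 p.2) :=
  Def.quot_rel

/-- The domain and the kernel of the representing relation are given by formulas, and these serve as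
`dom` and `eqv` once the coordinates are enumerated by some `Fin n`. -/
theorem USet.exists_dset (U : USet T) : ∃ (X : DSet L) (hX : X.IsValid T)
    (e : (N : Mod T) → X.Pt N.1 ≃ U.car N),
    DefMap (Ctx.triv T) (X.toUSet hX) U (fun N x => e N x) := by
  obtain ⟨n, ⟨e⟩⟩ := Finite.exists_equiv_fin U.ι
  set τ : Fin n → L.Srt := fun k => U.srt (e.symm k) with hτ
  have hs : ∀ j, τ (e j) = U.srt j := fun j => congrArg U.srt (e.symm_apply_apply j)
  let c : (N : Mod T) → N.1.Tup τ → N.1.Tup U.srt := fun N v j =>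
    cast (congrArg N.1.car (hs j)) (v (e j))
  have hc : ∀ N v j, HEq (v (e j)) (c N v j) := fun N v j => (cast_heq _ _).symm
  have hcs : ∀ (N : Mod T) w, ∃ v, c N v = w := fun N w => ⟨fun k => w (e.symm k), by
    funext j
    refine eq_of_heq ((hc N (fun k => w (e.symm k)) j).symm.trans ?_)
    show HEq (w (e.symm (e j))) (w j)
    rw [e.symm_apply_apply]⟩
  obtain ⟨D, ⟨φ, hφ⟩, hD⟩ := U.dom.reindex_heq (τ := τ) e hs
  obtain ⟨E, ⟨ψ, hψ⟩, hE⟩ := U.eqv.reindex_heq (τ := Sum.elim τ τ) (Sum.map e e) (by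
    rintro (j | j) <;> exact hs j)
  let X : DSet L := ⟨n, τ, φ, ψ⟩
  have hdom : ∀ (N : Mod T) v, N.1.Sat X.dom v ↔ ∃ s, U.val N (c N v) s := fun N v =>
    (hφ N v).trans (hD N _ v (hc N v))
  have heqv : ∀ (N : Mod T) (v w : X.Rep N.1), X.Eqv N.1 v w ↔
      ∃ s, U.val N (c N v.1) s ∧ U.val N (c N w.1) s := fun N v w =>
    (hψ N _).trans (hE N (Str.Tup.app (c N v.1) (c N w.1)) _ (by
      rintro (j | j) <;> exact hc N _ j))
  have hX : X.IsValid T := by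
    intro N hN
    refine ⟨fun v => (heqv ⟨N, hN⟩ v v).2 ?_, fun {v w} h => (heqv ⟨N, hN⟩ w v).2 ?_,
      fun {v w z} h h' => (heqv ⟨N, hN⟩ v z).2 ?_⟩
    · obtain ⟨s, hs⟩ := (hdom ⟨N, hN⟩ v.1).1 v.2
      exact ⟨s, hs, hs⟩
    · obtain ⟨s, h, h'⟩ := (heqv ⟨N, hN⟩ v w).1 h
      exact ⟨s, h', h⟩
    · obtain ⟨s, h₁, h₂⟩ := (heqv ⟨N, hN⟩ v w).1 h
      obtain ⟨s', h₁', h₂'⟩ := (heqv ⟨N, hN⟩ w z).1 h'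
      obtain rfl := U.func _ _ _ _ h₂ h₁'
      exact ⟨s, h₁, h₂'⟩
  choose p hp using fun (N : Mod T) (v : X.Rep N.1) => (hdom N v.1).1 v.2
  let f : (N : Mod T) → X.Pt N.1 → U.car N := fun N => Quot.lift (p N) fun v w h => by
    obtain ⟨s, h, h'⟩ := (heqv N v w).1 h
    exact (U.func N _ _ _ (hp N v) h).trans (U.func N _ _ _ (hp N w) h').symm
  have hf : ∀ N v x, X.Repr N.1 v x → U.val N (c N v) (f N x) := by
    rintro N v _ ⟨h, rfl⟩
    exact hp N ⟨v, h⟩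
  refine ⟨X, hX, fun N => Equiv.ofBijective (f N) ⟨?_, fun s => ?_⟩, ?_⟩
  · rintro ⟨v⟩ ⟨w⟩ h
    refine Quot.sound ((heqv N v w).2 ⟨_, hp N v, ?_⟩)
    have h : p N v = p N w := h
    exact h ▸ hp N w
  · obtain ⟨w, hw⟩ := U.surj N s
    obtain ⟨v, rfl⟩ := hcs N w
    exact ⟨Quot.mk _ ⟨v, (hdom N v).2 ⟨s, hw⟩⟩, U.func N _ _ _ (hf N v _ ⟨_, rfl⟩) hw⟩
  · have hc' : StructMap (USet.raw T τ) (USet.raw T U.srt) c :=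
      ⟨e, hs, fun N v w s (h : v = s) hw => by
        subst h
        exact funext fun j => eq_of_heq ((hw j).symm.trans (hc N v j))⟩
    refine Def.congr (C := Ctx.triv T) (R := fun (N : Mod T) (q : X.Pt N.1 × U.car N) => ∃ v : N.1.Tup X.srt,
      X.Repr N.1 v q.1 ∧ U.val N (c N v) q.2) (Def.ex (V := USet.raw T X.srt) (Def.and ?_ ?_)) ?_
    · exact Def.repr.reindex (U := ((X.toUSet hX).prod U).prod (USet.raw T X.srt))
        (f := fun N p => (p.2, p.1.1)) (.pair (.snd' .id) (.fst' (.fst' .id)))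
    · exact (Def.of_bdef (C := Ctx.triv T) (BDef.val (U := U))).reindex
        (U := ((X.toUSet hX).prod U).prod (USet.raw T X.srt))
        (f := fun N p => (c N p.2, p.1.2)) (.pair (hc'.comp (.snd' .id)) (.snd' (.fst' .id)))
    · rintro N ⟨x, s⟩
      constructor
      · rintro ⟨v, hv, h⟩
        exact U.func N _ _ _ (hf N v x hv) h
      · intro h
        obtain ⟨v, hv⟩ := DSet.exists_repr x
        exact ⟨v, hv, h ▸ hf N v x hv⟩

/-! ## Definable relations -/

theorem DRel.holds_iff {β : Type} {X : β → DSet L} (φ : DRel X) (N : L.Str) (p : Pts N X) :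
    φ.Holds N p ↔ ∃ w : N.Tup (fun jk : (j : β) × Fin (X j).n => (X jk.1).srt jk.2),
      (∀ b, (X b).Repr N (fun k => w ⟨b, k⟩) (p b)) ∧
        N.Sat (σ := fun jk : (j : β) × Fin (X j).n => (X jk.1).srt jk.2) φ w :=
  ⟨fun ⟨r, h, h'⟩ => ⟨fun jk => (r jk.1).1 jk.2, fun b => ⟨(r b).2, h b⟩, h'⟩,
    fun ⟨w, h, h'⟩ => ⟨fun b => ⟨fun k => w ⟨b, k⟩, (h b).1⟩, fun b => (h b).2, h'⟩⟩

theorem DRel.def_holds {C : Ctx T} {β : Type} [Finite β] {X : β → DSet L}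
    (hX : ∀ b, (X b).IsValid T) (φ : DRel X) :
    Def C (USet.pi fun b => (X b).toUSet (hX b)) (fun N p => φ.Holds (C.mod N).1 p) := by
  refine Def.lift (U := USet.pi fun b => (X b).toUSet (hX b)) (R := fun N p => φ.Holds N.1 p)
    (Def.congr (C := Ctx.triv T) (R := fun (N : Mod T) (p : (b : β) → (X b).Pt N.1) =>
      ∃ w : N.1.Tup (fun jk : (j : β) × Fin (X j).n => (X jk.1).srt jk.2),
        (∀ b, (X b).Repr N.1 (fun k => w ⟨b, k⟩) (p b)) ∧
        N.1.Sat (σ := fun jk : (j : β) × Fin (X j).n => (X jk.1).srt jk.2) φ w)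
    (Def.ex (V := USet.raw T (fun jk : (j : β) × Fin (X j).n => (X jk.1).srt jk.2))
      (Def.and (Def.finite_all fun b => ?_) ?_)) fun N p => (φ.holds_iff N.1 p).symm)
  · refine Def.repr.reindex (U := (USet.pi fun b => (X b).toUSet (hX b)).prod
      (USet.raw T (fun jk : (j : β) × Fin (X j).n => (X jk.1).srt jk.2)))
      (f := fun N p => (fun k => p.2 ⟨b, k⟩, p.1 b)) (.pair ?_ (.app (.fst' .id) b))
    refine StructMap.comp (V := USet.raw T (fun jk : (j : β) × Fin (X j).n => (X jk.1).srt jk.2))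
      (W := USet.raw T (X b).srt) (g := fun N w k => w ⟨b, k⟩) ?_ (.snd' .id)
    exact ⟨fun k => ⟨b, k⟩, fun _ => rfl, fun N v w s (h : v = s) e => by
      subst h
      exact funext fun k => (eq_of_heq (e k)).symm⟩
  · refine Def.of_bdef (U := (USet.pi fun b => (X b).toUSet (hX b)).prod
      (USet.raw T (fun jk : (j : β) × Fin (X j).n => (X jk.1).srt jk.2)))
      (R := fun N p => N.1.Sat (σ := fun jk : (j : β) × Fin (X j).n =>
      (X jk.1).srt jk.2) φ p.2) (BDef.reindex (V := USet.raw T _)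
        (R := fun N v => N.1.Sat φ v) ?_ (.snd' .id))
    exact BDef.of_fo (FO.of_fml φ) fun N v s (h : v = s) => h ▸ Iff.rfl

theorem Def.exists_drel {β : Type} [Finite β] {X : β → DSet L}
    (hX : ∀ b, (X b).IsValid T) {R : (N : Mod T) → Pts N.1 X → Prop}
    (hR : Def (Ctx.triv T) (USet.pi fun b => (X b).toUSet (hX b)) R) :
    ∃ φ : DRel X, ∀ (N : Mod T) (p : Pts N.1 X), φ.Holds N.1 p ↔ R N p := by
  obtain ⟨φ, hφ⟩ := hR.bdef
  refine ⟨φ, fun N p => (DRel.holds_iff φ N.1 p).trans ⟨?_, fun h => ?_⟩⟩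
  · rintro ⟨w, hw, h⟩
    obtain ⟨s, hs, h⟩ := (hφ N w).1 h
    rwa [(USet.pi fun b => (X b).toUSet (hX b)).func N w p s (fun b => ⟨_, rfl, hw b⟩) hs]
  · obtain ⟨w, hw⟩ := (USet.pi fun b => (X b).toUSet (hX b)).surj N p
    refine ⟨w, fun b => ?_, (hφ N w).2 ⟨p, hw, h⟩⟩
    obtain ⟨_, rfl, h⟩ := hw b
    exact h

section Tuples

variable {C : Ctx T} {X Y Z : DSet L} {hX : X.IsValid T} {hY : Y.IsValid T} {hZ : Z.IsValid T}

theorem DRel.def_holds₂ (φ : DRel ![X, Y]) : Def C ((X.toUSet hX).prod (Y.toUSet hY))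
    (fun N p => φ.Holds (C.mod N).1 (pt2 p.1 p.2)) := by
  have h : ∀ b, (![X, Y] b).IsValid T := fun b => match b with
    | 0 => hX
    | 1 => hY
  refine (φ.def_holds h).reindex (U := (X.toUSet hX).prod (Y.toUSet hY))
    (f := fun N p => pt2 p.1 p.2) (.tuple fun b => ?_)
  match b with
  | 0 => exact .fst' .id
  | 1 => exact .snd' .id

theorem Def.exists_drel₂ {R : (N : Mod T) → X.Pt N.1 → Y.Pt N.1 → Prop}
    (hR : Def (Ctx.triv T) ((X.toUSet hX).prod (Y.toUSet hY)) (fun N p => R N p.1 p.2)) :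
    ∃ φ : DRel ![X, Y], ∀ (N : Mod T) x y, φ.Holds N.1 (pt2 x y) ↔ R N x y := by
  have h : ∀ b, (![X, Y] b).IsValid T := fun b => match b with
    | 0 => hX
    | 1 => hY
  obtain ⟨φ, hφ⟩ := Def.exists_drel h (hR.reindex
    (U := USet.pi fun b => (![X, Y] b).toUSet (h b)) (f := fun N p => (p 0, p 1))
    (.pair (.app .id 0) (.app .id 1)))
  exact ⟨φ, fun N x y => hφ N _⟩

theorem DRel.def_holds₃ (φ : DRel ![X, Y, Z]) :
    Def C ((X.toUSet hX).prod ((Y.toUSet hY).prod (Z.toUSet hZ)))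
      (fun N p => φ.Holds (C.mod N).1 (pt3 p.1 p.2.1 p.2.2)) := by
  have h : ∀ b, (![X, Y, Z] b).IsValid T := fun b => match b with
    | 0 => hX
    | 1 => hY
    | 2 => hZ
  refine (φ.def_holds h).reindex (U := (X.toUSet hX).prod ((Y.toUSet hY).prod (Z.toUSet hZ)))
    (f := fun N p => pt3 p.1 p.2.1 p.2.2) (.tuple fun b => ?_)
  match b with
  | 0 => exact .fst' .id
  | 1 => exact .fst' (.snd' .id)
  | 2 => exact .snd' (.snd' .id)

theorem Def.exists_drel₃ {R : (N : Mod T) → X.Pt N.1 → Y.Pt N.1 → Z.Pt N.1 → Prop}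
    (hR : Def (Ctx.triv T) ((X.toUSet hX).prod ((Y.toUSet hY).prod (Z.toUSet hZ)))
      (fun N p => R N p.1 p.2.1 p.2.2)) :
    ∃ φ : DRel ![X, Y, Z], ∀ (N : Mod T) x y z, φ.Holds N.1 (pt3 x y z) ↔ R N x y z := by
  have h : ∀ b, (![X, Y, Z] b).IsValid T := fun b => match b with
    | 0 => hX
    | 1 => hY
    | 2 => hZ
  obtain ⟨φ, hφ⟩ := Def.exists_drel h (hR.reindex
    (U := USet.pi fun b => (![X, Y, Z] b).toUSet (h b)) (f := fun N p => (p 0, p 1, p 2))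
    (.pair (.app .id 0) (.pair (.app .id 1) (.app .id 2))))
  exact ⟨φ, fun N x y z => hφ N _⟩

end Tuples

/-! ## Completeness of the theory of a structure -/

/-- A structure, as a model of its theory. -/
@[reducible] def Str.self (M : L.Str) : Mod M.thry := ⟨M, fun _ h => h⟩

/-- A definable predicate on a one-point set is a sentence, and the theory of a structure is
complete. Through this lemma a definable statement checked in `M` holds in every model of its
theory. -/
theorem Def.iff_self {M : L.Str} {R : Mod M.thry → Prop}
    (hR : Def (Ctx.triv M.thry) (USet.unit M.thry) (fun N _ => R N)) (N : Mod M.thry) :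
    R N ↔ R M.self := by
  have key : ∀ {R : Mod M.thry → Prop}, Def (Ctx.triv M.thry) (USet.unit M.thry) (fun N _ => R N) →
      R M.self → R N := by
    intro R hR h
    obtain ⟨φ, hφ⟩ := hR.bdef
    have h₁ : φ ∈ M.thry := (hφ M.self _).2 ⟨_, rfl, h⟩
    obtain ⟨_, _, h⟩ := (hφ N _).1 (N.2 h₁)
    exact h
  exact ⟨fun h => by_contra fun h' => key hR.not h' h, key hR⟩

end MSLang

namespace MSLang

variable {L₀ L : MSLang.{u}} {T : L.Theory}

/-! ## Pulling back along an interpretation -/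

namespace Interp

/-- Tuples of elements of the sorts of `N₀`. -/
@[reducible] def pullRaw (i : Interp L₀ L) (hv : ∀ s, (i.srt s).IsValid T) {α : Type} [Finite α]
    (σ : α → L₀.Srt) : USet T :=
  USet.pi fun a => (i.srt (σ a)).toUSet (hv (σ a))

theorem structMap_val (i : Interp L₀ L) (hv : ∀ s, (i.srt s).IsValid T) {α : Type} [Finite α]
    {σ : α → L₀.Srt} {n : ℕ} {τ : Fin n → L₀.Srt} {s : L₀.Srt} (x : Vr σ τ s) :
    StructMap ((i.pullRaw hv σ).prod (i.pullRaw hv τ)) ((i.srt s).toUSet (hv s))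
      (fun N p => Vr.val (N := i.pull N.1) p.1 p.2 x) := by
  obtain ⟨a | k, h⟩ := x
  · obtain rfl : σ a = s := h
    exact .app (.fst' .id) a
  · obtain rfl : τ k = s := h
    exact .app (.snd' .id) k

/-- This is the translation of formulas under an interpretation: atomic formulas become the
interpreting relations, and a quantifier over a sort becomes one over the interpreting definable
set. -/
theorem def_realize (i : Interp L₀ L) (hv : ∀ s, (i.srt s).IsValid T) {α : Type} [Finite α]
    {σ : α → L₀.Srt} {n : ℕ} {τ : Fin n → L₀.Srt} (φ : BFml L₀ σ n τ) :
    Def (Ctx.triv T) ((i.pullRaw hv σ).prod (i.pullRaw hv τ))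
      (fun N p => BFml.Realize (i.pull N.1) p.1 φ p.2) := by
  induction φ with
  | bot => exact Def.bot
  | eq s x y => exact Def.eq.reindex (.pair (i.structMap_val hv x) (i.structMap_val hv y))
  | @rel n τ R x =>
    exact ((i.rel R).def_holds fun j => hv _).reindex
      (U := (i.pullRaw hv σ).prod (i.pullRaw hv τ))
      (f := fun N p j => Vr.val (N := i.pull N.1) p.1 p.2 (x j))
      (.tuple fun j => i.structMap_val hv (x j))
  | imp φ ψ ih₁ ih₂ => exact ih₁.imp ih₂
  | @all n τ s φ ih =>
    refine Def.all (V := (i.srt s).toUSet (hv s)) (ih.reindex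
      (U := ((i.pullRaw hv σ).prod (i.pullRaw hv τ)).prod ((i.srt s).toUSet (hv s)))
      (f := fun N p => (p.1.1, Fin.cons (α := fun k => (i.pull N.1).car
        ((Fin.cons s τ : Fin _ → L₀.Srt) k)) p.2 p.1.2)) (.pair (.fst' (.fst' .id)) (.tuple ?_)))
    refine Fin.cases ?_ fun k => ?_
    · exact .snd' .id
    · exact .app (V := fun k => (i.srt (τ k)).toUSet (hv (τ k))) (.snd' (.fst' .id)) k

theorem def_sat (i : Interp L₀ L) (hv : ∀ s, (i.srt s).IsValid T) {α : Type} [Finite α]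
    {σ : α → L₀.Srt} (φ : L₀.Fml σ) :
    Def (Ctx.triv T) (i.pullRaw hv σ) (fun N v => (i.pull N.1).Sat φ v) :=
  (i.def_realize hv φ).reindex (U := i.pullRaw hv σ) (f := fun N v => (v, fun k => k.elim0))
    (.pair .id (.tuple fun k => k.elim0))

theorem pull_models (i : Interp L₀ L) {M : L.Str} (hv : ∀ s, (i.srt s).IsValid M.thry)
    (N : Mod M.thry) : (i.pull N.1).Models (i.pull M).thry := by
  intro φ hφ
  have h : ∀ N' : Mod M.thry, (i.pull N'.1).Sat φ (fun e => e.elim) ↔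
      (i.pull M).Sat φ (fun e => e.elim) := fun N' =>
    Def.iff_self ((i.def_sat hv φ).reindex (U := USet.unit M.thry)
      (f := fun N _ e => e.elim) (.tuple fun e => e.elim)) N'
  exact (h N).2 hφ

/-- The interpreted structure, as a model of the theory of `M₀`. -/
@[reducible] def pullMod (i : Interp L₀ L) {M : L.Str} (hv : ∀ s, (i.srt s).IsValid M.thry)
    (N : Mod M.thry) : Mod (i.pull M).thry := ⟨i.pull N.1, i.pull_models hv N⟩

section

variable (i : Interp L₀ L) {M : L.Str} (hv : ∀ s, (i.srt s).IsValid M.thry)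

theorem def_sat_fo {α : Type} [Finite α] {σ : α → L₀.Srt}
    {R : (N : Mod (i.pull M).thry) → N.1.Tup σ → Prop} (hR : FO (i.pull M).thry σ R) :
    Def (Ctx.triv M.thry) (i.pullRaw hv σ) (fun N v => R (i.pullMod hv N) v) := by
  obtain ⟨φ, hφ⟩ := hR
  exact (i.def_sat hv φ).congr fun N v => hφ (i.pullMod hv N) v

theorem pull_eqv (U : USet (i.pull M).thry) :
    Def (Ctx.triv M.thry) ((i.pullRaw hv U.srt).prod (i.pullRaw hv U.srt))
      (fun N p => ∃ s, U.val (i.pullMod hv N) p.1 s ∧ U.val (i.pullMod hv N) p.2 s) := by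
  refine (i.def_sat_fo hv U.eqv).reindex
    (U := (i.pullRaw hv U.srt).prod (i.pullRaw hv U.srt))
    (f := fun N p => Str.Tup.app (N := i.pull N.1) p.1 p.2) (.tuple ?_)
  rintro (j | j)
  · exact .app (V := fun j => (i.srt (U.srt j)).toUSet (hv (U.srt j))) (.fst' .id) j
  · exact .app (V := fun j => (i.srt (U.srt j)).toUSet (hv (U.srt j))) (.snd' .id) j

/-- The set `i(U)`. -/
@[reducible] def pb (U : USet (i.pull M).thry) : USet M.thry :=
  (i.pullRaw hv U.srt).quot (fun N => U.car (i.pullMod hv N)) (fun N => U.val (i.pullMod hv N))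
    (fun N => U.surj (i.pullMod hv N)) (fun N => U.func (i.pullMod hv N))
    (i.def_sat_fo hv U.dom) (i.pull_eqv hv U)

variable {i hv}

theorem def_pb_val {C : Ctx M.thry} {U : USet (i.pull M).thry} :
    Def C ((i.pullRaw hv U.srt).prod (i.pb hv U))
      (fun N p => U.val (i.pullMod hv (C.mod N)) p.1 p.2) :=
  Def.quot_rel

theorem def_pb {C : Ctx M.thry} {U : USet (i.pull M).thry}
    {R : (N : Mod (i.pull M).thry) → U.car N → Prop} (hR : Def (Ctx.triv (i.pull M).thry) U R) :
    Def C (i.pb hv U) (fun N s => R (i.pullMod hv (C.mod N)) s) := by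
  refine Def.lift (U := i.pb hv U) (R := fun N s => R (i.pullMod hv N) s)
    (Def.congr (C := Ctx.triv M.thry) (U := i.pb hv U) (R := fun (N : Mod M.thry) s =>
      ∃ v : (i.pull N.1).Tup U.srt, U.val (i.pullMod hv N) v s ∧
        ∃ s, U.val (i.pullMod hv N) v s ∧ R (i.pullMod hv N) s)
      (Def.ex (V := i.pullRaw hv U.srt) (Def.and ?_ ?_)) fun N s => ?_)
  · exact def_pb_val.reindex (U := (i.pb hv U).prod (i.pullRaw hv U.srt))
      (f := fun N p => (p.2, p.1)) (.pair (.snd' .id) (.fst' .id))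
  · exact (i.def_sat_fo hv hR.bdef).reindex (U := (i.pb hv U).prod (i.pullRaw hv U.srt))
      (f := fun N p => p.2) (.snd' .id)
  · constructor
    · rintro ⟨v, hv', h⟩
      rwa [BDef.iff_of_val R hv'] at h
    · intro h
      obtain ⟨v, hv'⟩ := U.surj _ s
      exact ⟨v, hv', s, hv', h⟩

theorem defMap_pb_fst {C : Ctx M.thry} {U V : USet (i.pull M).thry} :
    DefMap C (i.pb hv (U.prod V)) (i.pb hv U) (fun _ p => p.1) := by
  refine DefMap.lift (U := i.pb hv (U.prod V)) (V := i.pb hv U) (f := fun _ p => p.1)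
    (Def.congr (C := Ctx.triv M.thry) (R := fun (N : Mod M.thry)
      (q : (U.car (i.pullMod hv N) × V.car (i.pullMod hv N)) × U.car (i.pullMod hv N)) =>
      ∃ v : (i.pull N.1).Tup (U.prod V).srt, (U.prod V).val (i.pullMod hv N) v q.1 ∧
        U.val (i.pullMod hv N) (fun j => v (.inl j)) q.2)
      (Def.ex (V := i.pullRaw hv (U.prod V).srt) (Def.and ?_ ?_)) fun N s => ?_)
  · exact def_pb_val.reindex
      (U := ((i.pb hv (U.prod V)).prod (i.pb hv U)).prod (i.pullRaw hv (U.prod V).srt))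
      (f := fun N p => (p.2, p.1.1)) (.pair (.snd' .id) (.fst' (.fst' .id)))
  · exact def_pb_val.reindex
      (U := ((i.pb hv (U.prod V)).prod (i.pb hv U)).prod (i.pullRaw hv (U.prod V).srt))
      (f := fun N p => (fun j => p.2 (.inl j), p.1.2))
      (.pair (.tuple fun j => .app (.snd' .id) (Sum.inl j)) (.snd' (.fst' .id)))
  · constructor
    · rintro ⟨v, h, h'⟩
      exact U.func _ _ _ _ h.1 h'
    · intro h
      obtain ⟨v, hv'⟩ := (U.prod V).surj _ s.1
      exact ⟨v, hv', h ▸ hv'.1⟩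

theorem defMap_pb_snd {C : Ctx M.thry} {U V : USet (i.pull M).thry} :
    DefMap C (i.pb hv (U.prod V)) (i.pb hv V) (fun _ p => p.2) := by
  refine DefMap.lift (U := i.pb hv (U.prod V)) (V := i.pb hv V) (f := fun _ p => p.2)
    (Def.congr (C := Ctx.triv M.thry) (R := fun (N : Mod M.thry)
      (q : (U.car (i.pullMod hv N) × V.car (i.pullMod hv N)) × V.car (i.pullMod hv N)) =>
      ∃ v : (i.pull N.1).Tup (U.prod V).srt, (U.prod V).val (i.pullMod hv N) v q.1 ∧
        V.val (i.pullMod hv N) (fun j => v (.inr j)) q.2)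
      (Def.ex (V := i.pullRaw hv (U.prod V).srt) (Def.and ?_ ?_)) fun N s => ?_)
  · exact def_pb_val.reindex
      (U := ((i.pb hv (U.prod V)).prod (i.pb hv V)).prod (i.pullRaw hv (U.prod V).srt))
      (f := fun N p => (p.2, p.1.1)) (.pair (.snd' .id) (.fst' (.fst' .id)))
  · exact def_pb_val.reindex
      (U := ((i.pb hv (U.prod V)).prod (i.pb hv V)).prod (i.pullRaw hv (U.prod V).srt))
      (f := fun N p => (fun j => p.2 (.inr j), p.1.2))
      (.pair (.tuple fun j => .app (.snd' .id) (Sum.inr j)) (.snd' (.fst' .id)))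
  · constructor
    · rintro ⟨v, h, h'⟩
      exact V.func _ _ _ _ h.2 h'
    · intro h
      obtain ⟨v, hv'⟩ := (U.prod V).surj _ s.1
      exact ⟨v, hv', h ▸ hv'.2⟩

/-- Both sides have the same points, but their representing tuples are indexed differently, so the
definability of the identity between them has content. -/
theorem defMap_pb_prod {C : Ctx M.thry} {U V : USet (i.pull M).thry} :
    DefMap C (i.pb hv (U.prod V)) ((i.pb hv U).prod (i.pb hv V)) (fun _ p => p) :=
  DefMap.pair defMap_pb_fst defMap_pb_snd

theorem defMap_prod_pb {C : Ctx M.thry} {U V : USet (i.pull M).thry} :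
    DefMap C ((i.pb hv U).prod (i.pb hv V)) (i.pb hv (U.prod V)) (fun _ p => p) :=
  defMap_pb_prod.symm (U := i.pb hv (U.prod V)) (V := (i.pb hv U).prod (i.pb hv V))
    fun _ _ _ => eq_comm

theorem defMap_pb {C : Ctx M.thry} {U V : USet (i.pull M).thry}
    {f : (N : Mod (i.pull M).thry) → U.car N → V.car N}
    (hf : DefMap (Ctx.triv (i.pull M).thry) U V f) :
    DefMap C (i.pb hv U) (i.pb hv V) (fun N x => f (i.pullMod hv (C.mod N)) x) :=
  (def_pb hf).comp defMap_prod_pb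

/-- Definability on a product of sets `i(U)`, `i(V)`. -/
theorem def_pb₂ {C : Ctx M.thry} {U V : USet (i.pull M).thry}
    {R : (N : Mod (i.pull M).thry) → U.car N → V.car N → Prop}
    (hR : Def (Ctx.triv (i.pull M).thry) (U.prod V) (fun N p => R N p.1 p.2)) :
    Def C ((i.pb hv U).prod (i.pb hv V)) (fun N p => R (i.pullMod hv (C.mod N)) p.1 p.2) :=
  (def_pb hR).comp defMap_prod_pb

theorem def_pb₃ {C : Ctx M.thry} {U V W : USet (i.pull M).thry}
    {R : (N : Mod (i.pull M).thry) → U.car N → V.car N → W.car N → Prop}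
    (hR : Def (Ctx.triv (i.pull M).thry) (U.prod (V.prod W)) (fun N p => R N p.1 p.2.1 p.2.2)) :
    Def C ((i.pb hv U).prod ((i.pb hv V).prod (i.pb hv W)))
      (fun N p => R (i.pullMod hv (C.mod N)) p.1 p.2.1 p.2.2) :=
  (def_pb hR).comp (defMap_prod_pb.comp (DefMap.fst.pair (defMap_prod_pb.comp DefMap.snd)))

/-- Points of `i(U)`, for a set `U` of tuples. -/
theorem defMap_pb_raw {C : Ctx M.thry} {α : Type} [Finite α] {σ : α → L₀.Srt} :
    DefMap C (i.pb hv (USet.raw (i.pull M).thry σ)) (i.pullRaw hv σ) (fun _ v => v) :=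
  (def_pb_val (C := C) (hv := hv) (U := USet.raw (i.pull M).thry σ)).reindex
    (U := (i.pb hv (USet.raw (i.pull M).thry σ)).prod (i.pullRaw hv σ))
    (f := fun N p => (p.2, p.1)) (.pair (.snd' .id) (.fst' .id)) |>.congr fun _ _ => eq_comm

/-! ## Mixed relations -/

theorem MRel.holds_iff {β γ : Type} {X : β → DSet L} {Y : γ → DSet L₀} (φ : i.MRel X Y)
    (N : L.Str) (p : Pts N X) (q : Pts (i.pull N) Y) : φ.Holds N p q ↔
    ∃ w : (i.pull N).Tup (fun jk : (j : γ) × Fin (Y j).n => (Y jk.1).srt jk.2),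
      (∀ j, (Y j).Repr (i.pull N) (fun k => w ⟨j, k⟩) (q j)) ∧
        DRel.Holds (X := Sum.elim X (fun jk : (j : γ) × Fin (Y j).n => i.srt ((Y jk.1).srt jk.2)))
          φ N (Pts.app p w) :=
  ⟨fun ⟨r, h, h'⟩ => ⟨fun jk => (r jk.1).1 jk.2, fun b => ⟨(r b).2, h b⟩, h'⟩,
    fun ⟨w, h, h'⟩ => ⟨fun b => ⟨fun k => w ⟨b, k⟩, (h b).1⟩, fun b => (h b).2, h'⟩⟩

variable {β γ : Type} [Finite β] [Finite γ] {X : β → DSet L} {Y : γ → DSet L₀}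
  (hX : ∀ b, (X b).IsValid M.thry) (hY : ∀ c, (Y c).IsValid (i.pull M).thry)

theorem def_repr_family {C : Ctx M.thry} :
    Def C ((i.pullRaw hv (fun jk : (j : γ) × Fin (Y j).n => (Y jk.1).srt jk.2)).prod
        (USet.pi fun c => i.pb hv ((Y c).toUSet (hY c))))
      (fun N p => ∀ j, (Y j).Repr (i.pull (C.mod N).1) (fun k => p.1 ⟨j, k⟩) (p.2 j)) := by
  refine Def.finite_all fun j => ?_
  refine ((def_pb_val (C := C) (hv := hv) (U := (Y j).toUSet (hY j))).reindex
    (U := (i.pullRaw hv (fun jk : (j : γ) × Fin (Y j).n => (Y jk.1).srt jk.2)).prod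
        (USet.pi fun c => i.pb hv ((Y c).toUSet (hY c))))
    (f := fun N p => (fun k => p.1 ⟨j, k⟩, p.2 j))
    (.pair (.tuple fun k => .app (.fst' .id) (⟨j, k⟩ : (j : γ) × Fin (Y j).n))
      (.app (.snd' .id) j))).congr fun N p => ⟨?_, fun h => ⟨_, rfl, h⟩⟩
  rintro ⟨v, hv, h⟩
  subst hv
  exact h

theorem MRel.def_holds {C : Ctx M.thry} (φ : i.MRel X Y) :
    Def C ((USet.pi fun b => (X b).toUSet (hX b)).prod
        (USet.pi fun c => i.pb hv ((Y c).toUSet (hY c))))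
      (fun N p => φ.Holds (C.mod N).1 p.1 p.2) := by
  have hXY : ∀ x, (Sum.elim X (fun jk : (j : γ) × Fin (Y j).n =>
      i.srt ((Y jk.1).srt jk.2)) x).IsValid M.thry := by
    rintro (b | jk)
    exacts [hX b, hv _]
  refine (Def.ex (C := C) (U := (USet.pi fun b => (X b).toUSet (hX b)).prod
        (USet.pi fun c => i.pb hv ((Y c).toUSet (hY c))))
    (V := i.pullRaw hv (fun jk : (j : γ) × Fin (Y j).n => (Y jk.1).srt jk.2))
    (R := fun N p w => (∀ j, (Y j).Repr (i.pull (C.mod N).1) (fun k => w ⟨j, k⟩) (p.2 j)) ∧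
      DRel.Holds (X := Sum.elim X (fun jk : (j : γ) × Fin (Y j).n => i.srt ((Y jk.1).srt jk.2)))
          φ (C.mod N).1 (Pts.app p.1 w))
    (Def.and ?_ ?_)).congr fun N p => (φ.holds_iff _ _ _).symm
  · exact (def_repr_family (C := C) (hv := hv) hY).reindex
      (U := ((USet.pi fun b => (X b).toUSet (hX b)).prod
        (USet.pi fun c => i.pb hv ((Y c).toUSet (hY c)))).prod
          (i.pullRaw hv (fun jk : (j : γ) × Fin (Y j).n => (Y jk.1).srt jk.2)))
      (f := fun N p => (p.2, p.1.2)) (.pair (.snd' .id) (.snd' (.fst' .id)))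
  · refine (DRel.def_holds (C := C) hXY φ).reindex
      (U := ((USet.pi fun b => (X b).toUSet (hX b)).prod
        (USet.pi fun c => i.pb hv ((Y c).toUSet (hY c)))).prod
          (i.pullRaw hv (fun jk : (j : γ) × Fin (Y j).n => (Y jk.1).srt jk.2)))
      (f := fun N p => Pts.app p.1.1 p.2) (.tuple ?_)
    rintro (b | jk)
    · exact .app (V := fun b => (X b).toUSet (hX b)) (.fst' (.fst' .id)) b
    · exact .app (V := fun jk : (j : γ) × Fin (Y j).n => (i.srt ((Y jk.1).srt jk.2)).toUSet (hv _))
        (.snd' .id) jk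

theorem exists_mrel {R : (N : Mod M.thry) → Pts N.1 X → Pts (i.pull N.1) Y → Prop}
    (hR : Def (Ctx.triv M.thry) ((USet.pi fun b => (X b).toUSet (hX b)).prod
        (USet.pi fun c => i.pb hv ((Y c).toUSet (hY c)))) (fun N p => R N p.1 p.2)) :
    ∃ φ : i.MRel X Y, ∀ (N : Mod M.thry) p q, φ.Holds N.1 p q ↔ R N p q := by
  have hXY : ∀ x, (Sum.elim X (fun jk : (j : γ) × Fin (Y j).n =>
      i.srt ((Y jk.1).srt jk.2)) x).IsValid M.thry := by
    rintro (b | jk)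
    exacts [hX b, hv _]
  -- The formula sees only representatives of the points of i(Y); the points themselves are
  -- recovered existentially.
  have key : Def (Ctx.triv M.thry) (USet.pi fun x => (Sum.elim X (fun jk : (j : γ) × Fin (Y j).n =>
      i.srt ((Y jk.1).srt jk.2)) x).toUSet (hXY x)) (fun N z => ∃ q : Pts (i.pull N.1) Y,
        (∀ j, (Y j).Repr (i.pull N.1) (fun k => z (.inr ⟨j, k⟩)) (q j)) ∧
          R N (fun b => z (.inl b)) q) := by
    refine Def.ex (V := USet.pi fun c => i.pb hv ((Y c).toUSet (hY c))) (Def.and ?_ ?_)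
    · exact (def_repr_family (C := Ctx.triv M.thry) (hv := hv) hY).reindex
        (U := (USet.pi fun x => (Sum.elim X (fun jk : (j : γ) × Fin (Y j).n =>
          i.srt ((Y jk.1).srt jk.2)) x).toUSet (hXY x)).prod
            (USet.pi fun c => i.pb hv ((Y c).toUSet (hY c))))
        (f := fun N p => (fun jk => p.1 (.inr jk), p.2))
        (.pair (.tuple fun jk => .app (.fst' .id) (Sum.inr jk)) (.snd' .id))
    · exact hR.reindex
        (U := (USet.pi fun x => (Sum.elim X (fun jk : (j : γ) × Fin (Y j).n =>
          i.srt ((Y jk.1).srt jk.2)) x).toUSet (hXY x)).prod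
            (USet.pi fun c => i.pb hv ((Y c).toUSet (hY c))))
        (f := fun N p => (fun b => p.1 (.inl b), p.2))
        (.pair (.tuple fun b => .app (.fst' .id) (Sum.inl b)) (.snd' .id))
  obtain ⟨φ, hφ⟩ := Def.exists_drel hXY key
  refine ⟨φ, fun N p q => (MRel.holds_iff φ N.1 p q).trans ?_⟩
  constructor
  · rintro ⟨w, hw, h⟩
    obtain ⟨q', hq', h⟩ := (hφ N _).1 h
    have : q' = q := by
      funext j
      obtain ⟨_, e⟩ := hw j
      obtain ⟨_, e'⟩ := hq' j
      exact e'.symm.trans e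
    exact this ▸ h
  · intro h
    choose w hw using fun j => DSet.exists_repr (q j)
    exact ⟨fun jk => w jk.1 jk.2, hw, (hφ N _).2 ⟨q, hw, h⟩⟩

end

end Interp

end MSLang

namespace MSLang

variable {L₀ L : MSLang.{u}} {T : L.Theory}

/-! ## Definable sets that are valid in all structures -/

theorem DSet.def_equivalence (X : DSet L) :
    Def (Ctx.triv T) (USet.unit T) (fun N _ => Equivalence (X.Eqv N.1)) := by
  let U := USet.raw T X.srt
  have hd : Def (Ctx.triv T) U (fun N v => N.1.Sat X.dom v) :=
    Def.of_bdef (C := Ctx.triv T) (R := fun N v => N.1.Sat X.dom v)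
      (BDef.of_fo (U := U) (FO.of_fml X.dom) fun N v s (h : v = s) => h ▸ Iff.rfl)
  have he : Def (Ctx.triv T) (U.prod U) (fun N p => N.1.Sat X.eqv (Str.Tup.app p.1 p.2)) := by
    refine Def.of_bdef (C := Ctx.triv T) (U := U.prod U)
      (R := fun N p => N.1.Sat X.eqv (Str.Tup.app p.1 p.2))
      (BDef.of_fo (U := U.prod U) (FO.of_fml X.eqv) ?_)
    rintro N v ⟨p, q⟩ ⟨rfl, rfl⟩
    have e : v = Str.Tup.app (fun j => v (.inl j)) (fun j => v (.inr j)) := by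
      funext x
      cases x <;> rfl
    conv_lhs => rw [e]
    exact Iff.rfl
  have h1 : Def (Ctx.triv T) (USet.unit T) (fun N _ => ∀ v : N.1.Tup X.srt,
      N.1.Sat X.dom v → N.1.Sat X.eqv (Str.Tup.app v v)) :=
    Def.all (V := U) (Def.imp (hd.reindex (.snd' .id))
      (he.reindex (U := (USet.unit T).prod U) (f := fun N p => (p.2, p.2)) (.pair (.snd' .id) (.snd' .id))))
  have h2 : Def (Ctx.triv T) (USet.unit T) (fun N _ => ∀ v w : N.1.Tup X.srt,
      N.1.Sat X.dom v → N.1.Sat X.dom w → N.1.Sat X.eqv (Str.Tup.app v w) →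
        N.1.Sat X.eqv (Str.Tup.app w v)) :=
    Def.all (V := U) (Def.all (V := U) (Def.imp (hd.reindex (.snd' (.fst' .id)))
      (Def.imp (hd.reindex (.snd' .id)) (Def.imp
        (he.reindex (U := ((USet.unit T).prod U).prod U) (f := fun N p => (p.1.2, p.2))
          (.pair (.snd' (.fst' .id)) (.snd' .id)))
        (he.reindex (U := ((USet.unit T).prod U).prod U) (f := fun N p => (p.2, p.1.2))
          (.pair (.snd' .id) (.snd' (.fst' .id))))))))
  have h3 : Def (Ctx.triv T) (USet.unit T) (fun N _ => ∀ v w z : N.1.Tup X.srt,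
      N.1.Sat X.dom v → N.1.Sat X.dom w → N.1.Sat X.dom z → N.1.Sat X.eqv (Str.Tup.app v w) →
        N.1.Sat X.eqv (Str.Tup.app w z) → N.1.Sat X.eqv (Str.Tup.app v z)) :=
    Def.all (V := U) (Def.all (V := U) (Def.all (V := U)
      (Def.imp (hd.reindex (.snd' (.fst' (.fst' .id))))
      (Def.imp (hd.reindex (.snd' (.fst' .id))) (Def.imp (hd.reindex (.snd' .id)) (Def.imp
        (he.reindex (U := (((USet.unit T).prod U).prod U).prod U) (f := fun N p => (p.1.1.2, p.1.2))
          (.pair (.snd' (.fst' (.fst' .id))) (.snd' (.fst' .id)))) (Def.imp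
        (he.reindex (U := (((USet.unit T).prod U).prod U).prod U) (f := fun N p => (p.1.2, p.2))
          (.pair (.snd' (.fst' .id)) (.snd' .id)))
        (he.reindex (U := (((USet.unit T).prod U).prod U).prod U) (f := fun N p => (p.1.1.2, p.2))
          (.pair (.snd' (.fst' (.fst' .id))) (.snd' .id))))))))))
  refine (h1.and (h2.and h3)).congr fun N _ => ⟨fun ⟨a, b, c⟩ => ⟨fun v => a v.1 v.2,
    fun {v w} h => b v.1 w.1 v.2 w.2 h, fun {v w z} h h' => c v.1 w.1 z.1 v.2 w.2 z.2 h h'⟩,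
    fun h => ⟨fun v hv => h.refl ⟨v, hv⟩, fun v w hv hw e => h.symm (x := ⟨v, hv⟩) (y := ⟨w, hw⟩) e,
      fun v w z hv hw hz e e' => h.trans (x := ⟨v, hv⟩) (y := ⟨w, hw⟩) (z := ⟨z, hz⟩) e e'⟩⟩

/-- Stable embeddedness concerns definable sets valid in T and T₀, whereas sets built here are valid
only in the theories of `M` and M₀. Being an equivalence relation is a sentence, so the relation can
be redefined as equality wherever that sentence fails; nothing changes in the models at hand. -/
theorem USet.exists_valid_dset (U : USet T) : ∃ (X : DSet L) (hX : ∀ T' : L.Theory, X.IsValid T')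
    (e : (N : Mod T) → X.Pt N.1 ≃ U.car N),
    DefMap (Ctx.triv T) (X.toUSet (hX T)) U (fun N x => e N x) := by
  obtain ⟨X, hX, e, he⟩ := U.exists_dset
  have hF : FO (∅ : L.Theory) (Sum.elim X.srt X.srt) (fun N v =>
      (Equivalence (X.Eqv N.1) → N.1.Sat X.eqv v) ∧
      (¬ Equivalence (X.Eqv N.1) → ∀ j, HEq (v (.inl j)) (v (.inr j)))) := by
    have hE : FO (∅ : L.Theory) (Sum.elim X.srt X.srt) (fun N _ => Equivalence (X.Eqv N.1)) :=
      FO.congr (X.def_equivalence.reindex (U := USet.raw ∅ (Sum.elim X.srt X.srt)) .to_unit).bdef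
        fun N v => ⟨fun ⟨_, _, h⟩ => h, fun h => ⟨v, rfl, h⟩⟩
    exact (hE.imp (FO.of_fml _)).and (hE.not.imp (FO.finite_all fun j => FO.eq_var _ _ rfl))
  obtain ⟨ψ, hψ⟩ := hF
  let X' : DSet L := ⟨X.n, X.srt, X.dom, ψ⟩
  have hE : ∀ (N : L.Str) (v w : X.Rep N), X'.Eqv N v w ↔
      (Equivalence (X.Eqv N) → X.Eqv N v w) ∧ (¬ Equivalence (X.Eqv N) → v = w) := fun N v w =>
    (hψ ⟨N, fun _ h => h.elim⟩ (Str.Tup.app v.1 w.1)).trans (and_congr Iff.rfl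
      (imp_congr Iff.rfl ⟨fun h => Subtype.ext (funext fun j => eq_of_heq (h j)),
        fun h j => h ▸ HEq.rfl⟩))
  have hX' : ∀ T' : L.Theory, X'.IsValid T' := by
    intro T' N _
    by_cases h : Equivalence (X.Eqv N)
    · have : X'.Eqv N = X.Eqv N := by
        funext v w
        exact propext ((hE N v w).trans (by simp [h]))
      rw [this]
      exact h
    · have : X'.Eqv N = @Eq (X.Rep N) := by
        funext v w
        exact propext ((hE N v w).trans (by simp [h]))
      rw [this]
      exact eq_equivalence
  have hXE : ∀ (N : Mod T) v w, X'.Eqv N.1 v w ↔ X.Eqv N.1 v w := fun N v w =>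
    (hE N.1 v w).trans (by simp [hX N.1 N.2])
  let d : (N : Mod T) → X'.Pt N.1 ≃ X.Pt N.1 := fun N =>
    { toFun := Quot.map id fun v w h => (hXE N v w).1 h
      invFun := Quot.map id fun v w h => (hXE N v w).2 h
      left_inv := by rintro ⟨v⟩; rfl
      right_inv := by rintro ⟨v⟩; rfl }
  refine ⟨X', hX', fun N => (d N).trans (e N), DefMap.comp (C := Ctx.triv T)
    (U := X'.toUSet (hX' T)) (V := X.toUSet hX) (W := U) (g := fun N x => e N x) (f := fun N x => d N x) he ?_⟩
  refine Def.congr (C := Ctx.triv T) (U := (X'.toUSet (hX' T)).prod (X.toUSet hX))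
    (R := fun (N : Mod T) p => ∃ v : N.1.Tup X.srt,
      X'.Repr N.1 v p.1 ∧ X.Repr N.1 v p.2) (Def.ex (V := USet.raw T X.srt) (Def.and ?_ ?_)) ?_
  · exact (Def.repr (X := X')).reindex
      (U := ((X'.toUSet (hX' T)).prod (X.toUSet hX)).prod (USet.raw T X.srt))
      (f := fun N p => (p.2, p.1.1)) (.pair (.snd' .id) (.fst' (.fst' .id)))
  · exact (Def.repr (X := X)).reindex
      (U := ((X'.toUSet (hX' T)).prod (X.toUSet hX)).prod (USet.raw T X.srt))
      (f := fun N p => (p.2, p.1.2)) (.pair (.snd' .id) (.snd' (.fst' .id)))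
  · rintro N ⟨x, y⟩
    constructor
    · rintro ⟨v, ⟨h, rfl⟩, ⟨h', rfl⟩⟩
      rfl
    · intro h
      obtain ⟨v, hv, rfl⟩ := X'.exists_repr x
      exact ⟨v, ⟨hv, rfl⟩, ⟨hv, h⟩⟩

/-! ## Uniform stable embeddedness -/

namespace Interp

/-- Stable embeddedness, with canonical parameters: every definable family of subsets of a set
`i(V)` is obtained by a definable map from a family definable in `L₀`, with distinct members. -/
def IsCanonicallyEmbedded (i : Interp L₀ L) {M : L.Str} (hv : ∀ s, (i.srt s).IsValid M.thry) :
    Prop :=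
  ∀ (U : USet M.thry) (V : USet (i.pull M).thry)
    (R : (N : Mod M.thry) → U.car N → V.car (i.pullMod hv N) → Prop),
    Def (Ctx.triv M.thry) (U.prod (i.pb hv V)) (fun N p => R N p.1 p.2) →
    ∃ (W : USet (i.pull M).thry) (E : (N : Mod (i.pull M).thry) → W.car N → V.car N → Prop)
      (c : (N : Mod M.thry) → U.car N → W.car (i.pullMod hv N)),
      Def (Ctx.triv (i.pull M).thry) (W.prod V) (fun N p => E N p.1 p.2) ∧
      (∀ N w w', (∀ y, E N w y ↔ E N w' y) → w = w') ∧
      DefMap (Ctx.triv M.thry) U (i.pb hv W) c ∧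
      ∀ N u y, R N u y ↔ E (i.pullMod hv N) (c N u) y

/-- Stable embeddedness yields a code in the base for each fibre, but not a unique one. Identifying
codes with equal fibres makes it unique, and then the map from U to codes is definable: its graph
says that two fibres agree. -/
theorem IsStablyEmbedded.isCanonicallyEmbedded {i : Interp L₀ L} {T₀ : L₀.Theory}
    (hI : i.IsInterp T₀ T) (hS : i.IsStablyEmbedded T₀ T) {M : L.Str} (hM : M.Models T)
    (hv : ∀ s, (i.srt s).IsValid M.thry) : i.IsCanonicallyEmbedded hv := by
  intro U V R hR
  obtain ⟨X, hX, e, he⟩ := U.exists_valid_dset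
  obtain ⟨Y, hY, d, hd⟩ := V.exists_valid_dset
  have hXv : ∀ b, (![X] b).IsValid M.thry := fun b => match b with
    | 0 => hX _
  have hYv : ∀ b, (![Y] b).IsValid (i.pull M).thry := fun b => match b with
    | 0 => hY _
  obtain ⟨Z, hZ⟩ := exists_mrel (hv := hv) (X := ![X]) (Y := ![Y]) hXv hYv
    (R := fun N p q => R N (e N (p 0)) (d (i.pullMod hv N) (q 0))) (by
      refine Def.comp2 (C := Ctx.triv M.thry) (V := U) (W := i.pb hv V)
        (R := fun N (u : U.car N) (y : V.car (i.pullMod hv N)) => R N u y) hR ?_ ?_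
      · exact DefMap.comp (C := Ctx.triv M.thry) (V := X.toUSet (hX _)) (W := U)
          (g := fun N x => e N x) he
          (DefMap.app (V := fun b => (![X] b).toUSet (hXv b)) DefMap.fst 0)
      · exact DefMap.comp (C := Ctx.triv M.thry) (V := i.pb hv (Y.toUSet (hY _))) (W := i.pb hv V)
          (g := fun N x => d (i.pullMod hv N) x) (defMap_pb hd)
          (DefMap.app (V := fun b => i.pb hv ((![Y] b).toUSet (hYv b))) DefMap.snd 0))
  obtain ⟨W₀, hW₀, Z₀, hZ₀⟩ := hS Y (hY _) X (hX _) Z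
  have hW : W₀.IsValid (i.pull M).thry := fun N hN => hW₀ N fun φ h => hN (hI.models M hM h)
  let E₀ : (N : Mod (i.pull M).thry) → W₀.Pt N.1 → V.car N → Prop := fun N w y =>
    Z₀.Holds N.1 (pt2 w ((d N).symm y))
  have hE₀ : Def (Ctx.triv (i.pull M).thry) ((W₀.toUSet hW).prod V)
      (fun N p => E₀ N p.1 p.2) := by
    refine Def.comp2 (V := W₀.toUSet hW) (W := Y.toUSet (hY _)) (C := Ctx.triv (i.pull M).thry)
      (R := fun N (w : W₀.Pt N.1) (y : Y.Pt N.1) => Z₀.Holds N.1 (pt2 w y))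
      Z₀.def_holds₂ DefMap.fst ?_
    exact DefMap.comp (V := V) (g := fun N x => (d N).symm x)
      (hd.symm fun N x y => eq_comm.trans (Equiv.symm_apply_eq _).symm) DefMap.snd
  have hcov : ∀ (N : Mod M.thry) u, ∃ w : W₀.Pt (i.pull N.1),
      ∀ y, R N u y ↔ E₀ (i.pullMod hv N) w y := by
    intro N u
    obtain ⟨w, hw⟩ := hZ₀ N.1 (fun φ h => N.2 (hM h)) ((e N).symm u)
    refine ⟨w, fun y => ?_⟩
    refine Iff.trans ?_ (hw ((d (i.pullMod hv N)).symm y))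
    refine Iff.trans ?_ (hZ N (pt1 ((e N).symm u)) (pt1 ((d (i.pullMod hv N)).symm y))).symm
    show R N u y ↔ R N (e N ((e N).symm u)) (d (i.pullMod hv N) ((d (i.pullMod hv N)).symm y))
    simp
  -- The points of `W` are the coded sets themselves, so equality in `W` is equality of fibres by
  -- construction.
  let W : USet (i.pull M).thry := (W₀.toUSet hW).quot
    (fun N => {B : Set (V.car N) // ∃ w, B = {y | E₀ N w y}})
    (fun N w s => s.1 = {y | E₀ N w y}) (fun N s => s.2)
    (fun N w s s' h h' => Subtype.ext (h.trans h'.symm))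
    (Def.top.congr fun N w => ⟨fun _ => ⟨⟨_, w, rfl⟩, rfl⟩, fun _ => trivial⟩)
    ((Def.all (C := Ctx.triv (i.pull M).thry) (U := (W₀.toUSet hW).prod (W₀.toUSet hW)) (V := V)
      (R := fun N (p : W₀.Pt N.1 × W₀.Pt N.1) y => E₀ N p.1 y ↔ E₀ N p.2 y)
      (Def.iff (hE₀.reindex (U := ((W₀.toUSet hW).prod (W₀.toUSet hW)).prod V)
          (f := fun N p => (p.1.1, p.2)) (.pair (.fst' (.fst' .id)) (.snd' .id)))
        (hE₀.reindex (U := ((W₀.toUSet hW).prod (W₀.toUSet hW)).prod V)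
          (f := fun N p => (p.1.2, p.2)) (.pair (.snd' (.fst' .id)) (.snd' .id))))).congr
      fun N p => ⟨fun h => ⟨⟨_, p.1, rfl⟩, rfl, Set.ext h⟩,
        fun ⟨s, h, h'⟩ y => Set.ext_iff.1 (h.symm.trans h') y⟩)
  have hE : Def (Ctx.triv (i.pull M).thry) (W.prod V) (fun N p => p.2 ∈ p.1.1) := by
    refine Def.congr (C := Ctx.triv (i.pull M).thry) (U := W.prod V)
      (R := fun (N : Mod (i.pull M).thry) p => ∃ w : W₀.Pt N.1, p.1.1 = {y | E₀ N w y} ∧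
        E₀ N w p.2) (Def.ex (V := W₀.toUSet hW) (Def.and ?_ ?_)) ?_
    · exact (Def.quot_rel (P := W₀.toUSet hW)).reindex (U := (W.prod V).prod (W₀.toUSet hW))
        (f := fun N p => (p.2, p.1.1)) (.pair (.snd' .id) (.fst' (.fst' .id)))
    · exact hE₀.reindex (U := (W.prod V).prod (W₀.toUSet hW))
        (f := fun N p => (p.2, p.1.2)) (.pair (.snd' .id) (.snd' (.fst' .id)))
    · rintro N ⟨⟨B, w, rfl⟩, y⟩
      constructor
      · rintro ⟨w', h, h'⟩
        exact Set.ext_iff.1 h y |>.2 h'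
      · exact fun h => ⟨w, rfl, h⟩
  refine ⟨W, fun N w y => y ∈ w.1, fun N u => ⟨{y | R N u y}, ?_⟩, hE,
    fun N w w' h => Subtype.ext (Set.ext h), ?_, fun N u y => Iff.rfl⟩
  · obtain ⟨w, hw⟩ := hcov N u
    exact ⟨w, Set.ext hw⟩
  · refine Def.congr (C := Ctx.triv M.thry) (U := U.prod (i.pb hv W))
      (R := fun (N : Mod M.thry) p => ∀ y : V.car (i.pullMod hv N), R N p.1 y ↔ y ∈ p.2.1)
      (Def.all (V := i.pb hv V) (Def.iff ?_ ?_)) ?_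
    · exact hR.reindex (U := (U.prod (i.pb hv W)).prod (i.pb hv V)) (f := fun N p => (p.1.1, p.2))
        (.pair (.fst' (.fst' .id)) (.snd' .id))
    · exact (def_pb₂ (hv := hv) (U := W) (V := V) (R := fun N w y => y ∈ w.1) hE).reindex
        (U := (U.prod (i.pb hv W)).prod (i.pb hv V)) (f := fun N p => (p.1.2, p.2))
        (.pair (.snd' (.fst' .id)) (.snd' .id))
    · rintro N ⟨u, s⟩
      exact ⟨fun h => Subtype.ext (Set.ext h), fun h y => Set.ext_iff.1 (Subtype.ext_iff.1 h) y⟩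

end Interp

/-! ## Models with named parameters -/

/-- A sentence is a relation on the empty tuple of parameters, so preservation of the truth of
relations at tuples from `A` includes preservation of sentences. -/
theorem AModel.models {M : L.Str} {A : Set M.Elt} (N : AModel A) : N.N.Models M.thry := by
  intro φ hφ
  obtain ⟨ψ, hψ⟩ := Def.exists_drel (T := (∅ : L.Theory)) (β := Fin 0) (X := fun k => k.elim0)
    (fun k => k.elim0) (R := fun N _ => N.1.Sat φ (fun e => e.elim))
    (Def.of_bdef (C := Ctx.triv ∅) (R := fun N _ => N.1.Sat φ (fun e => e.elim))
      (BDef.reindex (V := USet.unit ∅) (R := fun N v => N.1.Sat φ v)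
        (BDef.of_fo (FO.of_fml φ) fun N v s (h : v = s) => h ▸ Iff.rfl) .to_unit))
  have h := N.elem ⟨0, fun k => k.elim0, fun k => k.elim0, fun k => k.elim0⟩ ψ
  exact (hψ ⟨N.N, fun _ h => h.elim⟩ _).1 (h.1 ((hψ ⟨M, fun _ h => h.elim⟩ _).2 hφ))

/-- A model containing `A`, as a model. -/
@[reducible] def AModel.mod {M : L.Str} {A : Set M.Elt} (N : AModel A) : Mod M.thry :=
  ⟨N.N, N.models⟩

/-- The original model. -/
@[reducible] def AModel.self {M : L.Str} (A : Set M.Elt) : AModel A :=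
  ⟨M, fun x => x.1.2, fun _ _ => Iff.rfl⟩

/-- Models containing `A`, with parameters from `A`. -/
@[reducible] def Ctx.par {M : L.Str} {A : Set M.Elt} (hA : ∀ x ∈ A, x.1.IsValid M.thry) :
    Ctx M.thry where
  Md := AModel A
  mod N := N.mod
  K := A
  P x := x.1.1.toUSet (hA x.1 x.2)
  pt x N := N.e x

theorem Def.exists_injective {C : Ctx T} {U : USet T}
    {R : (N : C.Md) → U.car (C.mod N) → Prop} (hR : Def C U R) :
    ∃ (n : ℕ) (t : Fin n → C.K), Function.Injective t ∧
      ∃ R' : (N : Mod T) → ((b : Fin n) → (C.P (t b)).car N) → U.car N → Prop,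
      Def (Ctx.triv T) ((USet.pi fun b => C.P (t b)).prod U) (fun N p => R' N p.1 p.2) ∧
        ∀ N u, R N u ↔ R' (C.mod N) (fun b => C.pt (t b) N) u := by
  obtain ⟨β, _, t, R', hR', h⟩ := hR
  obtain ⟨n, ⟨e⟩⟩ := Finite.exists_equiv_fin (Set.range t)
  obtain ⟨t', g, hinj, rfl⟩ : ∃ (t' : Fin n → C.K) (g : β → Fin n), Function.Injective t' ∧
      t = fun b => t' (g b) :=
    ⟨fun k => (e.symm k).1, fun b => e ⟨t b, b, rfl⟩,
      Subtype.val_injective.comp e.symm.injective, funext fun b => by simp⟩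
  refine ⟨n, t', hinj, fun N p u => R' N (fun b => p (g b), u), ?_, h⟩
  exact Def.of_bdef (C := Ctx.triv T) (U := (USet.pi fun b => C.P (t' b)).prod U)
    (R := fun N p => R' N (fun b => p.1 (g b), p.2))
    (hR'.reindex (U := (USet.pi fun b => C.P (t' b)).prod U)
      (f := fun N p => (fun b => p.1 (g b), p.2))
      (.pair (.tuple fun b => .app (.fst' .id) (g b)) (.snd' .id)))

/-- The tuple of parameters `t`. -/
@[reducible] def ATup.ofFin {M : L.Str} {A : Set M.Elt} {n : ℕ} (t : Fin n → A) : ATup A :=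
  ⟨n, fun k => (t k).1.1, fun k => (t k).1.2, fun k => (t k).2⟩

/-- The theory of `M` with constants for `A` is complete: a definable statement about the parameters
holds in one model containing `A` exactly when it holds in `M`. -/
theorem Def.iff_self_par {M : L.Str} {A : Set M.Elt} (hA : ∀ x ∈ A, x.1.IsValid M.thry)
    {R : AModel A → Prop} (hR : Def (Ctx.par hA) (USet.unit M.thry) (fun N _ => R N))
    (N : AModel A) : R N ↔ R (AModel.self A) := by
  obtain ⟨n, t, -, R', hR', h⟩ := hR.exists_injective
  obtain ⟨φ, hφ⟩ := Def.exists_drel (X := fun k => (t k).1.1) (fun k => hA _ (t k).2)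
    (R := fun N p => R' N p (fun e => e.elim))
    (hR'.reindex (U := USet.pi fun k => (t k).1.1.toUSet (hA _ (t k).2))
      (f := fun N p => (p, fun e => e.elim)) (.pair .id .to_unit))
  exact ((h N _).trans (hφ N.mod _).symm).trans ((N.elem (ATup.ofFin t) φ).symm.trans
    ((hφ (AModel.self A).mod _).trans (h (AModel.self A) _).symm))

/-! ## Sets of the base that are definable over the parameters -/

namespace Interp

variable {i : Interp L₀ L} {M : L.Str} {hv : ∀ s, (i.srt s).IsValid M.thry} {A : Set M.Elt}

/-- The canonical parameter of an `A`-definable subset of i(V) is an `A`-definable point of the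
base, hence a ∅-definable one, and the subset can be recovered from it. -/
theorem RestrictionTrivial.exists_base_def (hA₀ : i.RestrictionTrivial A)
    (hA : ∀ x ∈ A, x.1.IsValid M.thry) (hs : i.IsCanonicallyEmbedded hv)
    {V : USet (i.pull M).thry} {R : (N : AModel A) → V.car (i.pullMod hv N.mod) → Prop}
    (hR : Def (Ctx.par hA) (i.pb hv V) R) :
    ∃ R₀ : (N : Mod (i.pull M).thry) → V.car N → Prop, Def (Ctx.triv (i.pull M).thry) V R₀ ∧
      ∀ N v, R N v ↔ R₀ (i.pullMod hv N.mod) v := by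
  obtain ⟨n, t, -, R', hR', h⟩ := hR.exists_injective
  obtain ⟨W, E, c, hE, -, hc, hRE⟩ := hs (USet.pi fun k => (t k).1.1.toUSet (hA _ (t k).2)) V R' hR'
  obtain ⟨Y, hY, e, he⟩ := W.exists_dset
  have hYv : ∀ b, (![Y] b).IsValid (i.pull M).thry := fun b => match b with
    | 0 => hY
  obtain ⟨φ, hφ⟩ := exists_mrel (hv := hv) (X := fun k => (t k).1.1) (Y := ![Y])
    (fun k => hA _ (t k).2) hYv (R := fun N p q => e (i.pullMod hv N) (q 0) = c N p) (by
      refine Def.eq2 (C := Ctx.triv M.thry) (U := (USet.pi fun k =>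
        (t k).1.1.toUSet (hA _ (t k).2)).prod (USet.pi fun b =>
        i.pb hv ((![Y] b).toUSet (hYv b)))) (V := i.pb hv W)
        (f := fun N p => e (i.pullMod hv N) (p.2 0)) (g := fun N p => c N p.1) ?_
        (DefMap.comp hc DefMap.fst)
      exact DefMap.comp (C := Ctx.triv M.thry) (W := i.pb hv W) (V := i.pb hv (Y.toUSet hY)) (g := fun N y => e (i.pullMod hv N) y)
        (defMap_pb he) (DefMap.app (V := fun b => i.pb hv ((![Y] b).toUSet (hYv b))) DefMap.snd 0))
  -- `ψ` isolates the canonical parameter in M₀.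
  obtain ⟨m, P, b, hb, ψ, hψ⟩ := hA₀ Y hY
    ((e (i.pullMod hv M.self)).symm (c M.self fun k => (t k).1.2)) ⟨ATup.ofFin t, φ, fun y' =>
      (hφ M.self _ _).trans (Equiv.eq_symm_apply _).symm⟩
  -- The parameters of `ψ` come from the empty set, so there are none.
  have hm : ∀ k : Fin m, False := fun k => hb k
  have hΩ : Def (Ctx.triv (i.pull M).thry) (Y.toUSet hY)
      (fun N y => ψ.Holds N.1 (Pts.app (fun k => (hm k).elim) (pt1 y))) := by
    have hX : ∀ x, ((Sum.elim P ![Y] : Fin m ⊕ Fin 1 → DSet L₀) x).IsValid (i.pull M).thry := by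
      rintro (k | k)
      · exact (hm k).elim
      · exact hYv k
    refine (ψ.def_holds hX).reindex (U := Y.toUSet hY)
      (f := fun N y => Pts.app (fun k => (hm k).elim) (pt1 y)) (.tuple ?_)
    rintro (k | k)
    · exact (hm k).elim
    · match k with
      | 0 => exact .id
  let R₀ : (N : Mod (i.pull M).thry) → V.car N → Prop := fun N v => ∃ y : Y.Pt N.1,
    ψ.Holds N.1 (Pts.app (fun k => (hm k).elim) (pt1 y)) ∧ E N (e N y) v
  have hR₀ : Def (Ctx.triv (i.pull M).thry) V R₀ := by
    refine Def.ex (V := Y.toUSet hY) (Def.and ?_ ?_)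
    · exact hΩ.reindex (U := V.prod (Y.toUSet hY)) (f := fun N p => p.2) (.snd' .id)
    · exact Def.comp2 (C := Ctx.triv (i.pull M).thry) (R := fun N w v => E N w v) hE
        (DefMap.comp he DefMap.snd) DefMap.fst
  -- The equality of the two sets is a statement over `A`, so it need be checked only in `M`, where
  -- the canonical parameter was isolated.
  refine ⟨R₀, hR₀, fun N => (Def.iff_self_par hA (R := fun N => ∀ v, R N v ↔
    R₀ (i.pullMod hv N.mod) v) (Def.all (V := i.pb hv V) (Def.iff ?_ ?_)) N).2 fun v => ?_⟩
  · exact hR.reindex (.snd' .id)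
  · exact (def_pb hR₀).reindex (U := (USet.unit M.thry).prod (i.pb hv V)) (f := fun N p => p.2)
      (.snd' .id)
  · refine (h (AModel.self A) v).trans ((hRE M.self _ v).trans ?_)
    have hb' : b = fun k => (hm k).elim := funext fun k => (hm k).elim
    rw [hb'] at hψ
    constructor
    · exact fun h => ⟨_, (hψ _).2 rfl, by simpa using h⟩
    · rintro ⟨y, hy, h⟩
      obtain rfl := (hψ y).1 hy
      simpa using h

end Interp

end MSLang

namespace MSLang

variable {L : MSLang.{u}}

/-! ## Ultrapowers -/

theorem exists_ultrafilter_of_directed {J ι : Type*} [Nonempty ι] (S : ι → Set J)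
    (hS : ∀ a, (S a).Nonempty) (hd : ∀ a b, ∃ c, S c ⊆ S a ∧ S c ⊆ S b) :
    ∃ 𝒰 : Ultrafilter J, ∀ a, S a ∈ 𝒰 := by
  have h : (⨅ a, Filter.principal (S a)).NeBot := by
    refine Filter.iInf_neBot_of_directed' ?_ fun a => Filter.principal_neBot_iff.2 (hS a)
    intro a b
    obtain ⟨c, h, h'⟩ := hd a b
    exact ⟨c, Filter.principal_mono.2 h, Filter.principal_mono.2 h'⟩
  exact ⟨Ultrafilter.of _, fun a => Ultrafilter.of_le _
    (Filter.mem_iInf_of_mem a (Filter.mem_principal_self _))⟩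

/-- The ultrapower of a structure. -/
def Str.ultrapower (M : L.Str) {J : Type u} (𝒰 : Ultrafilter J) : L.Str where
  car s := Filter.Germ (𝒰 : Filter J) (M.car s)
  rel R x := ∃ r : (k : Fin (L.ar R)) → J → M.car (L.arSrt R k),
    (∀ k, (r k : Filter.Germ (𝒰 : Filter J) _) = x k) ∧ ∀ᶠ j in (𝒰 : Filter J), M.rel R fun k => r k j

section

variable {M : L.Str} {J : Type u} (𝒰 : Ultrafilter J)

/-- The class of a sequence of tuples. -/
def Str.germ {α : Type} {σ : α → L.Srt} (v : (a : α) → J → M.car (σ a)) :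
    (M.ultrapower 𝒰).Tup σ :=
  fun a => ((v a : J → M.car (σ a)) : Filter.Germ (𝒰 : Filter J) (M.car (σ a)))

theorem Vr.val_germ {α : Type} {σ : α → L.Srt} {n : ℕ} {τ : Fin n → L.Srt} {s : L.Srt}
    (v : (a : α) → J → M.car (σ a)) (w : (k : Fin n) → J → M.car (τ k)) (x : Vr σ τ s) :
    x.val (Str.germ 𝒰 v) (Str.germ 𝒰 w) =
      ((fun j => x.val (N := M) (fun a => v a j) (fun k => w k j) : J → M.car s) :
        Filter.Germ (𝒰 : Filter J) (M.car s)) := by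
  obtain ⟨a | k, rfl⟩ := x <;> rfl

/-- Łoś's theorem. Only the universal quantifier needs work, where counterexamples are chosen index
by index. -/
theorem BFml.realize_germ {α : Type} {σ : α → L.Srt} (v : (a : α) → J → M.car (σ a)) {n : ℕ}
    {τ : Fin n → L.Srt} (φ : BFml L σ n τ) (w : (k : Fin n) → J → M.car (τ k)) :
    φ.Realize (M.ultrapower 𝒰) (Str.germ 𝒰 v) (Str.germ 𝒰 w) ↔
      ∀ᶠ j in (𝒰 : Filter J), φ.Realize M (fun a => v a j) (fun k => w k j) := by
  induction φ with
  | bot => simp [BFml.Realize, 𝒰.neBot.ne]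
  | eq s x y =>
    simp only [BFml.Realize, Vr.val_germ]
    exact Filter.Germ.coe_eq
  | @rel n τ R x =>
    simp only [BFml.Realize, Vr.val_germ]
    constructor
    · rintro ⟨r, hr, h⟩
      filter_upwards [h, Filter.eventually_all.2 fun k => Filter.Germ.coe_eq.1 (hr k)] with j h e
      rwa [← show (fun k => r k j) = _ from funext e]
    · exact fun h => ⟨_, fun _ => rfl, h⟩
  | imp φ ψ ihφ ihψ =>
    simp only [BFml.Realize, ihφ, ihψ]
    exact Ultrafilter.eventually_imp.symm
  | @all n τ s φ ih =>
    have hc : ∀ x : J → M.car s, Fin.cons (α := fun k => (M.ultrapower 𝒰).car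
        ((Fin.cons s τ : Fin (n + 1) → L.Srt) k)) (x : Filter.Germ (𝒰 : Filter J) (M.car s))
          (Str.germ 𝒰 w) = Str.germ 𝒰 (Fin.cons (α := fun k => J → M.car
            ((Fin.cons s τ : Fin (n + 1) → L.Srt) k)) x w) := by
      intro x
      funext k
      refine Fin.cases rfl (fun k => rfl) k
    have hc' : ∀ (x : J → M.car s) j, (fun k => (Fin.cons (α := fun k => J → M.car
            ((Fin.cons s τ : Fin (n + 1) → L.Srt) k)) x w : ∀ k, _) k j) =
        Fin.cons (α := fun k => M.car ((Fin.cons s τ : Fin (n + 1) → L.Srt) k)) (x j)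
          (fun k => w k j) := by
      intro x j
      funext k
      refine Fin.cases rfl (fun k => rfl) k
    constructor
    · intro h
      by_contra h'
      rw [Filter.not_eventually, Ultrafilter.frequently_iff_eventually] at h'
      simp only [BFml.Realize, not_forall] at h'
      -- Sorts may be empty; an index where the formula fails supplies the element needed as a
      -- default for the choice of counterexamples.
      obtain ⟨j₀, x₀, -⟩ := h'.exists
      have : Nonempty (M.car s) := ⟨x₀⟩
      obtain ⟨x, hx⟩ := Filter.skolem.1 h'
      have h₁ := h (x : Filter.Germ (𝒰 : Filter J) (M.car s))
      replace h₁ := (ih _).1 ((congrArg (fun w => φ.Realize _ _ w) (hc x)).mp h₁)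
      obtain ⟨j, h₂, h₃⟩ := (h₁.and hx).exists
      rw [hc'] at h₂
      exact h₃ h₂
    · intro h x
      obtain ⟨x, rfl⟩ := Quotient.exists_rep x
      refine (congrArg (fun w => φ.Realize _ _ w) (hc x)).mpr ((ih _).2 ?_)
      filter_upwards [h] with j h
      rw [hc']
      exact h (x j)

theorem Str.sat_germ {α : Type} {σ : α → L.Srt} (φ : L.Fml σ) (v : (a : α) → J → M.car (σ a)) :
    (M.ultrapower 𝒰).Sat φ (Str.germ 𝒰 v) ↔
      ∀ᶠ j in (𝒰 : Filter J), M.Sat φ (fun a => v a j) := by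
  have h := BFml.realize_germ 𝒰 v φ (fun k => k.elim0)
  have h₁ : (Str.germ 𝒰 (M := M) (σ := fun k : Fin 0 => k.elim0) fun k => k.elim0) =
      fun k => k.elim0 := funext fun k => k.elim0
  have h₂ : ∀ j : J, (fun k : Fin 0 => (k.elim0 : J → M.car (k.elim0)) j) =
      fun k => k.elim0 := fun j => funext fun k => k.elim0
  rw [h₁] at h
  refine h.trans ?_
  refine Filter.eventually_congr (Filter.Eventually.of_forall fun j => ?_)
  unfold Str.Sat
  rw [show (fun k : Fin 0 => (k.elim0 : J → M.car (k.elim0)) j) =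
    fun k => k.elim0 from funext fun k => k.elim0]

theorem Str.ultrapower_models : (M.ultrapower 𝒰).Models M.thry := by
  intro φ hφ
  have h := (Str.sat_germ 𝒰 (M := M) φ (fun e => e.elim)).2 (Filter.Eventually.of_forall fun j => by
    rwa [show (fun a : Empty => (a.elim : J → M.car a.elim) j) = fun e => e.elim from
      funext fun e => e.elim])
  rwa [show (Str.germ 𝒰 (M := M) (σ := fun e : Empty => e.elim) fun e => e.elim) =
      fun e => e.elim from funext fun e => e.elim] at h

/-- The ultrapower, as a model. -/
@[reducible] def Str.upow (M : L.Str) {J : Type u} (𝒰 : Ultrafilter J) : Mod M.thry :=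
  ⟨M.ultrapower 𝒰, Str.ultrapower_models 𝒰⟩

theorem FO.germ {α : Type} {σ : α → L.Srt} {R : (N : Mod M.thry) → N.1.Tup σ → Prop}
    (hR : FO M.thry σ R) (v : (a : α) → J → M.car (σ a)) :
    R (M.upow 𝒰) (Str.germ 𝒰 v) ↔ ∀ᶠ j in (𝒰 : Filter J), R M.self (fun a => v a j) := by
  obtain ⟨φ, hφ⟩ := hR
  refine (hφ (M.upow 𝒰) _).symm.trans ((Str.sat_germ 𝒰 φ v).trans ?_)
  exact Filter.eventually_congr (Filter.Eventually.of_forall fun j => hφ M.self _)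

namespace USet

theorem exists_ulim (U : USet M.thry) (s : J → U.car M.self) : ∃ t : U.car (M.upow 𝒰),
    ∀ v : (a : U.ι) → J → M.car (U.srt a),
      (∀ᶠ j in (𝒰 : Filter J), U.val M.self (fun a => v a j) (s j)) →
        U.val (M.upow 𝒰) (Str.germ 𝒰 v) t := by
  choose v hv using fun j => U.surj M.self (s j)
  obtain ⟨t, ht⟩ := (FO.germ 𝒰 U.dom (fun a j => v j a)).2
    (Filter.Eventually.of_forall fun j => ⟨s j, hv j⟩)
  refine ⟨t, fun w hw => ?_⟩
  obtain ⟨t', ht', h⟩ := (FO.germ 𝒰 U.eqv (v := Sum.rec (fun a j => v j a) w)).2 (by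
    filter_upwards [hw] with j h
    exact ⟨s j, hv j, h⟩)
  exact U.func _ _ _ _ ht ht' ▸ h

/-- The limit, in an ultrapower, of a sequence of points. -/
noncomputable def ulim (U : USet M.thry) (s : J → U.car M.self) : U.car (M.upow 𝒰) :=
  (U.exists_ulim 𝒰 s).choose

theorem ulim_val (U : USet M.thry) {s : J → U.car M.self} {v : (a : U.ι) → J → M.car (U.srt a)}
    (h : ∀ᶠ j in (𝒰 : Filter J), U.val M.self (fun a => v a j) (s j)) :
    U.val (M.upow 𝒰) (Str.germ 𝒰 v) (U.ulim 𝒰 s) :=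
  (U.exists_ulim 𝒰 s).choose_spec v h

theorem ulim_prod (U V : USet M.thry) (s : J → (U.prod V).car M.self) :
    (U.prod V).ulim 𝒰 s = (U.ulim 𝒰 fun j => (s j).1, V.ulim 𝒰 fun j => (s j).2) := by
  choose v hv using fun j => (U.prod V).surj M.self (s j)
  refine (U.prod V).func _ (Str.germ 𝒰 fun a j => v j a) _ _
    ((U.prod V).ulim_val 𝒰 (Filter.Eventually.of_forall hv)) ⟨?_, ?_⟩
  · exact U.ulim_val 𝒰 (v := fun a j => v j (.inl a)) (Filter.Eventually.of_forall fun j => (hv j).1)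
  · exact V.ulim_val 𝒰 (v := fun a j => v j (.inr a)) (Filter.Eventually.of_forall fun j => (hv j).2)

theorem ulim_pi {β : Type} [Finite β] (U : β → USet M.thry) (s : J → (USet.pi U).car M.self) :
    (USet.pi U).ulim 𝒰 s = fun b => (U b).ulim 𝒰 fun j => s j b := by
  choose v hv using fun j => (USet.pi U).surj M.self (s j)
  exact (USet.pi U).func _ (Str.germ 𝒰 fun a j => v j a) _ _
    ((USet.pi U).ulim_val 𝒰 (Filter.Eventually.of_forall hv)) fun b =>
      (U b).ulim_val 𝒰 (v := fun a j => v j ⟨b, a⟩) (Filter.Eventually.of_forall fun j => hv j b)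

end USet

theorem Def.ulim {U : USet M.thry} {R : (N : Mod M.thry) → U.car N → Prop}
    (hR : Def (Ctx.triv M.thry) U R) (s : J → U.car M.self) :
    R (M.upow 𝒰) (U.ulim 𝒰 s) ↔ ∀ᶠ j in (𝒰 : Filter J), R M.self (s j) := by
  choose v hv using fun j => U.surj M.self (s j)
  have h := FO.germ 𝒰 hR.bdef (fun a j => v j a)
  refine (BDef.iff_of_val R (U.ulim_val 𝒰 (Filter.Eventually.of_forall hv))).symm.trans (h.trans ?_)
  exact Filter.eventually_congr (Filter.Eventually.of_forall fun j =>
    BDef.iff_of_val (R := R) (hv j))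

/-- An ultrapower, with the parameters interpreted by the limit of interpretations in which every
true formula eventually holds. -/
@[reducible] noncomputable def AModel.ulim {A : Set M.Elt} (hA : ∀ x ∈ A, x.1.IsValid M.thry)
    (e : J → (x : A) → x.1.1.Pt M)
    (he : ∀ (t : ATup A) (φ : DRel t.P), φ.Holds M t.a →
      ∀ᶠ j in (𝒰 : Filter J), φ.Holds M (fun k => e j ⟨⟨t.P k, t.a k⟩, t.mem k⟩)) : AModel A where
  N := (M.upow 𝒰).1
  e x := (x.1.1.toUSet (hA _ x.2)).ulim 𝒰 fun j => e j x
  elem t φ := by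
    have hX : ∀ k, (t.P k).IsValid M.thry := fun k => hA _ (t.mem k)
    have h₁ : ∀ φ : DRel t.P, φ.Holds (M.upow 𝒰).1 (fun k => ((t.P k).toUSet (hX k)).ulim 𝒰
        fun j => e j ⟨⟨t.P k, t.a k⟩, t.mem k⟩) ↔
          ∀ᶠ j in (𝒰 : Filter J), φ.Holds M (fun k => e j ⟨⟨t.P k, t.a k⟩, t.mem k⟩) := by
      intro φ
      have := Def.ulim 𝒰 (φ.def_holds (C := Ctx.triv M.thry) hX)
        (fun j k => e j ⟨⟨t.P k, t.a k⟩, t.mem k⟩)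
      rwa [USet.ulim_pi] at this
    -- Only true relations are assumed to hold eventually; the converse follows by applying this to
    -- the negation of `φ`.
    refine ⟨fun h => (h₁ φ).2 (he t φ h), fun h => by_contra fun h' => ?_⟩
    obtain ⟨ψ, hψ⟩ := Def.exists_drel hX (φ.def_holds (C := Ctx.triv M.thry) hX).not
    obtain ⟨j, h₂, h₃⟩ := ((he t ψ ((hψ M.self _).2 h')).and ((h₁ φ).1 h)).exists
    exact (hψ M.self _).1 h₂ h₃

end

end MSLang

/-! ### Internality by compactness: embedding definable sets in the base -/

namespace MSLang

variable {L₀ L : MSLang.{u}}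

/-- Definable subsets. -/
@[reducible] def USet.sub {T : L.Theory} (P : USet T) (R : (N : Mod T) → P.car N → Prop)
    (hR : Def (Ctx.triv T) P R) : USet T :=
  P.quot (fun N => {p // R N p}) (fun _ p s => p = s.1) (fun _ s => ⟨s.1, rfl⟩)
    (fun _ _ _ _ h h' => Subtype.ext (h.symm.trans h'))
    (hR.congr fun _ p => ⟨fun h => ⟨⟨p, h⟩, rfl⟩, fun ⟨s, h⟩ => h ▸ s.2⟩)
    ((Def.and Def.eq (hR.reindex (U := P.prod P) (.fst' .id))).congr fun _ p =>
      ⟨fun ⟨h, h'⟩ => ⟨⟨p.1, h'⟩, rfl, h.symm⟩, fun ⟨s, h, h'⟩ => ⟨h.trans h'.symm, h ▸ s.2⟩⟩)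

theorem DefMap.sub_val {T : L.Theory} {C : Ctx T} {P : USet T} {R : (N : Mod T) → P.car N → Prop}
    {hR : Def (Ctx.triv T) P R} : DefMap C (P.sub R hR) P (fun _ s => s.1) :=
  (Def.reindex (U := (P.sub R hR).prod P) (Def.quot_rel (P := P)) (f := fun N p => (p.2, p.1))
    (.pair (.snd' .id) (.fst' .id))).congr fun _ _ => eq_comm

section

variable {M : L.Str} {A : Set M.Elt}

/-- The ultrapower, with the parameters interpreted by themselves. -/
@[reducible] noncomputable def AModel.upow {J : Type u} (𝒰 : Ultrafilter J)
    (hA : ∀ x ∈ A, x.1.IsValid M.thry) : AModel A :=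
  AModel.ulim 𝒰 hA (fun _ x => x.1.2) fun _ _ h => Filter.Eventually.of_forall fun _ => h

theorem Def.ulim_upow {J : Type u} (𝒰 : Ultrafilter J) {hA : ∀ x ∈ A, x.1.IsValid M.thry}
    {U : USet M.thry} {R : (N : AModel A) → U.car N.mod → Prop} (hR : Def (Ctx.par hA) U R)
    (s : J → U.car M.self) :
    R (AModel.upow 𝒰 hA) (U.ulim 𝒰 s) ↔ ∀ᶠ j in (𝒰 : Filter J), R (AModel.self A) (s j) := by
  obtain ⟨n, t, -, R', hR', h⟩ := hR.exists_injective
  have h₁ := Def.ulim 𝒰 hR' (fun j => (fun k => (t k).1.2, s j))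
  rw [USet.ulim_prod, USet.ulim_pi] at h₁
  exact (h _ _).trans (h₁.trans (Filter.eventually_congr
    (Filter.Eventually.of_forall fun j => (h (AModel.self A) _).symm)))

end

namespace Interp

variable {i : Interp L₀ L} {M : L.Str} {hv : ∀ s, (i.srt s).IsValid M.thry} {A : Set M.Elt}

/-- The finitely many parameters are treated as additional variables of the family and then
specialized. -/
theorem IsCanonicallyEmbedded.par (hs : i.IsCanonicallyEmbedded hv)
    {hA : ∀ x ∈ A, x.1.IsValid M.thry} {U : USet M.thry} {V : USet (i.pull M).thry}
    {R : (N : AModel A) → U.car N.mod → V.car (i.pullMod hv N.mod) → Prop}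
    (hR : Def (Ctx.par hA) (U.prod (i.pb hv V)) (fun N p => R N p.1 p.2)) :
    ∃ (W : USet (i.pull M).thry) (E : (N : Mod (i.pull M).thry) → W.car N → V.car N → Prop)
      (c : (N : AModel A) → U.car N.mod → W.car (i.pullMod hv N.mod)),
      Def (Ctx.triv (i.pull M).thry) (W.prod V) (fun N p => E N p.1 p.2) ∧
      (∀ N w w', (∀ y, E N w y ↔ E N w' y) → w = w') ∧
      DefMap (Ctx.par hA) U (i.pb hv W) c ∧
      ∀ N u y, R N u y ↔ E (i.pullMod hv N.mod) (c N u) y := by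
  obtain ⟨n, t, -, R', hR', h⟩ := hR.exists_injective
  obtain ⟨W, E, c, hE, hE', hc, hRE⟩ := hs ((USet.pi fun k => (t k).1.1.toUSet (hA _ (t k).2)).prod U)
    V (fun N p y => R' N p.1 (p.2, y)) (hR'.reindex
      (U := ((USet.pi fun k => (t k).1.1.toUSet (hA _ (t k).2)).prod U).prod (i.pb hv V))
      (f := fun N p => (p.1.1, (p.1.2, p.2)))
      (.pair (.fst' (.fst' .id)) (.pair (.snd' (.fst' .id)) (.snd' .id))))
  refine ⟨W, E, fun N u => c N.mod (fun k => N.e (t k), u), hE, hE', ?_, fun N u y =>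
    (h N (u, y)).trans (hRE N.mod (fun k => N.e (t k), u) y)⟩
  refine DefMap.comp (C := Ctx.par hA)
    (V := (USet.pi fun k => (t k).1.1.toUSet (hA _ (t k).2)).prod U) (W := i.pb hv W)
    (g := fun N p => c N.mod p) (f := fun N u => (fun k => N.e (t k), u)) (DefMap.lift hc)
    (DefMap.pair (DefMap.tuple fun k => DefMap.param (C := Ctx.par hA) (t k)) DefMap.id)

/-- If no `A`-definable map to the base were injective, some model containing `A` would have
distinct points q, q' that no such map separates. But q is defined by a formula over N₀ ∪ A, and the
canonical parameter of the family of its solutions separates q from q'. -/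
theorem IsInternalityParams.exists_injective (hA : i.IsInternalityParams A)
    (hs : i.IsCanonicallyEmbedded hv) (U : USet M.thry) :
    ∃ (W : USet (i.pull M).thry)
      (c : (N : AModel A) → U.car N.mod → W.car (i.pullMod hv N.mod)),
      DefMap (Ctx.par hA.valid) U (i.pb hv W) c ∧ ∀ N, Function.Injective (c N) := by
  by_contra hcon
  let ι := {x : (W : USet (i.pull M).thry) ×
    ((N : AModel A) → U.car N.mod → W.car (i.pullMod hv N.mod)) //
      DefMap (Ctx.par hA.valid) U (i.pb hv x.1) x.2}
  have hdef : ∀ x : ι, Def (Ctx.par hA.valid) (U.prod U)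
      (fun N p => x.1.2 N p.1 = x.1.2 N p.2) := fun x =>
    Def.eq2 (C := Ctx.par hA.valid) (U := U.prod U) (V := i.pb hv x.1.1)
      (f := fun N p => x.1.2 N p.1) (g := fun N p => x.1.2 N p.2)
      (DefMap.comp (C := Ctx.par hA.valid) x.2 DefMap.fst)
      (DefMap.comp (C := Ctx.par hA.valid) x.2 DefMap.snd)
  have : Nonempty ι := ⟨⟨⟨USet.unit _, fun _ _ e => e.elim⟩,
    Def.top.congr fun _ _ => ⟨fun _ => funext fun e => e.elim, fun _ => trivial⟩⟩⟩
  obtain ⟨𝒰, h𝒰⟩ := exists_ultrafilter_of_directed (J := U.car M.self × U.car M.self)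
    (fun x : ι => {q | q.1 ≠ q.2 ∧ x.1.2 (AModel.self A) q.1 = x.1.2 (AModel.self A) q.2}) (by
      intro x
      by_contra h
      refine hcon ⟨x.1.1, x.1.2, x.2, fun N => (Def.iff_self_par hA.valid
        (R := fun N => Function.Injective (x.1.2 N)) ?_ N).2 ?_⟩
      · refine Def.all (C := Ctx.par hA.valid) (V := U) (Def.all (V := U) (Def.imp ?_ ?_))
        · exact (hdef x).reindex (U := ((USet.unit M.thry).prod U).prod U)
            (f := fun N p => (p.1.2, p.2)) (.pair (.snd' (.fst' .id)) (.snd' .id))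
        · exact Def.eq.reindex (U := ((USet.unit M.thry).prod U).prod U)
            (f := fun N p => (p.1.2, p.2)) (.pair (.snd' (.fst' .id)) (.snd' .id))
      · intro q q' e
        by_contra h'
        exact h ⟨(q, q'), h', e⟩) (by
      intro x y
      -- The maps are directed by pairing: points identified by the pair are identified by both
      -- components.
      refine ⟨⟨⟨x.1.1.prod y.1.1, fun N u => (x.1.2 N u, y.1.2 N u)⟩,
        DefMap.comp (C := Ctx.par hA.valid) (V := (i.pb hv x.1.1).prod (i.pb hv y.1.1))
          (W := i.pb hv (x.1.1.prod y.1.1)) (g := fun N p => p)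
          (f := fun N u => (x.1.2 N u, y.1.2 N u)) defMap_prod_pb (DefMap.pair x.2 y.2)⟩, ?_, ?_⟩
      · exact fun q h => ⟨h.1, (Prod.ext_iff.1 h.2).1⟩
      · exact fun q h => ⟨h.1, (Prod.ext_iff.1 h.2).2⟩)
  let N := AModel.upow 𝒰 hA.valid
  let q : U.car N.mod := U.ulim 𝒰 Prod.fst
  let q' : U.car N.mod := U.ulim 𝒰 Prod.snd
  have hne : q ≠ q' := by
    have h := Def.ulim_upow 𝒰 (hA := hA.valid) (Def.eq (U := U)).not (s := fun q => q)
    rw [USet.ulim_prod] at h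
    refine h.2 ?_
    filter_upwards [h𝒰 (Classical.arbitrary ι)] with q hq using hq.1
  have heq : ∀ x : ι, x.1.2 N q = x.1.2 N q' := by
    intro x
    have h := Def.ulim_upow 𝒰 (hdef x) (s := fun q => q)
    rw [USet.ulim_prod] at h
    refine h.2 ?_
    filter_upwards [h𝒰 x] with q hq using hq.2
  obtain ⟨X, hX, e, he⟩ := U.exists_dset
  obtain ⟨m, P, b, hb, φ, hφ⟩ := hA.generates N X ((e N.mod).symm q) hX
  -- Each parameter of the formula that defines q is the value of an `A`-definable map at a base
  -- point: a coordinate map for an element of N₀, a constant map on a one-point set for an element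
  -- of `A`. So all parameters can vary in the base.
  have hP : ∀ k, ∃ (hP : (P k).IsValid M.thry) (W : USet (i.pull M).thry)
      (v : (N : AModel A) → W.car (i.pullMod hv N.mod) → (P k).Pt N.N)
      (w : W.car (i.pullMod hv N.mod)),
      DefMap (Ctx.par hA.valid) (i.pb hv W) ((P k).toUSet hP) v ∧ v N w = b k := by
    intro k
    obtain ⟨s, y, h⟩ | ⟨x, h⟩ := hb k
    · obtain ⟨h₁, h₂⟩ := Sigma.mk.inj_iff.1 h
      generalize P k = Z, b k = z at h₁ h₂
      subst h₁
      obtain rfl := eq_of_heq h₂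
      refine ⟨hv s, USet.raw _ (fun _ : Unit => s), fun _ v => v (), fun _ => z, ?_, rfl⟩
      exact DefMap.app (V := fun _ : Unit => (i.srt s).toUSet (hv s)) defMap_pb_raw ()
    · obtain ⟨h₁, h₂⟩ := Sigma.mk.inj_iff.1 h
      generalize P k = Z, b k = z at h₁ h₂
      subst h₁
      obtain rfl := eq_of_heq h₂
      exact ⟨hA.valid _ x.2, USet.unit _, fun N _ => N.e x, fun e => e.elim,
        DefMap.param (C := Ctx.par hA.valid) x, rfl⟩
  choose hP W v w hvd hvw using hP
  have hXv : ∀ x, ((Sum.elim P ![X] : Fin m ⊕ Fin 1 → DSet L) x).IsValid M.thry := by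
    rintro (k | k)
    · exact hP k
    · match k with
      | 0 => exact hX
  -- `c` sends x to the canonical parameter of the set of base tuples at which the formula holds of
  -- x. It is one of the maps that do not separate q and q', and so the formula holds of q' at the
  -- tuple `w` as well.
  obtain ⟨W', E, c, -, -, hc, hRE⟩ := hs.par (hA := hA.valid) (U := U) (V := USet.pi W)
    (R := fun N x y => φ.Holds N.N (Pts.app (fun k => v k N (y k)) (pt1 ((e N.mod).symm x)))) (by
      refine Def.comp (C := Ctx.par hA.valid) (U := U.prod (i.pb hv (USet.pi W)))
        (V := USet.pi fun b => (Sum.elim P ![X] b).toUSet (hXv b))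
        (f := fun N p => Pts.app (fun k => v k N (p.2 k)) (pt1 ((e N.mod).symm p.1)))
        (φ.def_holds hXv) (DefMap.tuple ?_)
      rintro (k | k)
      · refine DefMap.comp (C := Ctx.par hA.valid) (U := U.prod (i.pb hv (USet.pi W)))
          (V := i.pb hv (W k)) (W := (P k).toUSet (hP k)) (g := v k)
          (f := fun N p => p.2 k) (hvd k) (DefMap.comp (C := Ctx.par hA.valid)
            (U := U.prod (i.pb hv (USet.pi W))) (V := i.pb hv (USet.pi W)) (W := i.pb hv (W k)) (g := fun N y => y k)
            (f := fun N p => p.2) (defMap_pb (U := USet.pi W) (V := W k) (f := fun N y => y k) (DefMap.of_struct (.app .id k))) DefMap.snd)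
      · match k with
        | 0 =>
          refine DefMap.comp (C := Ctx.par hA.valid) (V := U) (W := X.toUSet hX)
            (g := fun N x => (e N.mod).symm x)
            (DefMap.lift (f := fun N x => (e N).symm x) (DefMap.symm (U := X.toUSet hX)
              (f := fun N x => e N x) he fun N x y =>
              eq_comm.trans (Equiv.symm_apply_eq _).symm)) DefMap.fst)
  have h₁ := hRE N q w
  have h₂ := hRE N q' w
  rw [show c N q = c N q' from heq ⟨⟨W', c⟩, hc⟩] at h₁
  have h₃ := h₂.2 (h₁.1 (by
    rw [show (fun k => v k N (w k)) = b from funext hvw]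
    exact (hφ _).2 rfl))
  rw [show (fun k => v k N (w k)) = b from funext hvw, hφ] at h₃
  exact hne ((e N.mod).symm.injective h₃.symm)

/-- Every definable set is in bijection over `A` with a definable set of the base. -/
theorem IsInternalityParams.exists_equiv (hA : i.IsInternalityParams A)
    (hA₀ : i.RestrictionTrivial A) (hs : i.IsCanonicallyEmbedded hv) (U : USet M.thry) :
    ∃ (D : USet (i.pull M).thry) (b : (N : AModel A) → U.car N.mod ≃ D.car (i.pullMod hv N.mod)),
      DefMap (Ctx.par hA.valid) U (i.pb hv D) (fun N x => b N x) := by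
  obtain ⟨W, c, hc, hinj⟩ := hA.exists_injective hs U
  -- The image of an `A`-definable embedding is an `A`-definable set of the base, hence ∅-definable
  -- there.
  obtain ⟨R₀, hR₀, h⟩ := hA₀.exists_base_def hA.valid hs (V := W)
    (R := fun N w => ∃ x, c N x = w) (Def.ex (V := U) (hc.reindex
      (U := (i.pb hv W).prod U) (f := fun N p => (p.2, p.1)) (.pair (.snd' .id) (.fst' .id))))
  refine ⟨W.sub R₀ hR₀, fun N => Equiv.ofBijective
    (fun x => ⟨c N x, (h N _).1 ⟨x, rfl⟩⟩) ⟨fun x y e => hinj N (Subtype.ext_iff.1 e), ?_⟩, ?_⟩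
  · rintro ⟨w, hw⟩
    obtain ⟨x, rfl⟩ := (h N w).2 hw
    exact ⟨x, rfl⟩
  · refine Def.congr (C := Ctx.par hA.valid) (U := U.prod (i.pb hv (W.sub R₀ hR₀)))
      (R := fun (N : AModel A) p => c N p.1 = p.2.1) ?_ fun N p =>
        ⟨fun h => Subtype.ext h, fun h => Subtype.ext_iff.1 h⟩
    exact Def.eq2 (C := Ctx.par hA.valid) (U := U.prod (i.pb hv (W.sub R₀ hR₀)))
      (V := i.pb hv W) (f := fun N p => c N p.1)
      (g := fun N p => p.2.1) (DefMap.comp (C := Ctx.par hA.valid) hc DefMap.fst)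
      (DefMap.comp (C := Ctx.par hA.valid) (U := U.prod (i.pb hv (W.sub R₀ hR₀)))
        (V := i.pb hv (W.sub R₀ hR₀)) (W := i.pb hv W) (g := fun N s => s.1) (f := fun N p => p.2)
        (defMap_pb (U := W.sub R₀ hR₀) (V := W) (f := fun N s => s.1) DefMap.sub_val) DefMap.snd)

end Interp

end MSLang

namespace MSLang

variable {L₀ L : MSLang.{u}}

/-! ## Automorphisms -/

theorem BFml.realize_strIso {N N' : L.Str} (e : StrIso N N') {α : Type} {σ : α → L.Srt}
    (v : N.Tup σ) {n : ℕ} {τ : Fin n → L.Srt} (φ : BFml L σ n τ) (w : N.Tup τ) :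
    φ.Realize N' (fun a => e.map _ (v a)) (fun k => e.map _ (w k)) ↔ φ.Realize N v w := by
  have hval : ∀ {n : ℕ} {τ : Fin n → L.Srt} (w : N.Tup τ) {s : L.Srt} (x : Vr σ τ s),
      x.val (N := N') (fun a => e.map _ (v a)) (fun k => e.map _ (w k)) = e.map s (x.val v w) := by
    rintro n τ w s ⟨a | k, rfl⟩ <;> rfl
  induction φ with
  | bot => rfl
  | eq s x y =>
    simp only [BFml.Realize, hval]
    exact (e.map s).apply_eq_iff_eq
  | rel R x =>
    simp only [BFml.Realize, hval]
    exact e.rel_iff R _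
  | imp φ ψ ihφ ihψ => exact imp_congr (ihφ w) (ihψ w)
  | @all n τ s φ ih =>
    have hc : ∀ x, (Fin.cons (α := fun k => N'.car ((Fin.cons s τ : Fin (n + 1) → L.Srt) k))
        (e.map s x) (fun k => e.map _ (w k))) = fun k => e.map _ ((Fin.cons (α := fun k => N.car
          ((Fin.cons s τ : Fin (n + 1) → L.Srt) k)) x w : N.Tup _) k) := by
      intro x
      funext k
      refine Fin.cases rfl (fun k => rfl) k
    refine ((e.map s).forall_congr fun {x} => ?_).symm
    refine (ih _).symm.trans ?_
    rw [← hc]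
    exact Iff.rfl

/-- Automorphisms of a structure preserve all formulas. -/
def Aut.ofStrIso {N : L.Str} (e : StrIso N N) : Aut N where
  map := e.map
  sat_iff σ φ v := by
    have h := BFml.realize_strIso e v φ (fun k => k.elim0)
    rwa [show (fun k : Fin 0 => e.map (k.elim0) (k.elim0 : N.car k.elim0)) = fun k => k.elim0 from
      funext fun k => k.elim0] at h

section

variable {T : L.Theory} {N : Mod T} (f : Aut N.1)

theorem FO.aut {α : Type} {σ : α → L.Srt} {R : (N : Mod T) → N.1.Tup σ → Prop}
    (hR : FO T σ R) (v : N.1.Tup σ) : R N (fun a => f.map _ (v a)) ↔ R N v := by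
  obtain ⟨φ, hφ⟩ := hR
  exact (hφ N _).symm.trans ((f.sat_iff σ φ v).trans (hφ N v))

namespace Aut

theorem exists_app (U : USet T) (s : U.car N) : ∃ t, ∀ v, U.val N v s →
    U.val N (fun a => f.map _ (v a)) t := by
  obtain ⟨v, hv⟩ := U.surj N s
  obtain ⟨t, ht⟩ := (U.dom.aut f v).2 ⟨s, hv⟩
  refine ⟨t, fun w hw => ?_⟩
  have h := (U.eqv.aut f (Str.Tup.app v w)).2 ⟨s, hv, hw⟩
  obtain ⟨t', h₁, h₂⟩ := h
  exact U.func N _ _ _ ht h₁ ▸ h₂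

/-- The action of an automorphism on a uniformly definable set. -/
noncomputable def app (U : USet T) (s : U.car N) : U.car N := (f.exists_app U s).choose

theorem val_app {U : USet T} {s : U.car N} {v : N.1.Tup U.srt} (h : U.val N v s) :
    U.val N (fun a => f.map _ (v a)) (f.app U s) :=
  (f.exists_app U s).choose_spec v h

theorem app_eq {U : USet T} {s t : U.car N} {v : N.1.Tup U.srt} (h : U.val N v s)
    (h' : U.val N (fun a => f.map _ (v a)) t) : f.app U s = t :=
  U.func N _ _ _ (f.val_app h) h'

theorem app_prod (U V : USet T) (p : (U.prod V).car N) :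
    f.app (U.prod V) p = (f.app U p.1, f.app V p.2) := by
  obtain ⟨v, hv⟩ := (U.prod V).surj N p
  exact f.app_eq hv ⟨f.val_app hv.1, f.val_app hv.2⟩

theorem app_pi {β : Type} [Finite β] (U : β → USet T) (p : (USet.pi U).car N) :
    f.app (USet.pi U) p = fun b => f.app (U b) (p b) := by
  obtain ⟨v, hv⟩ := (USet.pi U).surj N p
  exact f.app_eq hv fun b => f.val_app (hv b)

theorem app_toUSet {X : DSet L} (hX : X.IsValid T) (x : X.Pt N.1) :
    f.app (X.toUSet hX) x = f.onPt x := by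
  obtain ⟨v, hv, rfl⟩ := DSet.exists_repr x
  exact f.app_eq (U := X.toUSet hX) (v := v) ⟨_, rfl, hv, rfl⟩
    ⟨_, rfl, (f.sat_iff _ X.dom v).2 hv, rfl⟩

theorem app_iff {U : USet T} {R : (N : Mod T) → U.car N → Prop} (hR : Def (Ctx.triv T) U R)
    (s : U.car N) : R N (f.app U s) ↔ R N s := by
  obtain ⟨v, hv⟩ := U.surj N s
  exact (BDef.iff_of_val R (f.val_app hv)).symm.trans ((hR.bdef.aut f v).trans
    (BDef.iff_of_val R hv))

theorem app_map {U V : USet T} {g : (N : Mod T) → U.car N → V.car N}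
    (hg : DefMap (Ctx.triv T) U V g) (x : U.car N) : g N (f.app U x) = f.app V (g N x) := by
  have h := (f.app_iff (U := U.prod V) hg (x, g N x)).2 rfl
  rwa [app_prod] at h

theorem app_injective (U : USet T) : Function.Injective (f.app U) := by
  intro x y h
  refine (f.app_iff (U := U.prod U) Def.eq (x, y)).1 ?_
  rw [app_prod]
  exact h

end Aut

end

/-- A point of i(U) is represented by points of the interpreting sets of sorts, all of which `f`
fixes. -/
theorem Interp.FixesBase.app_pb {i : Interp L₀ L} {M : L.Str}
    {hv : ∀ s, (i.srt s).IsValid M.thry} {N : Mod M.thry} {f : Aut N.1} (hf : i.FixesBase f)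
    (U : USet (i.pull M).thry) (s : (i.pb hv U).car N) : f.app (i.pb hv U) s = s := by
  obtain ⟨v, hv'⟩ := U.surj (i.pullMod hv N) s
  have h := (f.app_iff (U := (i.pullRaw hv U.srt).prod (i.pb hv U))
    (def_pb_val (C := Ctx.triv M.thry)) (v, s)).2 hv'
  rw [Aut.app_prod, Aut.app_pi] at h
  refine U.func (i.pullMod hv N) v _ _ ?_ hv'
  rwa [show (fun a => f.app ((i.srt (U.srt a)).toUSet (hv (U.srt a))) (v a)) = v from
    funext fun a => (f.app_toUSet _ _).trans (hf _ _)] at h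

/-- A sort. -/
@[reducible] def USet.sort (T : L.Theory) (s : L.Srt) : USet T :=
  (USet.raw T (fun _ : Unit => s)).quot (fun N => N.1.car s) (fun _ v x => v () = x)
    (fun _ x => ⟨fun _ => x, rfl⟩) (fun _ _ _ _ h h' => h.symm.trans h')
    (Def.top.congr fun _ v => ⟨fun _ => ⟨v (), rfl⟩, fun _ => trivial⟩)
    (Def.eq.congr fun _ p => ⟨fun h => ⟨_, rfl, (congrFun h ()).symm⟩,
      fun ⟨_, h, h'⟩ => funext fun _ => h.trans h'.symm⟩)

theorem DefMap.coord {T : L.Theory} {C : Ctx T} {α : Type} [Finite α] {σ : α → L.Srt} (a : α) :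
    DefMap C (USet.raw T σ) (USet.sort T (σ a)) (fun _ v => v a) :=
  (Def.quot_rel (P := USet.raw T (fun _ : Unit => σ a))).reindex
    (U := (USet.raw T σ).prod (USet.sort T (σ a))) (f := fun _ p => (fun _ => p.1 a, p.2))
    (.pair (StructMap.comp (V := USet.raw T σ) (W := USet.raw T fun _ : Unit => σ a)
      (g := fun _ v _ => v a) ⟨fun _ => a, fun _ => rfl, fun N v w s (h : v = s) e => by
        subst h
        exact funext fun k => (eq_of_heq (e k)).symm⟩ (.fst' .id)) (.snd' .id))

theorem DefMap.raw_of_sorts {T : L.Theory} {C : Ctx T} {α : Type} [Finite α] {σ : α → L.Srt} :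
    DefMap C (USet.pi fun k => USet.sort T (σ k)) (USet.raw T σ) (fun _ p => p) :=
  DefMap.symm (U := USet.raw T σ) (V := USet.pi fun k => USet.sort T (σ k))
    (f := fun _ v => v) (DefMap.tuple fun k => DefMap.coord k) fun _ _ _ => eq_comm

theorem Def.rel {T : L.Theory} {C : Ctx T} (R : L.Rel) :
    Def C (USet.pi fun k => USet.sort T (L.arSrt R k))
      (fun N p => (C.mod N).1.rel R fun k => p k) := by
  have h : Def C (USet.raw T (L.arSrt R)) (fun N v => (C.mod N).1.rel R v) :=
    Def.of_bdef (U := USet.raw T (L.arSrt R)) (R := fun N v => N.1.rel R v)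
      (BDef.of_fo (U := USet.raw T (L.arSrt R)) (FO.rel R) fun N v s (h : v = s) => h ▸ Iff.rfl)
  exact Def.comp (C := C) (U := USet.pi fun k => USet.sort T (L.arSrt R k))
    (V := USet.raw T (L.arSrt R)) (R := fun N v => (C.mod N).1.rel R v) (f := fun N p => p) h
    DefMap.raw_of_sorts

/-! ## Automorphisms from interpretations of the parameters -/

namespace Interp

variable {i : Interp L₀ L} {M : L.Str} {hv : ∀ s, (i.srt s).IsValid M.thry} {A : Set M.Elt}

/-- Two interpretations of the parameters in the same structure are conjugate over the base. -/
theorem IsInternalityParams.exists_aut (hA : i.IsInternalityParams A)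
    (hA₀ : i.RestrictionTrivial A) (hs : i.IsCanonicallyEmbedded hv) {N : L.Str}
    {e₁ e₂ : (x : A) → x.1.1.Pt N}
    (h₁ : ∀ (t : ATup A) (φ : DRel t.P),
      φ.Holds M t.a ↔ φ.Holds N (fun j => e₁ ⟨⟨t.P j, t.a j⟩, t.mem j⟩))
    (h₂ : ∀ (t : ATup A) (φ : DRel t.P),
      φ.Holds M t.a ↔ φ.Holds N (fun j => e₂ ⟨⟨t.P j, t.a j⟩, t.mem j⟩)) :
    ∃ f : Aut N, i.FixesBase f ∧ ∀ (U : USet M.thry)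
      (R : (N : AModel A) → U.car N.mod → Prop), Def (Ctx.par hA.valid) U R →
      ∀ u : U.car (AModel.mod ⟨N, e₁, h₁⟩), R ⟨N, e₁, h₁⟩ u ↔
        R ⟨N, e₂, h₂⟩ (f.app (N := AModel.mod ⟨N, e₂, h₂⟩) U u) := by
  choose D b hb using fun U => hA.exists_equiv hA₀ hs U
  -- The bijections with the base depend on the interpretation of `A`; going to the base with the
  -- first and back with the second gives a permutation of every definable set.
  let s : (U : USet M.thry) → U.car (AModel.mod ⟨N, e₁, h₁⟩) ≃ U.car (AModel.mod ⟨N, e₁, h₁⟩) :=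
    fun U => (b U ⟨N, e₁, h₁⟩).trans (b U ⟨N, e₂, h₂⟩).symm
  have hsb : ∀ U u, b U ⟨N, e₂, h₂⟩ (s U u) = b U ⟨N, e₁, h₁⟩ u := fun U u => by simp [s]
  -- Transported to the base, an `A`-definable relation becomes a ∅-definable relation `R₀` that
  -- does not see how `A` is interpreted; this is why `s` carries its first version to its second.
  have key : ∀ (U : USet M.thry) (W : USet (i.pull M).thry)
      (R : (N : AModel A) → U.car N.mod → W.car (i.pullMod hv N.mod) → Prop),
      Def (Ctx.par hA.valid) (U.prod (i.pb hv W)) (fun N p => R N p.1 p.2) → ∀ u w,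
      (R ⟨N, e₁, h₁⟩ u w ↔ R ⟨N, e₂, h₂⟩ (s U u) w) := by
    intro U W R hR u w
    obtain ⟨R₀, hR₀, h⟩ := hA₀.exists_base_def hA.valid hs (V := (D U).prod W)
      (R := fun N p => R N ((b U N).symm p.1) p.2) (by
        refine Def.comp2 (C := Ctx.par hA.valid) (U := i.pb hv ((D U).prod W)) hR
          (f := fun N p => (b U N).symm p.1) (g := fun N p => p.2) ?_ defMap_pb_snd
        refine DefMap.comp (C := Ctx.par hA.valid) (U := i.pb hv ((D U).prod W))
          (V := i.pb hv (D U)) (W := U) (g := fun N d => (b U N).symm d) (f := fun N p => p.1)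
          (DefMap.symm (U := U) (V := i.pb hv (D U)) (f := fun N x => b U N x) (hb U)
            fun N x y => eq_comm.trans (Equiv.symm_apply_eq _).symm) defMap_pb_fst)
    have h₃ := h ⟨N, e₁, h₁⟩ (b U ⟨N, e₁, h₁⟩ u, w)
    have h₄ := h ⟨N, e₂, h₂⟩ (b U ⟨N, e₂, h₂⟩ (s U u), w)
    simp only [Equiv.symm_apply_apply] at h₃ h₄
    rw [hsb] at h₄
    exact h₃.trans h₄.symm
  -- The permutations commute with ∅-definable maps; hence those of the sorts determine all others,
  -- and they preserve the basic relations.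
  have nat : ∀ (U V : USet M.thry) (g : (N : Mod M.thry) → U.car N → V.car N),
      DefMap (Ctx.triv M.thry) U V g → ∀ u, s V (g _ u) = g _ (s U u) := by
    intro U V g hg u
    have h := (key U (D V) (fun N x d => b V N (g N.mod x) = d) ?_ u _).1 rfl
    · exact ((Equiv.symm_apply_eq _).2 h.symm)
    · refine Def.eq2 (C := Ctx.par hA.valid) (U := U.prod (i.pb hv (D V))) (V := i.pb hv (D V))
        (f := fun N p => b V N (g N.mod p.1)) (g := fun N p => p.2) ?_ DefMap.snd
      exact DefMap.comp (C := Ctx.par hA.valid) (U := U.prod (i.pb hv (D V)))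
        (V := V) (W := i.pb hv (D V)) (g := fun N x => b V N x)
        (f := fun N p => g N.mod p.1) (hb V) (DefMap.comp (C := Ctx.par hA.valid)
          (U := U.prod (i.pb hv (D V))) (V := U) (W := V) (f := fun N p => p.1) (g := fun N x => g N.mod x) (DefMap.lift hg) DefMap.fst)
  have keyT : ∀ (U : USet M.thry) (R : (N : AModel A) → U.car N.mod → Prop),
      Def (Ctx.par hA.valid) U R → ∀ u, (R ⟨N, e₁, h₁⟩ u ↔ R ⟨N, e₂, h₂⟩ (s U u)) :=
    fun U R hR u => key U (USet.unit _) (fun N x _ => R N x)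
      (hR.reindex (U := U.prod (i.pb hv (USet.unit _))) (f := fun N p => p.1) (.fst' .id)) u
      (fun e => e.elim)
  let f : Aut N := Aut.ofStrIso
    { map := fun r => s (USet.sort M.thry r)
      rel_iff := fun R x => by
        have h := keyT _ _ (Def.rel R) x
        have h' : s (USet.pi fun k => USet.sort M.thry (L.arSrt R k)) x =
            fun k => s (USet.sort M.thry (L.arSrt R k)) (x k) := funext fun k =>
          (nat (USet.pi fun k => USet.sort M.thry (L.arSrt R k))
            (USet.sort M.thry (L.arSrt R k)) (fun _ p => p k)
            (DefMap.of_struct (C := Ctx.triv M.thry)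
              (U := USet.pi fun k => USet.sort M.thry (L.arSrt R k)) (.app .id k)) x).symm
        rw [h'] at h
        exact h.symm }
  -- `s` preserves the relation "v represents u", and on tuples it acts coordinatewise, as `f` does.
  have hf : ∀ U u, f.app (N := AModel.mod ⟨N, e₂, h₂⟩) U u = s U u := by
    intro U u
    obtain ⟨v, hv'⟩ := U.surj (AModel.mod ⟨N, e₁, h₁⟩) u
    refine f.app_eq (N := AModel.mod ⟨N, e₂, h₂⟩) hv' ?_
    have h := (keyT _ _ (Def.of_bdef (C := Ctx.par hA.valid) (BDef.val (U := U))) (v, u)).1 hv'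
    have h₁' := nat ((USet.raw M.thry U.srt).prod U) (USet.raw M.thry U.srt) _ DefMap.fst (v, u)
    have h₂' := nat ((USet.raw M.thry U.srt).prod U) U _ DefMap.snd (v, u)
    dsimp only at h₁' h₂' h
    rw [← h₁', ← h₂'] at h
    have h₃ : s (USet.raw M.thry U.srt) v = fun a => f.map _ (v a) := funext fun a =>
      (nat (USet.raw M.thry U.srt) (USet.sort M.thry (U.srt a)) _ (DefMap.coord a) v).symm
    rwa [h₃] at h
  refine ⟨f, fun r x => ?_, fun U R hR u => ?_⟩
  · refine (f.app_toUSet (N := AModel.mod ⟨N, e₂, h₂⟩) (hv r) x).symm.trans ?_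
    rw [hf]
    refine (key ((i.srt r).toUSet (hv r)) (USet.raw _ fun _ : Unit => r) (fun N x v => x = v ())
      ?_ x (fun _ => x)).1 rfl
    refine Def.eq2 (C := Ctx.par hA.valid) (U := ((i.srt r).toUSet (hv r)).prod
      (i.pb hv (USet.raw _ fun _ : Unit => r))) (V := (i.srt r).toUSet (hv r))
      (f := fun N p => p.1) (g := fun N p => p.2 ()) DefMap.fst ?_
    exact DefMap.comp (C := Ctx.par hA.valid) (U := ((i.srt r).toUSet (hv r)).prod
      (i.pb hv (USet.raw _ fun _ : Unit => r))) (V := i.pb hv (USet.raw _ fun _ : Unit => r))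
      (W := (i.srt r).toUSet (hv r))
      (g := fun N v => v ()) (f := fun N p => p.2) (DefMap.app
        (V := fun _ : Unit => (i.srt r).toUSet (hv r)) defMap_pb_raw ()) DefMap.snd
  · rw [hf]
    exact keyT U R hR u

end Interp

end MSLang

namespace MSLang

variable {L₀ L : MSLang.{u}} {M : L.Str} {A : Set M.Elt}

/-! ## Invariant sets -/

theorem exists_injective_enum {K : Type*} {m n : ℕ} (s : Fin m → K) (t : Fin n → K) :
    ∃ (k : ℕ) (g : Fin k → K), Function.Injective g ∧ ∃ (p : Fin m → Fin k) (q : Fin n → Fin k),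
      s = (fun j => g (p j)) ∧ t = fun j => g (q j) := by
  obtain ⟨k, ⟨e⟩⟩ := Finite.exists_equiv_fin (Set.range (Sum.elim s t))
  exact ⟨k, fun j => (e.symm j).1, Subtype.val_injective.comp e.symm.injective,
    fun j => e ⟨s j, .inl j, rfl⟩, fun j => e ⟨t j, .inr j, rfl⟩,
    funext fun j => by simp, funext fun j => by simp⟩

/-- Injectivity prevents conflicting prescriptions; parameters outside the finite list keep their
own values. -/
theorem exists_assignment {n : ℕ} {g : Fin n → A} (hg : Function.Injective g)
    (p : (k : Fin n) → (g k).1.1.Pt M) : ∃ e : (x : A) → x.1.1.Pt M, ∀ k, e (g k) = p k := by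
  classical
  refine ⟨fun x => if h : ∃ k, g k = x then h.choose_spec ▸ p h.choose else x.1.2, fun k => ?_⟩
  have h : ∃ k', g k' = g k := ⟨k, rfl⟩
  refine (dif_pos h).trans ?_
  have h' := hg h.choose_spec
  generalize h.choose_spec = e at *
  generalize h.choose = k' at *
  subst h'
  rfl

namespace Interp

variable {i : Interp L₀ L} {hv : ∀ s, (i.srt s).IsValid M.thry}

/-- True conditions on finitely many parameters. -/
structure Condition (hA : ∀ x ∈ A, x.1.IsValid M.thry) where
  n : ℕ
  t : Fin n → A
  ψ : (N : Mod M.thry) → ((k : Fin n) → (t k).1.1.Pt N.1) → Prop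
  hψ : Def (Ctx.triv M.thry) (USet.pi fun k => (t k).1.1.toUSet (hA _ (t k).2)) ψ
  holds : ψ M.self fun k => (t k).1.2

theorem Condition.exists_le {hA : ∀ x ∈ A, x.1.IsValid M.thry} (c d : Condition hA) :
    ∃ b : Condition hA, ∀ (N : Mod M.thry) (e : (x : A) → x.1.1.Pt N.1),
      b.ψ N (fun k => e (b.t k)) → c.ψ N (fun k => e (c.t k)) ∧ d.ψ N (fun k => e (d.t k)) := by
  obtain ⟨m, s, φ, hφ, h⟩ := c
  obtain ⟨n, t, ψ, hψ, h'⟩ := d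
  obtain ⟨k, g, -, p, q, rfl, rfl⟩ := exists_injective_enum s t
  refine ⟨⟨k, g, fun N x => φ N (fun j => x (p j)) ∧ ψ N (fun j => x (q j)),
    Def.and ?_ ?_, h, h'⟩, fun N e h => h⟩
  · exact hφ.reindex (U := USet.pi fun k => (g k).1.1.toUSet (hA _ (g k).2))
      (f := fun N x j => x (p j)) (.tuple fun j => .app .id (p j))
  · exact hψ.reindex (U := USet.pi fun k => (g k).1.1.toUSet (hA _ (g k).2))
      (f := fun N x j => x (q j)) (.tuple fun j => .app .id (q j))

theorem Condition.holds_model {hA : ∀ x ∈ A, x.1.IsValid M.thry} (c : Condition hA)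
    (N : AModel A) : c.ψ N.mod (fun k => N.e (c.t k)) :=
  (Def.iff_self_par hA (R := fun N => c.ψ N.mod (fun k => N.e (c.t k)))
    (Def.comp (C := Ctx.par hA) (U := USet.unit M.thry)
      (V := USet.pi fun k => (c.t k).1.1.toUSet (hA _ (c.t k).2)) (R := fun N x => c.ψ N.mod x)
      (f := fun N _ k => N.e (c.t k))
      (Def.lift c.hψ) (DefMap.tuple fun k => DefMap.param (C := Ctx.par hA) (c.t k))) N).2 c.holds

/-- Galois descent. If the set depended on how `A` is interpreted, however many true conditions are
imposed on the interpretation, an ultrapower would carry two interpretations of `A` and a point in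
one version of the set but not in the other. An automorphism over the base conjugates the
interpretations, which contradicts invariance. -/
theorem IsInternalityParams.exists_def_of_invariant (hA : i.IsInternalityParams A)
    (hA₀ : i.RestrictionTrivial A) (hs : i.IsCanonicallyEmbedded hv) {U : USet M.thry}
    {R : (N : AModel A) → U.car N.mod → Prop} (hR : Def (Ctx.par hA.valid) U R)
    (hinv : ∀ (N : AModel A) (f : Aut N.N), i.FixesBase f → ∀ u, R N u →
      R N (f.app (N := N.mod) U u)) :
    ∃ R₁ : (N : Mod M.thry) → U.car N → Prop, Def (Ctx.triv M.thry) U R₁ ∧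
      ∀ N u, R N u ↔ R₁ N.mod u := by
  obtain ⟨n, t, -, R', hR', h⟩ := hR.exists_injective
  by_contra hcon
  have : Nonempty (Condition hA.valid) := ⟨0, fun k => k.elim0, fun _ _ => True, Def.top, trivial⟩
  obtain ⟨𝒰, h𝒰⟩ := exists_ultrafilter_of_directed
    (J := ((x : A) → x.1.1.Pt M) × ((x : A) → x.1.1.Pt M) × U.car M.self)
    (fun c : Condition hA.valid => {j | c.ψ M.self (fun k => j.1 (c.t k)) ∧
      c.ψ M.self (fun k => j.2.1 (c.t k)) ∧ R' M.self (fun k => j.1 (t k)) j.2.2 ∧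
      ¬ R' M.self (fun k => j.2.1 (t k)) j.2.2}) (by
    rintro c
    by_contra hc
    -- Otherwise, in `M`, all interpretations satisfying the condition `c` define the same set.
    have hc' : ∀ (e₁ e₂ : (x : A) → x.1.1.Pt M) (u : U.car M.self),
        c.ψ M.self (fun k => e₁ (c.t k)) → c.ψ M.self (fun k => e₂ (c.t k)) →
        R' M.self (fun k => e₁ (t k)) u → R' M.self (fun k => e₂ (t k)) u :=
      fun e₁ e₂ u h₁ h₂ h₃ => by_contra fun h₄ => hc ⟨(e₁, e₂, u), h₁, h₂, h₃, h₄⟩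
    clear hc
    have hmod := fun N => c.holds_model N
    obtain ⟨m, s, ψ, hψ, _⟩ := c
    obtain ⟨k, g, hg, p, q, rfl, rfl⟩ := exists_injective_enum s t
    dsimp only at hc' hmod
    let P := USet.pi fun k => (g k).1.1.toUSet (hA.valid _ (g k).2)
    have hall : ∀ (N : Mod M.thry) (x y : P.car N) (u : U.car N), ψ N (fun k => x (p k)) →
        ψ N (fun k => y (p k)) → R' N (fun k => x (q k)) u → R' N (fun k => y (q k)) u := by
      intro N
      refine (Def.iff_self (R := fun N => ∀ (x y : P.car N) (u : U.car N),
        ψ N (fun k => x (p k)) → ψ N (fun k => y (p k)) →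
        R' N (fun k => x (q k)) u → R' N (fun k => y (q k)) u) ?_ N).2 ?_
      · refine Def.all (C := Ctx.triv M.thry) (V := P) (Def.all (V := P) (Def.all (V := U)
          (Def.imp ?_ (Def.imp ?_ (Def.imp ?_ ?_)))))
        · exact hψ.reindex (U := (((USet.unit M.thry).prod P).prod P).prod U)
            (f := fun N x j => x.1.1.2 (p j))
            (.tuple fun j => .app (.snd' (.fst' (.fst' .id))) (p j))
        · exact hψ.reindex (U := (((USet.unit M.thry).prod P).prod P).prod U)
            (f := fun N x j => x.1.2 (p j)) (.tuple fun j => .app (.snd' (.fst' .id)) (p j))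
        · exact hR'.reindex (U := (((USet.unit M.thry).prod P).prod P).prod U)
            (f := fun N x => (fun j => x.1.1.2 (q j), x.2))
            (.pair (.tuple fun j => .app (.snd' (.fst' (.fst' .id))) (q j)) (.snd' .id))
        · exact hR'.reindex (U := (((USet.unit M.thry).prod P).prod P).prod U)
            (f := fun N x => (fun j => x.1.2 (q j), x.2))
            (.pair (.tuple fun j => .app (.snd' (.fst' .id)) (q j)) (.snd' .id))
      · intro x y u h₁ h₂ h₃
        obtain ⟨e₁, he₁⟩ := exists_assignment hg x
        obtain ⟨e₂, he₂⟩ := exists_assignment hg y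
        have h₄ := hc' e₁ e₂ u
        simp only [he₁, he₂] at h₄
        exact h₄ h₁ h₂ h₃
    -- All tuples satisfying `ψ` define the same set, so the true parameters can be replaced by an
    -- existentially quantified tuple, and no parameters remain.
    refine hcon ⟨fun N u => ∃ x : P.car N, ψ N (fun k => x (p k)) ∧ R' N (fun k => x (q k)) u,
      Def.ex (V := P) (Def.and ?_ ?_), fun N u => (h N u).trans ⟨fun h' => ?_, ?_⟩⟩
    · exact hψ.reindex (U := U.prod P) (f := fun N x j => x.2 (p j))
        (.tuple fun j => .app (.snd' .id) (p j))
    · exact hR'.reindex (U := U.prod P) (f := fun N x => (fun j => x.2 (q j), x.1))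
        (.pair (.tuple fun j => .app (.snd' .id) (q j)) (.fst' .id))
    · exact ⟨fun k => N.e (g k), hmod N, h'⟩
    · rintro ⟨x, hx, hx'⟩
      exact hall N.mod x (fun k => N.e (g k)) u hx (hmod N) hx') (by
    intro c d
    obtain ⟨b, hb⟩ := c.exists_le d
    exact ⟨b, fun j hj => ⟨(hb _ _ hj.1).1, (hb _ _ hj.2.1).1, hj.2.2⟩,
      fun j hj => ⟨(hb _ _ hj.1).2, (hb _ _ hj.2.1).2, hj.2.2⟩⟩)
  have hcond : ∀ (t : ATup A) (φ : DRel t.P), φ.Holds M t.a → ∃ c : Condition hA.valid,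
      ∀ e : (x : A) → x.1.1.Pt M, c.ψ M.self (fun k => e (c.t k)) →
        φ.Holds M (fun k => e ⟨⟨t.P k, t.a k⟩, t.mem k⟩) := fun t φ hφ =>
    ⟨⟨t.m, fun k => ⟨⟨t.P k, t.a k⟩, t.mem k⟩, fun N x => φ.Holds N.1 x,
      φ.def_holds (C := Ctx.triv M.thry) fun k => hA.valid _ (t.mem k), hφ⟩, fun e h => h⟩
  have he₁ : ∀ (t : ATup A) (φ : DRel t.P), φ.Holds M t.a → ∀ᶠ j : ((x : A) → x.1.1.Pt M) ×
      ((x : A) → x.1.1.Pt M) × U.car M.self in (𝒰 : Filter _),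
      φ.Holds M (fun k => j.1 ⟨⟨t.P k, t.a k⟩, t.mem k⟩) := fun t φ hφ => by
    obtain ⟨c, hc⟩ := hcond t φ hφ
    filter_upwards [h𝒰 c] with j hj using hc _ hj.1
  have he₂ : ∀ (t : ATup A) (φ : DRel t.P), φ.Holds M t.a → ∀ᶠ j : ((x : A) → x.1.1.Pt M) ×
      ((x : A) → x.1.1.Pt M) × U.car M.self in (𝒰 : Filter _),
      φ.Holds M (fun k => j.2.1 ⟨⟨t.P k, t.a k⟩, t.mem k⟩) := fun t φ hφ => by
    obtain ⟨c, hc⟩ := hcond t φ hφ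
    filter_upwards [h𝒰 c] with j hj using hc _ hj.2.1
  let N₁ := AModel.ulim (J := ((x : A) → x.1.1.Pt M) × ((x : A) → x.1.1.Pt M) × U.car M.self)
    𝒰 hA.valid (fun j => j.1) he₁
  let N₂ := AModel.ulim (J := ((x : A) → x.1.1.Pt M) × ((x : A) → x.1.1.Pt M) × U.car M.self)
    𝒰 hA.valid (fun j => j.2.1) he₂
  let w : U.car N₁.mod := U.ulim 𝒰 fun j => j.2.2
  have h₁ : R N₁ w := by
    have h₃ := Def.ulim 𝒰 hR' (fun j => (fun k => j.1 (t k), j.2.2))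
    rw [USet.ulim_prod, USet.ulim_pi] at h₃
    refine (h N₁ w).2 (h₃.2 ?_)
    filter_upwards [h𝒰 (Classical.arbitrary _)] with j hj using hj.2.2.1
  have h₂ : ¬ R N₂ w := by
    have h₃ := Def.ulim 𝒰 hR' (fun j => (fun k => j.2.1 (t k), j.2.2))
    rw [USet.ulim_prod, USet.ulim_pi] at h₃
    refine fun h₄ => ?_
    obtain ⟨j, h₅, h₆⟩ := ((h₃.1 ((h N₂ w).1 h₄)).and (h𝒰 (Classical.arbitrary _))).exists
    exact h₆.2.2.2 h₅
  -- `f` takes the second interpretation to the first: from R(N₁, w), invariance gives R(N₁, f w),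
  -- which conjugation turns into R(N₂, w).
  obtain ⟨f, hf, hfR⟩ := hA.exists_aut hA₀ hs N₂.elem N₁.elem
  exact h₂ ((hfR U R hR w).2 (hinv N₁ f hf w h₁))

end Interp

end MSLang

/-! ### Descent of equivariant maps -/

namespace MSLang

variable {L₀ L : MSLang.{u}}

theorem Def.isFn {T : L.Theory} {C : Ctx T} {U V : USet T}
    {R : (N : C.Md) → U.car (C.mod N) → V.car (C.mod N) → Prop}
    (hR : Def C (U.prod V) (fun N p => R N p.1 p.2)) :
    Def C (USet.unit T) (fun N _ => IsFn (R N)) := by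
  refine Def.all (V := U) (R := fun N _ x => ∃! y, R N x y) (Def.congr (C := C)
    (U := (USet.unit T).prod U)
    (R := fun N p => ∃ y : V.car (C.mod N), R N p.2 y ∧ ∀ y', R N p.2 y' → y' = y)
    (Def.ex (V := V) (Def.and ?_ (Def.all (V := V) (Def.imp ?_ ?_)))) fun _ _ => Iff.rfl)
  · exact hR.reindex (U := ((USet.unit T).prod U).prod V) (f := fun N p => (p.1.2, p.2))
      (.pair (.snd' (.fst' .id)) (.snd' .id))
  · exact hR.reindex (U := (((USet.unit T).prod U).prod V).prod V)
      (f := fun N p => (p.1.1.2, p.2)) (.pair (.snd' (.fst' (.fst' .id))) (.snd' .id))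
  · exact Def.eq.reindex (U := (((USet.unit T).prod U).prod V).prod V)
      (f := fun N p => (p.2, p.1.2)) (.pair (.snd' .id) (.snd' (.fst' .id)))

namespace Interp

variable {i : Interp L₀ L} {M : L.Str} {hv : ∀ s, (i.srt s).IsValid M.thry} {A : Set M.Elt}

theorem ARel.def_holds (hA : ∀ x ∈ A, x.1.IsValid M.thry) {X : DSet L} (hX : X.IsValid M.thry)
    {D : DSet L₀} (hD : D.IsValid (i.pull M).thry) (α : i.ARel A ![X] ![D]) :
    Def (Ctx.par hA) ((X.toUSet hX).prod (i.pb hv (D.toUSet hD)))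
      (fun N p => α.Holds N (pt1 p.1) (pt1 p.2)) := by
  have hX' : ∀ b, ((Sum.elim α.t.P ![X] : Fin α.t.m ⊕ Fin 1 → DSet L) b).IsValid M.thry := by
    rintro (k | k)
    · exact hA _ (α.t.mem k)
    · match k with
      | 0 => exact hX
  have hD' : ∀ b, (![D] b).IsValid (i.pull M).thry := fun b => match b with
    | 0 => hD
  refine Def.comp (C := Ctx.par hA) (U := (X.toUSet hX).prod (i.pb hv (D.toUSet hD)))
    (V := (USet.pi fun b => ((Sum.elim α.t.P ![X] : Fin α.t.m ⊕ Fin 1 → DSet L) b).toUSet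
      (hX' b)).prod (USet.pi fun c => i.pb hv ((![D] c).toUSet (hD' c))))
    (R := fun N q => α.φ.Holds N.N q.1 q.2)
    (f := fun N p => (Pts.app (α.t.inModel N) (pt1 p.1), pt1 p.2))
    (MRel.def_holds (C := Ctx.par hA) hX' hD' α.φ) (DefMap.pair (DefMap.tuple ?_) (DefMap.tuple ?_))
  · rintro (k | k)
    · exact DefMap.param (C := Ctx.par hA) (⟨_, α.t.mem k⟩ : A)
    · match k with
      | 0 => exact DefMap.fst
  · intro k
    match k with
    | 0 => exact DefMap.snd

theorem exists_arel {hA : ∀ x ∈ A, x.1.IsValid M.thry} {X : DSet L} {hX : X.IsValid M.thry}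
    {D : DSet L₀} {hD : D.IsValid (i.pull M).thry}
    {R : (N : AModel A) → X.Pt N.N → D.Pt (i.pull N.N) → Prop}
    (hR : Def (Ctx.par hA) ((X.toUSet hX).prod (i.pb hv (D.toUSet hD)))
      (fun N p => R N p.1 p.2)) :
    ∃ α : i.ARel A ![X] ![D], ∀ N x d, α.Holds N (pt1 x) (pt1 d) ↔ R N x d := by
  obtain ⟨n, t, -, R', hR', h⟩ := hR.exists_injective
  have hX' : ∀ b, ((Sum.elim (fun k => (t k).1.1) ![X] : Fin n ⊕ Fin 1 → DSet L) b).IsValid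
      M.thry := by
    rintro (k | k)
    · exact hA _ (t k).2
    · match k with
      | 0 => exact hX
  have hD' : ∀ b, (![D] b).IsValid (i.pull M).thry := fun b => match b with
    | 0 => hD
  obtain ⟨φ, hφ⟩ := exists_mrel (hv := hv) hX' hD'
    (R := fun N p q => R' N (fun k => p (.inl k)) (p (.inr 0), q 0))
    (hR'.reindex (U := (USet.pi fun b => ((Sum.elim (fun k => (t k).1.1) ![X] :
      Fin n ⊕ Fin 1 → DSet L) b).toUSet (hX' b)).prod
      (USet.pi fun c => i.pb hv ((![D] c).toUSet (hD' c))))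
      (f := fun N p => (fun k => p.1 (.inl k), (p.1 (.inr 0), p.2 0)))
      (.pair (.tuple fun k => .app (.fst' .id) (Sum.inl k))
        (.pair (.app (.fst' .id) (Sum.inr 0)) (.app (.snd' .id) 0))))
  exact ⟨⟨ATup.ofFin t, φ⟩, fun N x d => (hφ N.mod _ _).trans (h N (x, d)).symm⟩

/-- The composite α_E⁻¹ ∘ f ∘ α_D is definable over `A`. An automorphism over the base acts as a
point of G, so equivariance of α, β and f makes the graph invariant, and it descends. -/
theorem IsActIso.exists_map (hA : i.IsInternalityParams A) (hA₀ : i.RestrictionTrivial A)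
    (hs : i.IsCanonicallyEmbedded hv) {G : i.GaloisGroup M.thry} {H : ProGroup (i.pull M).thry}
    {θ : i.ProIso A G.grp H} {X Y : DSet L} {hX : X.IsValid M.thry} {hY : Y.IsValid M.thry}
    {D E : DSet L₀} (hD : D.IsValid (i.pull M).thry) (hE : E.IsValid (i.pull M).thry)
    {m : H.Act D} {m' : H.Act E} {α : i.ARel A ![X] ![D]} {β : i.ARel A ![Y] ![E]}
    (hα : IsActIso G θ hX m α) (hβ : IsActIso G θ hY m' β) {f : DRel ![D, E]}
    (hf : IsEquivariantMap m m' f) :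
    ∃ F : DRel ![X, Y], (∀ N : L.Str, N.Models M.thry →
        IsFn (fun (x : X.Pt N) (y : Y.Pt N) => F.Holds N (pt2 x y))) ∧
      ∀ (N : AModel A) (x : X.Pt N.N) (y : Y.Pt N.N) (d : D.Pt (i.pull N.N))
        (e : E.Pt (i.pull N.N)), α.Holds N (pt1 x) (pt1 d) → β.Holds N (pt1 y) (pt1 e) →
        (F.Holds N.N (pt2 x y) ↔ f.Holds (i.pull N.N) (pt2 d e)) := by
  let R : (N : AModel A) → X.Pt N.N → Y.Pt N.N → Prop := fun N x y =>
    ∃ (d : D.Pt (i.pull N.N)) (e : E.Pt (i.pull N.N)), α.Holds N (pt1 x) (pt1 d) ∧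
      β.Holds N (pt1 y) (pt1 e) ∧ f.Holds (i.pull N.N) (pt2 d e)
  have hR : Def (Ctx.par hA.valid) ((X.toUSet hX).prod (Y.toUSet hY)) (fun N p => R N p.1 p.2) := by
    refine Def.ex (C := Ctx.par hA.valid) (V := i.pb hv (D.toUSet hD)) (Def.ex
      (V := i.pb hv (E.toUSet hE)) (Def.and ?_ (Def.and ?_ ?_)))
    · exact (α.def_holds hA.valid hX hD).reindex (U := (((X.toUSet hX).prod (Y.toUSet hY)).prod
        (i.pb hv (D.toUSet hD))).prod (i.pb hv (E.toUSet hE))) (f := fun N p => (p.1.1.1, p.1.2))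
        (.pair (.fst' (.fst' (.fst' .id))) (.snd' (.fst' .id)))
    · exact (β.def_holds hA.valid hY hE).reindex (U := (((X.toUSet hX).prod (Y.toUSet hY)).prod
        (i.pb hv (D.toUSet hD))).prod (i.pb hv (E.toUSet hE))) (f := fun N p => (p.1.1.2, p.2))
        (.pair (.snd' (.fst' (.fst' .id))) (.snd' .id))
    · exact (def_pb₂ (hv := hv) (U := D.toUSet hD) (V := E.toUSet hE)
        (R := fun N d e => f.Holds N.1 (pt2 d e)) f.def_holds₂).reindex
        (U := (((X.toUSet hX).prod (Y.toUSet hY)).prod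
        (i.pb hv (D.toUSet hD))).prod (i.pb hv (E.toUSet hE))) (f := fun N p => (p.1.2, p.2))
        (.pair (.snd' (.fst' .id)) (.snd' .id))
  have hRf : ∀ (N : AModel A) x y d e, α.Holds N (pt1 x) (pt1 d) → β.Holds N (pt1 y) (pt1 e) →
      (R N x y ↔ f.Holds (i.pull N.N) (pt2 d e)) := by
    refine fun N x y d e hd he => ⟨?_, fun h => ⟨d, e, hd, he, h⟩⟩
    rintro ⟨d', e', hd', he', h⟩
    rwa [(hα.fn N x).unique hd hd', (hβ.fn N y).unique he he']
  obtain ⟨R₁, hR₁, h⟩ := hA.exists_def_of_invariant hA₀ hs hR (by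
    rintro N g hg ⟨x, y⟩ ⟨d, e, hd, he, h⟩
    rw [Aut.app_prod, Aut.app_toUSet, Aut.app_toUSet]
    obtain ⟨g', hg', -⟩ := G.exists_pt N.N N.models g hg
    obtain ⟨d', hd', -⟩ := hα.fn N (g.onPt x)
    obtain ⟨e', he', -⟩ := hβ.fn N (g.onPt y)
    refine ⟨d', e', hd', he', hf.equivariant _ (i.pull_models hv N.mod) (θ.θ N g') d d' e e' h
      ?_ ?_⟩
    · exact hα.equivariant N g' _ _ _ _ hd hd' ((hg' X hX _ _).2 rfl)
    · exact hβ.equivariant N g' _ _ _ _ he he' ((hg' Y hY _ _).2 rfl))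
  obtain ⟨F, hF⟩ := Def.exists_drel₂ (hX := hX) (hY := hY) (R := fun N x y => R₁ N (x, y)) hR₁
  refine ⟨F, fun N hN => ?_, fun N x y d e hd he =>
    (hF N.mod x y).trans ((h N (x, y)).symm.trans (hRf N x y d e hd he))⟩
  -- A model of the theory of `M` need not contain `A`, so functionality is checked in `M` and
  -- transferred as a sentence.
  refine (Def.iff_self (R := fun N => IsFn (fun (x : X.Pt N.1) (y : Y.Pt N.1) =>
    F.Holds N.1 (pt2 x y))) (Def.isFn (C := Ctx.triv M.thry) (U := X.toUSet hX) (V := Y.toUSet hY)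
      F.def_holds₂) ⟨N, hN⟩).2 fun x => ?_
  have hF' : ∀ x y, F.Holds M (pt2 x y) ↔ R (AModel.self A) x y := fun x y =>
    (hF M.self x y).trans (h (AModel.self A) (x, y)).symm
  obtain ⟨d, hd, -⟩ := hα.fn (AModel.self A) x
  obtain ⟨e, he, he'⟩ := hf.fn _ (i.pull_models hv M.self) d
  obtain ⟨y, hy, hy'⟩ := hβ.inv (AModel.self A) e
  refine ⟨y, (hF' x y).2 ⟨d, e, hd, hy, he⟩, fun y' h' => ?_⟩
  obtain ⟨d', e', hd', hy'', h'⟩ := (hF' x y').1 h'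
  obtain rfl := (hα.fn (AModel.self A) x).unique hd hd'
  obtain rfl := he' e' h'
  exact hy' _ hy''

end Interp

end MSLang

/-! ### Group laws, limits of points of pro-groups, and rigidity of automorphisms -/

namespace MSLang

variable {L₀ L : MSLang.{u}}

section

variable {α β : Type u} {R : α → α → α → Prop} {S : α → β → β → Prop}

theorem IsGroupLaw.existsUnique (h : IsGroupLaw R) (a b : α) : ∃! c, R a b c := by
  obtain ⟨_, h⟩ := h
  exact ⟨a * b, (h _ _ _).2 rfl, fun c hc => ((h _ _ _).1 hc).symm⟩

theorem IsGroupLaw.exists_one (h : IsGroupLaw R) : ∃ e, R e e e := by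
  obtain ⟨_, h⟩ := h
  exact ⟨1, (h _ _ _).2 (one_mul 1)⟩

theorem IsActionLaw.isFn (h : IsActionLaw R S) (a : α) : IsFn (S a) := by
  obtain ⟨_, _, -, h⟩ := h
  exact fun x => ⟨a • x, (h _ _ _).2 rfl, fun c hc => ((h _ _ _).1 hc).symm⟩

theorem IsActionLaw.mul (h : IsActionLaw R S) {a b c : α} {x y z : β} (hR : R a b c)
    (hb : S b x y) (ha : S a y z) : S c x z := by
  obtain ⟨_, _, h, h'⟩ := h
  rw [h] at hR
  rw [h'] at hb ha ⊢
  rw [← hR, mul_smul, hb, ha]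

theorem IsActionLaw.one (h : IsActionLaw R S) {e : α} (he : R e e e) (x : β) : S e x x := by
  obtain ⟨_, _, h, h'⟩ := h
  rw [h, mul_eq_left] at he
  rw [h', he, one_smul]

end

/-! ## Points of pro-groups -/

namespace ProGroup

variable {T : L.Theory} (H : ProGroup T)

/-- The groups of a pro-group, as uniformly definable sets. -/
@[reducible] def set (k : H.I) : USet T := (H.G k).toUSet (H.valid k)

/-- The transition maps of a pro-group. -/
noncomputable def map (N : Mod T) {k l : H.I} (h : k ≤ l) (a : (H.G l).Pt N.1) : (H.G k).Pt N.1 :=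
  (H.tr_fn N.1 N.2 h a).choose

theorem tr_iff (N : Mod T) {k l : H.I} (h : k ≤ l) (a : (H.G l).Pt N.1) (b : (H.G k).Pt N.1) :
    (H.tr h).Holds N.1 (pt2 a b) ↔ H.map N h a = b :=
  ⟨fun h' => ((H.tr_fn N.1 N.2 h a).choose_spec.2 b h').symm,
    fun h' => h' ▸ (H.tr_fn N.1 N.2 h a).choose_spec.1⟩

theorem defMap_map {k l : H.I} (h : k ≤ l) :
    DefMap (Ctx.triv T) (H.set l) (H.set k) (fun N a => H.map N h a) :=
  (H.tr h).def_holds₂.congr fun N p => H.tr_iff N h p.1 p.2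

theorem map_map (N : Mod T) {k l m : H.I} (h : k ≤ l) (h' : l ≤ m) (a : (H.G m).Pt N.1) :
    H.map N h (H.map N h' a) = H.map N (h.trans h') a :=
  ((H.tr_iff N _ _ _).1 (H.tr_trans N.1 N.2 h h' a _ _ ((H.tr_iff N h' _ _).2 rfl)
    ((H.tr_iff N h _ _).2 rfl))).symm

theorem mul_map (N : Mod T) {k l : H.I} (h : k ≤ l) {a b c : (H.G l).Pt N.1}
    (hm : (H.mul l).Holds N.1 (pt3 a b c)) :
    (H.mul k).Holds N.1 (pt3 (H.map N h a) (H.map N h b) (H.map N h c)) :=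
  H.tr_mul N.1 N.2 h a b c _ _ _ ((H.tr_iff N h _ _).2 rfl) ((H.tr_iff N h _ _).2 rfl)
    ((H.tr_iff N h _ _).2 rfl) hm

theorem Pt.map_eq {H : ProGroup T} {N : Mod T} (x : H.Pt N.1) {k l : H.I} (h : k ≤ l) :
    H.map N h (x.1 l) = x.1 k :=
  (H.tr_iff N h _ _).1 (x.2 k l h)

end ProGroup

section

variable {M : L.Str} {J : Type u} (𝒰 : Ultrafilter J)

theorem USet.ulim_congr {U : USet M.thry} {s t : J → U.car M.self}
    (h : ∀ᶠ j in (𝒰 : Filter J), s j = t j) : U.ulim 𝒰 s = U.ulim 𝒰 t := by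
  have h' := Def.ulim 𝒰 (Def.eq (U := U)) (fun j => (s j, t j))
  rw [USet.ulim_prod] at h'
  exact h'.2 h

theorem DefMap.ulim {U V : USet M.thry} {f : (N : Mod M.thry) → U.car N → V.car N}
    (hf : DefMap (Ctx.triv M.thry) U V f) (s : J → U.car M.self) :
    f (M.upow 𝒰) (U.ulim 𝒰 s) = V.ulim 𝒰 (fun j => f M.self (s j)) := by
  have h' := Def.ulim 𝒰 hf (fun j => (s j, f M.self (s j)))
  rw [USet.ulim_prod] at h'
  exact h'.2 (Filter.Eventually.of_forall fun _ => rfl)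

/-- The point `x` of the ultrapower is the limit of the `g j`, where `g j` is a point of the
group of index `l j`. -/
def ProGroup.IsLim (H : ProGroup M.thry) {l : J → H.I} (g : (j : J) → (H.G (l j)).Pt M)
    (x : H.Pt (M.upow 𝒰).1) : Prop :=
  ∀ k (s : J → (H.G k).Pt M), (∀ᶠ j in (𝒰 : Filter J), ∀ h : k ≤ l j, H.map M.self h (g j) = s j) →
    x.1 k = (H.set k).ulim 𝒰 s

/-- Where k ≤ l j fails an idempotent is used as a default; the choice does not matter once k ≤ l j
holds eventually. -/
theorem ProGroup.exists_map_eq (H : ProGroup M.thry) {l : J → H.I}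
    (g : (j : J) → (H.G (l j)).Pt M) (k : H.I) :
    ∃ s : J → (H.G k).Pt M, ∀ j (h : k ≤ l j), H.map M.self h (g j) = s j := by
  obtain ⟨e, -⟩ := (H.isGroup M M.self.2 k).exists_one
  classical
  exact ⟨fun j => if h : k ≤ l j then H.map M.self h (g j) else e,
    fun j h => by simp only [dif_pos h]⟩

variable {𝒰}

/-- Transition maps need not be surjective, so an element of a single group may lift to no point of
the pro-group. A sequence of elements whose indices eventually exceed every index does have a limit
point in the ultrapower. -/
theorem ProGroup.exists_isLim (H : ProGroup M.thry) {l : J → H.I}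
    (hl : ∀ k, ∀ᶠ j in (𝒰 : Filter J), k ≤ l j) (g : (j : J) → (H.G (l j)).Pt M) :
    ∃ x, H.IsLim 𝒰 g x := by
  choose s hs using H.exists_map_eq g
  refine ⟨⟨fun k => (H.set k).ulim 𝒰 (s k), fun k k' h => ?_⟩, fun k t ht => ?_⟩
  · refine (H.tr_iff (M.upow 𝒰) h _ _).2 ?_
    refine ((H.defMap_map h).ulim 𝒰 (s k')).trans (USet.ulim_congr 𝒰 (U := H.set k) ?_)
    filter_upwards [hl k'] with j hj
    rw [← hs k' j hj, ← hs k j (h.trans hj)]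
    exact H.map_map _ _ _ _
  · refine USet.ulim_congr 𝒰 (U := H.set k) ?_
    filter_upwards [ht, hl k] with j h h'
    rw [← hs k j h']
    exact h h'

theorem ProGroup.IsLim.mulRel {H : ProGroup M.thry} {l : J → H.I}
    (hl : ∀ k, ∀ᶠ j in (𝒰 : Filter J), k ≤ l j) {g g' g'' : (j : J) → (H.G (l j)).Pt M}
    {x x' x'' : H.Pt (M.upow 𝒰).1} (hx : H.IsLim 𝒰 g x) (hx' : H.IsLim 𝒰 g' x')
    (hx'' : H.IsLim 𝒰 g'' x'')
    (h : ∀ᶠ j in (𝒰 : Filter J), (H.mul (l j)).Holds M (pt3 (g j) (g' j) (g'' j))) :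
    H.MulRel x x' x'' := by
  intro k
  obtain ⟨s, hs⟩ := H.exists_map_eq g k
  obtain ⟨s', hs'⟩ := H.exists_map_eq g' k
  obtain ⟨s'', hs''⟩ := H.exists_map_eq g'' k
  rw [hx k s (Filter.Eventually.of_forall hs), hx' k s' (Filter.Eventually.of_forall hs'),
    hx'' k s'' (Filter.Eventually.of_forall hs'')]
  have h₁ := Def.ulim 𝒰 ((H.mul k).def_holds₃ (C := Ctx.triv M.thry) (hX := H.valid k)
    (hY := H.valid k) (hZ := H.valid k)) (fun j => (s j, (s' j, s'' j)))
  rw [USet.ulim_prod, USet.ulim_prod] at h₁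
  refine h₁.2 ?_
  filter_upwards [h, hl k] with j h hj
  rw [← hs j hj, ← hs' j hj, ← hs'' j hj]
  exact H.mul_map M.self hj h

end

namespace Interp

variable {i : Interp L₀ L} {M : L.Str} {hv : ∀ s, (i.srt s).IsValid M.thry} {A : Set M.Elt}

/-- Automorphisms over the base are determined by their values at the parameters. -/
theorem IsInternalityParams.app_eq (hA : i.IsInternalityParams A)
    (hs : i.IsCanonicallyEmbedded hv) {N : AModel A} {f f' : Aut N.N} (hf : i.FixesBase f)
    (hf' : i.FixesBase f') (h : ∀ x : A, f.onPt (N.e x) = f'.onPt (N.e x)) (U : USet M.thry)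
    (u : U.car N.mod) : f.app (N := N.mod) U u = f'.app (N := N.mod) U u := by
  obtain ⟨W, c, hc, hinj⟩ := hA.exists_injective hs U
  obtain ⟨n, t, -, R', hR', hRc⟩ := Def.exists_injective hc
  let P := USet.pi fun k => (t k).1.1.toUSet (hA.valid _ (t k).2)
  let p : P.car N.mod := fun k => N.e (t k)
  have hp : f.app (N := N.mod) P p = f'.app (N := N.mod) P p := by
    rw [Aut.app_pi, Aut.app_pi]
    funext k
    rw [Aut.app_toUSet, Aut.app_toUSet]
    exact h (t k)
  -- Injectivity of the embedding in the base is a ∅-definable property of the tuple `p` used in its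
  -- definition, so it passes to the common image of `p` under `f` and `f'`. Since base points are
  -- fixed, the images of u under `f` and `f'` have the same value and coincide.
  have hD : Def (Ctx.triv M.thry) P (fun N p => ∀ (u u' : U.car N) (w : W.car (i.pullMod hv N)),
      R' N p (u, w) → R' N p (u', w) → u = u') := by
    refine Def.all (V := U) (Def.all (V := U) (Def.all (V := i.pb hv W)
      (Def.imp ?_ (Def.imp ?_ ?_))))
    · exact hR'.reindex (U := ((P.prod U).prod U).prod (i.pb hv W))
        (f := fun N x => (x.1.1.1, (x.1.1.2, x.2)))
        (.pair (.fst' (.fst' (.fst' .id))) (.pair (.snd' (.fst' (.fst' .id))) (.snd' .id)))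
    · exact hR'.reindex (U := ((P.prod U).prod U).prod (i.pb hv W))
        (f := fun N x => (x.1.1.1, (x.1.2, x.2)))
        (.pair (.fst' (.fst' (.fst' .id))) (.pair (.snd' (.fst' .id)) (.snd' .id)))
    · exact Def.eq.reindex (U := ((P.prod U).prod U).prod (i.pb hv W))
        (f := fun N x => (x.1.1.2, x.1.2)) (.pair (.snd' (.fst' (.fst' .id))) (.snd' (.fst' .id)))
  have h₁ := (f.app_iff (N := N.mod) hD p).2 fun u u' w hu hu' =>
    hinj N (((hRc N (u, w)).2 hu).trans ((hRc N (u', w)).2 hu').symm)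
  have h₂ : ∀ f : Aut N.N, i.FixesBase f → R' N.mod (f.app (N := N.mod) P p)
      (f.app (N := N.mod) U u, c N u) := by
    intro f hf
    have h₃ := (f.app_iff (N := N.mod) hR' (p, (u, c N u))).2 ((hRc N (u, c N u)).1 rfl)
    rwa [Aut.app_prod, Aut.app_prod, hf.app_pb (N := N.mod)] at h₃
  exact h₁ _ _ _ (h₂ f hf) (hp ▸ h₂ f' hf')

end Interp

end MSLang

/-! ### Properties of θ at a finite level -/

namespace MSLang

variable {L₀ L : MSLang.{u}}

namespace Interp

variable {i : Interp L₀ L} {M : L.Str} {hv : ∀ s, (i.srt s).IsValid M.thry} {A : Set M.Elt}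

/-- The coordinates of an isomorphism of pro-groups, as functions of a coordinate. -/
noncomputable def ProIso.fwdMap {G : ProGroup M.thry} {H : ProGroup (i.pull M).thry}
    (θ : i.ProIso A G H) (N : AModel A) (l : H.I) (a : (G.G (θ.fwdIdx l)).Pt N.N) :
    (H.G l).Pt (i.pull N.N) :=
  (θ.fwd_fn N l a).choose

theorem ProIso.fwd_iff {G : ProGroup M.thry} {H : ProGroup (i.pull M).thry}
    (θ : i.ProIso A G H) (N : AModel A) (l : H.I) (a : (G.G (θ.fwdIdx l)).Pt N.N)
    (b : (H.G l).Pt (i.pull N.N)) :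
    (θ.fwd l).Holds N (pt1 a) (pt1 b) ↔ θ.fwdMap N l a = b :=
  ⟨fun h => ((θ.fwd_fn N l a).choose_spec.2 b h).symm,
    fun h => h ▸ (θ.fwd_fn N l a).choose_spec.1⟩

theorem ProIso.fwdMap_coord {G : ProGroup M.thry} {H : ProGroup (i.pull M).thry}
    (θ : i.ProIso A G H) (N : AModel A) (l : H.I) (g : G.Pt N.N) :
    θ.fwdMap N l (g.1 _) = (θ.θ N g).1 l :=
  (θ.fwd_iff N l _ _).1 (θ.fwd_spec N l g)

theorem ProIso.defMap_fwdMap (hA : ∀ x ∈ A, x.1.IsValid M.thry) {G : ProGroup M.thry}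
    {H : ProGroup (i.pull M).thry} (θ : i.ProIso A G H) (l : H.I) :
    DefMap (Ctx.par hA) (G.set (θ.fwdIdx l)) (i.pb hv (H.set l)) (fun N a => θ.fwdMap N l a) :=
  ((θ.fwd l).def_holds hA (G.valid _) (H.valid l)).congr fun N p => θ.fwd_iff N l p.1 p.2

theorem ProIso.def_mul (hv : ∀ s, (i.srt s).IsValid M.thry) (hA : ∀ x ∈ A, x.1.IsValid M.thry) {G : ProGroup M.thry}
    {H : ProGroup (i.pull M).thry} (θ : i.ProIso A G H) (l : H.I) :
    Def (Ctx.par hA)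
      ((G.set (θ.fwdIdx l)).prod ((G.set (θ.fwdIdx l)).prod (G.set (θ.fwdIdx l))))
      (fun N p => (H.mul l).Holds (i.pull N.N)
        (pt3 (θ.fwdMap N l p.1) (θ.fwdMap N l p.2.1) (θ.fwdMap N l p.2.2))) := by
  refine Def.comp3 (C := Ctx.par hA)
    (U := (G.set (θ.fwdIdx l)).prod ((G.set (θ.fwdIdx l)).prod (G.set (θ.fwdIdx l))))
    (V := i.pb hv (H.set l)) (W := i.pb hv (H.set l)) (X := i.pb hv (H.set l))
    (R := fun N x y z => (H.mul l).Holds (i.pull N.N) (pt3 x y z))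
    (f := fun N p => θ.fwdMap N l p.1) (g := fun N p => θ.fwdMap N l p.2.1)
    (h := fun N p => θ.fwdMap N l p.2.2)
    (def_pb₃ (C := Ctx.par hA) (U := H.set l) (V := H.set l) (W := H.set l)
      (R := fun N x y z => (H.mul l).Holds N.1 (pt3 x y z)) (H.mul l).def_holds₃) ?_ ?_ ?_
  · exact DefMap.comp (C := Ctx.par hA) (θ.defMap_fwdMap hA l) DefMap.fst
  · exact DefMap.comp (C := Ctx.par hA) (θ.defMap_fwdMap hA l) (DefMap.fst' DefMap.snd)
  · exact DefMap.comp (C := Ctx.par hA) (θ.defMap_fwdMap hA l) (DefMap.snd' DefMap.snd)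

/-- The index of the group that acts on the definable set of the parameter `b`. -/
def GaloisGroup.parIdx (G : i.GaloisGroup M.thry) (hA : ∀ x ∈ A, x.1.IsValid M.thry) (b : A) :
    G.grp.I :=
  (G.act b.1.1 (hA b.1 b.2)).k

/-- The orbit map of a parameter. -/
noncomputable def GaloisGroup.orbit (G : i.GaloisGroup M.thry)
    (hA : ∀ x ∈ A, x.1.IsValid M.thry) (N : AModel A) (b : A)
    (g : (G.grp.G (G.parIdx hA b)).Pt N.N) : b.1.1.Pt N.N :=
  (((G.act b.1.1 (hA b.1 b.2)).isAct N.N N.models).isFn g (N.e b)).choose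

theorem GaloisGroup.orbit_iff (G : i.GaloisGroup M.thry) (hA : ∀ x ∈ A, x.1.IsValid M.thry)
    (N : AModel A) (b : A) (g : (G.grp.G (G.parIdx hA b)).Pt N.N) (y : b.1.1.Pt N.N) :
    (G.act b.1.1 (hA b.1 b.2)).act.Holds N.N (pt3 g (N.e b) y) ↔ G.orbit hA N b g = y :=
  ⟨fun h => ((((G.act b.1.1 (hA b.1 b.2)).isAct N.N N.models).isFn g (N.e b)).choose_spec.2 y
    h).symm, fun h => h ▸ (((G.act b.1.1 (hA b.1 b.2)).isAct N.N N.models).isFn g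
      (N.e b)).choose_spec.1⟩

theorem GaloisGroup.defMap_orbit (G : i.GaloisGroup M.thry) (hA : ∀ x ∈ A, x.1.IsValid M.thry)
    (b : A) : DefMap (Ctx.par hA) (G.grp.set (G.parIdx hA b)) (b.1.1.toUSet (hA b.1 b.2))
      (fun N g => G.orbit hA N b g) := by
  refine Def.congr (C := Ctx.par hA)
    (U := (G.grp.set (G.parIdx hA b)).prod (b.1.1.toUSet (hA b.1 b.2)))
    (R := fun (N : AModel A) p => (G.act b.1.1 (hA b.1 b.2)).act.Holds N.N (pt3 p.1 (N.e b) p.2))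
    ?_ fun N p => G.orbit_iff hA N b p.1 p.2
  exact Def.comp3 (C := Ctx.par hA) (V := G.grp.set (G.parIdx hA b))
    (W := b.1.1.toUSet (hA b.1 b.2)) (X := b.1.1.toUSet (hA b.1 b.2))
    (R := fun N g x y => (G.act b.1.1 (hA b.1 b.2)).act.Holds N.N (pt3 g x y))
    (DRel.def_holds₃ _) DefMap.fst (DefMap.param (C := Ctx.par hA) b) DefMap.snd

theorem GaloisGroup.orbit_coord (G : i.GaloisGroup M.thry) (hA : ∀ x ∈ A, x.1.IsValid M.thry)
    (N : AModel A) (b : A) {g : G.grp.Pt N.N} {f : Aut N.N}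
    (hf : ∀ (Q : DSet L) (hQ : Q.IsValid M.thry) (x y : Q.Pt N.N),
      (G.act Q hQ).Rel g x y ↔ f.onPt x = y) :
    G.orbit hA N b (g.1 _) = f.onPt (N.e b) :=
  (G.orbit_iff hA N b _ _).1 ((hf _ (hA b.1 b.2) _ _).2 rfl)

section

variable (hA : i.IsInternalityParams A) (hs : i.IsCanonicallyEmbedded hv)
  (G : i.GaloisGroup M.thry) {H : ProGroup (i.pull M).thry} (θ : i.ProIso A G.grp H)

include hs

/-- For points of the inverse limit both properties are clear: θ is a homomorphism, and such points
act as automorphisms over the base, which are determined by their values on `A`. Elements of one G_k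
need not lift to points, so compactness is used: counterexamples for all pairs (k, B) would have
limits in an ultrapower that are points of the pro-group violating one of the properties. -/
theorem ProIso.exists_uniform_self (l : H.I) : ∃ (k : G.grp.I) (hk : θ.fwdIdx l ≤ k) (B : Finset A)
    (hB : ∀ b ∈ B, G.parIdx hA.valid b ≤ k), ∀ g g' g'' : (G.grp.G k).Pt M,
      ((G.grp.mul k).Holds M (pt3 g g' g'') → (H.mul l).Holds (i.pull M)
        (pt3 (θ.fwdMap (AModel.self A) l (G.grp.map M.self hk g))
          (θ.fwdMap (AModel.self A) l (G.grp.map M.self hk g'))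
          (θ.fwdMap (AModel.self A) l (G.grp.map M.self hk g'')))) ∧
      ((∀ b hb, G.orbit hA.valid (AModel.self A) b (G.grp.map M.self (hB b hb) g) =
          G.orbit hA.valid (AModel.self A) b (G.grp.map M.self (hB b hb) g')) →
        θ.fwdMap (AModel.self A) l (G.grp.map M.self hk g) =
          θ.fwdMap (AModel.self A) l (G.grp.map M.self hk g')) := by
  classical
  by_contra! hcon
  let J := {j : G.grp.I × Finset A // θ.fwdIdx l ≤ j.1 ∧ ∀ b ∈ j.2, G.parIdx hA.valid b ≤ j.1}
  have hJ : ∀ j₁ j₂ : J, ∃ j : J, (j₁.1.1 ≤ j.1.1 ∧ j₁.1.2 ⊆ j.1.2) ∧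
      (j₂.1.1 ≤ j.1.1 ∧ j₂.1.2 ⊆ j.1.2) := by
    rintro ⟨⟨k₁, B₁⟩, h₁, h₁'⟩ ⟨⟨k₂, B₂⟩, h₂, h₂'⟩
    obtain ⟨k, hk, hk'⟩ := G.grp.directed k₁ k₂
    refine ⟨⟨(k, B₁ ∪ B₂), h₁.trans hk, fun b hb => ?_⟩, ⟨hk, Finset.subset_union_left⟩,
      hk', Finset.subset_union_right⟩
    obtain hb | hb := Finset.mem_union.1 hb
    · exact (h₁' b hb).trans hk
    · exact (h₂' b hb).trans hk'
  have hJk : ∀ k, ∃ j : J, k ≤ j.1.1 := fun k => by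
    obtain ⟨k', h, h'⟩ := G.grp.directed k (θ.fwdIdx l)
    exact ⟨⟨(k', ∅), h', by simp⟩, h⟩
  have hJb : ∀ b, ∃ j : J, b ∈ j.1.2 := fun b => by
    obtain ⟨k', h, h'⟩ := G.grp.directed (G.parIdx hA.valid b) (θ.fwdIdx l)
    exact ⟨⟨(k', {b}), h', by simpa using h⟩, by simp⟩
  have : Nonempty J := ⟨(hJk (θ.fwdIdx l)).choose⟩
  obtain ⟨𝒰, h𝒰⟩ := exists_ultrafilter_of_directed
    (fun j : J => {j' : J | j.1.1 ≤ j'.1.1 ∧ j.1.2 ⊆ j'.1.2}) (fun j => ⟨j, le_rfl, subset_rfl⟩)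
    (fun j₁ j₂ => by
      obtain ⟨j, h, h'⟩ := hJ j₁ j₂
      exact ⟨j, fun j' hj' => ⟨h.1.trans hj'.1, h.2.trans hj'.2⟩,
        fun j' hj' => ⟨h'.1.trans hj'.1, h'.2.trans hj'.2⟩⟩)
  have hl : ∀ k, ∀ᶠ j : J in (𝒰 : Filter J), k ≤ j.1.1 := fun k => by
    obtain ⟨j, hj⟩ := hJk k
    filter_upwards [h𝒰 j] with j' hj' using hj.trans hj'.1
  have hb : ∀ b, ∀ᶠ j : J in (𝒰 : Filter J), b ∈ j.1.2 := fun b => by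
    obtain ⟨j, hj⟩ := hJb b
    filter_upwards [h𝒰 j] with j' hj' using hj'.2 hj
  choose g g' g'' hg using fun j : J => hcon j.1.1 j.2.1 j.1.2 j.2.2
  obtain ⟨x, hx⟩ := G.grp.exists_isLim hl g
  obtain ⟨x', hx'⟩ := G.grp.exists_isLim hl g'
  obtain ⟨x'', hx''⟩ := G.grp.exists_isLim hl g''
  let N := AModel.upow 𝒰 hA.valid
  have hx₁ := hx _ (fun j => G.grp.map M.self j.2.1 (g j)) (Filter.Eventually.of_forall fun _ _ => rfl)
  have hx₁' := hx' _ (fun j => G.grp.map M.self j.2.1 (g' j))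
    (Filter.Eventually.of_forall fun _ _ => rfl)
  have hx₁'' := hx'' _ (fun j => G.grp.map M.self j.2.1 (g'' j))
    (Filter.Eventually.of_forall fun _ _ => rfl)
  -- The ultrafilter decides which of the two properties fails for almost all indices.
  obtain hor | hor := Ultrafilter.eventually_or.1 (Filter.Eventually.of_forall (f := 𝒰)
    fun j => imp_iff_not_or.1 (hg j))
  · have hm := θ.map_mul N x x' x''
      (hx.mulRel hl hx' hx'' (hor.mono fun _ h => (Classical.not_imp.1 h).1)) l
    rw [← θ.fwdMap_coord, ← θ.fwdMap_coord, ← θ.fwdMap_coord, hx₁, hx₁', hx₁''] at hm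
    have h := Def.ulim_upow 𝒰 (θ.def_mul hv hA.valid l) (fun j : J =>
      (G.grp.map M.self j.2.1 (g j), (G.grp.map M.self j.2.1 (g' j),
        G.grp.map M.self j.2.1 (g'' j))))
    rw [USet.ulim_prod, USet.ulim_prod] at h
    obtain ⟨j, h₁, h₂⟩ := ((h.1 hm).and hor).exists
    exact (Classical.not_imp.1 h₂).2 h₁
  · have h := Def.ulim_upow 𝒰 (Def.eq2 (C := Ctx.par hA.valid)
      (U := (G.grp.set (θ.fwdIdx l)).prod (G.grp.set (θ.fwdIdx l))) (V := i.pb hv (H.set l))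
      (f := fun N p => θ.fwdMap N l p.1) (g := fun N p => θ.fwdMap N l p.2)
      (DefMap.comp (C := Ctx.par hA.valid) (θ.defMap_fwdMap hA.valid l) DefMap.fst)
      (DefMap.comp (C := Ctx.par hA.valid) (θ.defMap_fwdMap hA.valid l) DefMap.snd))
      (fun j : J => (G.grp.map M.self j.2.1 (g j), G.grp.map M.self j.2.1 (g' j)))
    rw [USet.ulim_prod] at h
    dsimp only at h
    rw [← hx₁, ← hx₁', θ.fwdMap_coord, θ.fwdMap_coord] at h
    obtain ⟨f, hf, hfx⟩ := G.exists_aut N.N N.models x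
    obtain ⟨f', hf', hfx'⟩ := G.exists_aut N.N N.models x'
    -- Each `b` eventually belongs to the finite set `B` of the index, so the limits agree at `b`.
    have hff : ∀ b : A, f.onPt (N.e b) = f'.onPt (N.e b) := by
      intro b
      rw [← G.orbit_coord hA.valid N b hfx, ← G.orbit_coord hA.valid N b hfx']
      obtain ⟨s, hs₁⟩ := G.grp.exists_map_eq g (G.parIdx hA.valid b)
      obtain ⟨s', hs₁'⟩ := G.grp.exists_map_eq g' (G.parIdx hA.valid b)
      rw [hx _ s (Filter.Eventually.of_forall hs₁), hx' _ s' (Filter.Eventually.of_forall hs₁')]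
      have h := Def.ulim_upow 𝒰 (Def.eq2 (C := Ctx.par hA.valid)
        (U := (G.grp.set (G.parIdx hA.valid b)).prod (G.grp.set (G.parIdx hA.valid b)))
        (V := b.1.1.toUSet (hA.valid b.1 b.2))
        (f := fun N p => G.orbit hA.valid N b p.1) (g := fun N p => G.orbit hA.valid N b p.2)
        (DefMap.comp (C := Ctx.par hA.valid) (G.defMap_orbit hA.valid b) DefMap.fst)
        (DefMap.comp (C := Ctx.par hA.valid) (G.defMap_orbit hA.valid b) DefMap.snd))
        (fun j : J => (s j, s' j))
      rw [USet.ulim_prod] at h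
      refine h.2 ?_
      filter_upwards [hor, hb b] with j hj hbj
      have h' := hj.1 b hbj
      rwa [hs₁, hs₁'] at h'
    have hxx : x = x' := (G.exists_pt N.N N.models f hf).unique hfx fun Q hQ y z => by
      rw [hfx', ← f.app_toUSet (N := N.mod) hQ, ← f'.app_toUSet (N := N.mod) hQ,
        hA.app_eq hs hf hf' hff]
    obtain ⟨j, h₁, h₂⟩ := ((h.1 (by rw [hxx])).and hor).exists
    exact h₂.2 h₁

end

end Interp

end MSLang

/-! ### The definable set X_D as a twist of D -/

namespace MSLang

variable {L₀ L : MSLang.{u}}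

namespace USet

variable {T : L.Theory}

theorem def_perQuot {P : USet T} {R : (N : Mod T) → P.car N × P.car N → Prop}
    (hR : Def (Ctx.triv T) (P.prod P) R) : Def (Ctx.triv T) P (fun N p => R N (p, p)) :=
  hR.reindex (U := P) (f := fun N p => (p, p)) (.pair .id .id)

/-- The quotient of a definable set by a partial equivalence relation. -/
@[reducible] def perQuot (P : USet T) (R : (N : Mod T) → P.car N × P.car N → Prop)
    (hR : Def (Ctx.triv T) (P.prod P) R) : USet T :=
  P.quot (fun N => {B : Set (P.car N) // ∃ p, R N (p, p) ∧ B = {q | R N (p, q)}})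
    (fun N p B => R N (p, p) ∧ B.1 = {q | R N (p, q)}) (fun N B => B.2)
    (fun N p B B' h h' => Subtype.ext (h.2.trans h'.2.symm))
    ((def_perQuot hR).congr fun N p => ⟨fun h => ⟨⟨_, p, h, rfl⟩, h, rfl⟩, fun ⟨_, h, _⟩ => h⟩)
    (Def.congr (C := Ctx.triv T) (U := P.prod P) (R := fun (N : Mod T) p =>
      (R N (p.1, p.1) ∧ R N (p.2, p.2)) ∧ ∀ q, R N (p.1, q) ↔ R N (p.2, q))
      (Def.and (Def.and ((def_perQuot hR).reindex (U := P.prod P) (f := fun N p => p.1) (.fst' .id))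
        ((def_perQuot hR).reindex (U := P.prod P) (f := fun N p => p.2) (.snd' .id)))
        (Def.all (V := P) (Def.iff
          (hR.reindex (U := (P.prod P).prod P) (f := fun N p => (p.1.1, p.2))
            (.pair (.fst' (.fst' .id)) (.snd' .id)))
          (hR.reindex (U := (P.prod P).prod P) (f := fun N p => (p.1.2, p.2))
            (.pair (.snd' (.fst' .id)) (.snd' .id))))))
      fun N p => ⟨fun ⟨⟨h, h'⟩, h''⟩ => ⟨⟨_, p.1, h, rfl⟩, ⟨h, rfl⟩, h', Set.ext h''⟩,
        fun ⟨B, ⟨h, h₁⟩, h', h₂⟩ => ⟨⟨h, h'⟩, fun q => Set.ext_iff.1 (h₁.symm.trans h₂) q⟩⟩)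

end USet

namespace Interp

variable {i : Interp L₀ L} {M : L.Str} {hv : ∀ s, (i.srt s).IsValid M.thry} {A : Set M.Elt}

/-- Both properties are definable over `A`, so their validity in `M` spreads to all models
containing `A`. -/
theorem ProIso.exists_uniform (hA : i.IsInternalityParams A) (hs : i.IsCanonicallyEmbedded hv)
    (G : i.GaloisGroup M.thry) {H : ProGroup (i.pull M).thry} (θ : i.ProIso A G.grp H) (l : H.I) :
    ∃ (k : G.grp.I) (hk : θ.fwdIdx l ≤ k) (n : ℕ) (t : Fin n → A)
      (ht : ∀ j, G.parIdx hA.valid (t j) ≤ k), ∀ N : AModel A,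
      (∀ g g' g'' : (G.grp.G k).Pt N.N,
        (G.grp.mul k).Holds N.N (pt3 g g' g'') → (H.mul l).Holds (i.pull N.N)
          (pt3 (θ.fwdMap N l (G.grp.map N.mod hk g)) (θ.fwdMap N l (G.grp.map N.mod hk g'))
            (θ.fwdMap N l (G.grp.map N.mod hk g'')))) ∧
      (∀ g g' : (G.grp.G k).Pt N.N, (∀ j, G.orbit hA.valid N (t j) (G.grp.map N.mod (ht j) g) =
          G.orbit hA.valid N (t j) (G.grp.map N.mod (ht j) g')) →
        θ.fwdMap N l (G.grp.map N.mod hk g) = θ.fwdMap N l (G.grp.map N.mod hk g')) := by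
  obtain ⟨k, hk, B, hB, h⟩ := θ.exists_uniform_self hA hs G l
  let t : Fin B.card → A := fun j => (B.equivFin.symm j).1
  let ht : ∀ j, G.parIdx hA.valid (t j) ≤ k := fun j => hB _ (B.equivFin.symm j).2
  refine ⟨k, hk, _, t, ht, fun N => ?_⟩
  let U := G.grp.set k
  have hmap : ∀ {V : USet M.thry} {f : (N : AModel A) → V.car N.mod → (G.grp.G k).Pt N.N}
      {k' : G.grp.I} (h : k' ≤ k), DefMap (Ctx.par hA.valid) V U f →
      DefMap (Ctx.par hA.valid) V (G.grp.set k') (fun N x => G.grp.map N.mod h (f N x)) :=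
    fun {V f k'} h hf => DefMap.comp (C := Ctx.par hA.valid) (U := V) (V := U)
      (W := G.grp.set k') (g := fun N x => G.grp.map N.mod h x) (f := f)
      (DefMap.lift (G.grp.defMap_map h)) hf
  constructor
  · refine (Def.iff_self_par hA.valid (R := fun N => ∀ g g' g'' : (G.grp.G k).Pt N.N,
      (G.grp.mul k).Holds N.N (pt3 g g' g'') → (H.mul l).Holds (i.pull N.N)
          (pt3 (θ.fwdMap N l (G.grp.map N.mod hk g)) (θ.fwdMap N l (G.grp.map N.mod hk g'))
            (θ.fwdMap N l (G.grp.map N.mod hk g'')))) ?_ N).2 fun g g' g'' => (h g g' g'').1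
    refine Def.all (C := Ctx.par hA.valid) (V := U) (Def.all (V := U) (Def.all (V := U)
      (Def.imp ?_ ?_)))
    · exact ((G.grp.mul k).def_holds₃ (C := Ctx.par hA.valid) (hX := G.grp.valid k)
        (hY := G.grp.valid k) (hZ := G.grp.valid k)).reindex
        (U := (((USet.unit M.thry).prod U).prod U).prod U)
        (f := fun N p => (p.1.1.2, (p.1.2, p.2)))
        (.pair (.snd' (.fst' (.fst' .id))) (.pair (.snd' (.fst' .id)) (.snd' .id)))
    · exact Def.comp3 (C := Ctx.par hA.valid) (U := (((USet.unit M.thry).prod U).prod U).prod U)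
        (V := G.grp.set (θ.fwdIdx l)) (W := G.grp.set (θ.fwdIdx l)) (X := G.grp.set (θ.fwdIdx l))
        (R := fun N x y z => (H.mul l).Holds (i.pull N.N)
          (pt3 (θ.fwdMap N l x) (θ.fwdMap N l y) (θ.fwdMap N l z)))
        (f := fun N p => G.grp.map N.mod hk p.1.1.2) (g := fun N p => G.grp.map N.mod hk p.1.2)
        (h := fun N p => G.grp.map N.mod hk p.2)
        (θ.def_mul hv hA.valid l) (hmap hk (DefMap.snd' (DefMap.fst' DefMap.fst)))
        (hmap hk (DefMap.snd' DefMap.fst)) (hmap hk DefMap.snd)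
  · refine (Def.iff_self_par hA.valid (R := fun N => ∀ g g' : (G.grp.G k).Pt N.N,
      (∀ j, G.orbit hA.valid N (t j) (G.grp.map N.mod (ht j) g) =
          G.orbit hA.valid N (t j) (G.grp.map N.mod (ht j) g')) →
        θ.fwdMap N l (G.grp.map N.mod hk g) = θ.fwdMap N l (G.grp.map N.mod hk g')) ?_ N).2
      fun g g' h' => (h g g' g).2 fun b hb => ?_
    · refine Def.all (C := Ctx.par hA.valid) (V := U) (Def.all (V := U)
        (Def.imp (Def.finite_all fun j => ?_) ?_))
      · refine Def.eq2 (C := Ctx.par hA.valid) (U := ((USet.unit M.thry).prod U).prod U)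
          (V := (t j).1.1.toUSet (hA.valid _ (t j).2))
          (f := fun N p => G.orbit hA.valid N (t j) (G.grp.map N.mod (ht j) p.1.2))
          (g := fun N p => G.orbit hA.valid N (t j) (G.grp.map N.mod (ht j) p.2))
          (DefMap.comp (C := Ctx.par hA.valid) (G.defMap_orbit hA.valid (t j)) (hmap (ht j) ?_))
          (DefMap.comp (C := Ctx.par hA.valid) (G.defMap_orbit hA.valid (t j)) (hmap (ht j) ?_))
        · exact DefMap.snd' DefMap.fst
        · exact DefMap.snd
      · refine Def.eq2 (C := Ctx.par hA.valid) (U := ((USet.unit M.thry).prod U).prod U)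
          (V := i.pb hv (H.set l))
          (f := fun N p => θ.fwdMap N l (G.grp.map N.mod hk p.1.2))
          (g := fun N p => θ.fwdMap N l (G.grp.map N.mod hk p.2))
          (DefMap.comp (C := Ctx.par hA.valid) (θ.defMap_fwdMap hA.valid l) (hmap hk ?_))
          (DefMap.comp (C := Ctx.par hA.valid) (θ.defMap_fwdMap hA.valid l) (hmap hk ?_))
        · exact DefMap.snd' DefMap.fst
        · exact DefMap.snd
    · have h₁ := h' (B.equivFin ⟨b, hb⟩)
      have h₂ : t (B.equivFin ⟨b, hb⟩) = b := by simp [t]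
      generalize t (B.equivFin ⟨b, hb⟩) = b', ht (B.equivFin ⟨b, hb⟩) = hb' at h₁ h₂
      subst h₂
      exact h₁

/-- The idea is to twist D by the orbit of a finite tuple t from `A` that is large enough to
determine the coordinate of θ through which the action factors. The value of a pair (gt, d) is
θ(g)d; only the naming of values requires `A`, whereas "having the same value" is invariant and
descends. -/
theorem exists_isActIso (hA : i.IsInternalityParams A) (hA₀ : i.RestrictionTrivial A)
    (hs : i.IsCanonicallyEmbedded hv) (G : i.GaloisGroup M.thry) {H : ProGroup (i.pull M).thry}
    (θ : i.ProIso A G.grp H) {D : DSet L₀} (hD : D.IsValid (i.pull M).thry) (a : H.Act D) :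
    ∃ (X : DSet L) (hX : X.IsValid M.thry) (α : i.ARel A ![X] ![D]), IsActIso G θ hX a α := by
  obtain ⟨k, hk, n, t, ht, hG⟩ := θ.exists_uniform hA hs G a.k
  have hact := fun N : AModel A => a.isAct _ (i.pull_models hv N.mod)
  let Y : USet M.thry := USet.pi fun j => (t j).1.1.toUSet (hA.valid _ (t j).2)
  let D' : USet M.thry := i.pb hv (D.toUSet hD)
  let X₀ : USet M.thry := Y.prod D'
  let O : (N : AModel A) → (G.grp.G k).Pt N.N → Y.car N.mod := fun N g j =>
    G.orbit hA.valid N (t j) (G.grp.map N.mod (ht j) g)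
  let τ : (N : AModel A) → (G.grp.G k).Pt N.N → (H.G a.k).Pt (i.pull N.N) := fun N g =>
    θ.fwdMap N a.k (G.grp.map N.mod hk g)
  have hO : DefMap (Ctx.par hA.valid) (G.grp.set k) Y O := DefMap.tuple fun j =>
    DefMap.comp (C := Ctx.par hA.valid) (G.defMap_orbit hA.valid (t j))
      (DefMap.lift (G.grp.defMap_map (ht j)))
  have hτ : DefMap (Ctx.par hA.valid) (G.grp.set k) (i.pb hv (H.set a.k)) τ :=
    DefMap.comp (C := Ctx.par hA.valid) (θ.defMap_fwdMap hA.valid a.k)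
      (DefMap.lift (G.grp.defMap_map hk))
  -- `g` ranges over the single group G_k, since points of the pro-group are not a definable set.
  -- The choice of `t` makes the value independent of `g`.
  let V : (N : AModel A) → X₀.car N.mod → D.Pt (i.pull N.N) → Prop := fun N p d =>
    ∃ g, O N g = p.1 ∧ a.act.Holds (i.pull N.N) (pt3 (τ N g) p.2 d)
  have hV : Def (Ctx.par hA.valid) (X₀.prod D') (fun N p => V N p.1 p.2) := by
    refine Def.ex (C := Ctx.par hA.valid) (V := G.grp.set k) (Def.and ?_ ?_)
    · exact Def.eq2 (C := Ctx.par hA.valid) (U := (X₀.prod D').prod (G.grp.set k)) (V := Y)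
        (f := fun N p => O N p.2) (g := fun N p => p.1.1.1)
        (DefMap.comp (C := Ctx.par hA.valid) hO DefMap.snd) (DefMap.fst' (DefMap.fst' DefMap.fst))
    · exact Def.comp3 (C := Ctx.par hA.valid) (U := (X₀.prod D').prod (G.grp.set k))
        (V := i.pb hv (H.set a.k)) (W := D') (X := D')
        (R := fun N x y z => a.act.Holds (i.pull N.N) (pt3 x y z))
        (f := fun N p => τ N p.2) (g := fun N p => p.1.1.2) (h := fun N p => p.1.2)
        (def_pb₃ (C := Ctx.par hA.valid) (U := H.set a.k) (V := D.toUSet hD) (W := D.toUSet hD)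
          (R := fun N x y z => a.act.Holds N.1 (pt3 x y z)) a.act.def_holds₃)
        (DefMap.comp (C := Ctx.par hA.valid) hτ DefMap.snd) (DefMap.snd' (DefMap.fst' DefMap.fst))
        (DefMap.snd' DefMap.fst)
  have hVuniq : ∀ N p d d', V N p d → V N p d' → d = d' := by
    rintro N p d d' ⟨g, h₁, h₂⟩ ⟨g', h₁', h₂'⟩
    have h₃ : τ N g = τ N g' := (hG N).2 g g' fun j => congrFun (h₁.trans h₁'.symm) j
    rw [h₃] at h₂
    exact ((hact N).isFn _ _).unique h₂ h₂'
  have hVsurj : ∀ N d, ∃ p, V N p d := by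
    intro N d
    -- The unit of G_k already reaches every d: θ sends it to an idempotent, hence to an element
    -- acting trivially.
    obtain ⟨e, he⟩ := (G.grp.isGroup N.N N.models k).exists_one
    exact ⟨(O N e, d), e, rfl, (hact N).one ((hG N).1 e e e he) d⟩
  have hVaut : ∀ (N : AModel A) (γ : G.grp.Pt N.N) (f : Aut N.N), i.FixesBase f →
      (∀ (Q : DSet L) (hQ : Q.IsValid M.thry) (x y : Q.Pt N.N),
        (G.act Q hQ).Rel γ x y ↔ f.onPt x = y) →
      ∀ p d d', V N p d → a.Rel (θ.θ N γ) d d' → V N (f.app (N := N.mod) X₀ p) d' := by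
    rintro N γ f hf hγ ⟨y, d₀⟩ d d' ⟨g, rfl, h₂⟩ h₃
    -- γ(gt) = (γg)t, and the base coordinate `d₀` is fixed, so the new value is θ(γ)θ(g)d₀ = θ(γ)d.
    obtain ⟨g', hg', -⟩ := (G.grp.isGroup N.N N.models k).existsUnique (γ.1 k) g
    refine ⟨g', ?_, ?_⟩
    · rw [Aut.app_prod, Aut.app_pi]
      funext j
      refine Eq.trans ?_ (f.app_toUSet (N := N.mod) _ _).symm
      refine (G.orbit_iff hA.valid N (t j) _ _).1 ?_
      refine ((G.act _ (hA.valid _ (t j).2)).isAct N.N N.models).mul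
        (a := γ.1 (G.parIdx hA.valid (t j))) (b := G.grp.map N.mod (ht j) g)
        (y := O N g j) ?_ ((G.orbit_iff hA.valid N (t j) _ _).2 rfl) ((hγ _ _ _ _).2 rfl)
      rw [← γ.map_eq (N := N.mod) (ht j)]
      exact G.grp.mul_map N.mod (ht j) hg'
    · rw [Aut.app_prod, hf.app_pb (N := N.mod)]
      refine (hact N).mul (a := (θ.θ N γ).1 a.k) ?_ h₂ h₃
      rw [← θ.fwdMap_coord, ← γ.map_eq (N := N.mod) hk]
      exact (hG N).1 _ _ _ hg'
  obtain ⟨R₁, hR₁, hRR⟩ := hA.exists_def_of_invariant hA₀ hs (U := X₀.prod X₀)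
    (R := fun N p => ∃ d, V N p.1 d ∧ V N p.2 d) (by
      refine Def.ex (C := Ctx.par hA.valid) (V := D') (Def.and ?_ ?_)
      · exact hV.reindex (U := (X₀.prod X₀).prod D') (f := fun N p => (p.1.1, p.2))
          (.pair (.fst' (.fst' .id)) (.snd' .id))
      · exact hV.reindex (U := (X₀.prod X₀).prod D') (f := fun N p => (p.1.2, p.2))
          (.pair (.snd' (.fst' .id)) (.snd' .id))) (by
      rintro N f hf ⟨p, q⟩ ⟨d, hp, hq⟩
      obtain ⟨γ, hγ, -⟩ := G.exists_pt N.N N.models f hf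
      obtain ⟨d', hd', -⟩ := (hact N).isFn ((θ.θ N γ).1 a.k) d
      rw [Aut.app_prod]
      exact ⟨d', hVaut N γ f hf hγ p d d' hp hd', hVaut N γ f hf hγ q d d' hq hd'⟩)
  -- Classes are the sets {q | R₁(p, q)}, so the quotient makes sense without proof that `R₁` is
  -- symmetric and transitive in models that do not contain `A`.
  let X₁ : USet M.thry := X₀.perQuot R₁ hR₁
  obtain ⟨X, hX, e, he⟩ := X₁.exists_dset
  have hr : ∀ {C : Ctx M.thry}, Def C (X₀.prod X₁) (fun N p => R₁ (C.mod N) (p.1, p.1) ∧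
      p.2.1 = {q | R₁ (C.mod N) (p.1, q)}) := Def.quot_rel
  obtain ⟨α, hα⟩ := exists_arel (hA := hA.valid) (hX := hX) (hD := hD) (hv := hv)
    (R := fun N x d => ∃ p, (R₁ N.mod (p, p) ∧ (e N.mod x).1 = {q | R₁ N.mod (p, q)}) ∧ V N p d) (by
      refine Def.ex (C := Ctx.par hA.valid) (V := X₀) (Def.and ?_ ?_)
      · refine Def.comp2 (C := Ctx.par hA.valid) (U := ((X.toUSet hX).prod D').prod X₀) (V := X₀)
          (W := X₁) (R := fun N p B => R₁ N.mod (p, p) ∧ B.1 = {q | R₁ N.mod (p, q)})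
          (f := fun N p => p.2) (g := fun N p => e N.mod p.1.1) hr DefMap.snd ?_
        exact DefMap.comp (C := Ctx.par hA.valid) (U := ((X.toUSet hX).prod D').prod X₀)
          (V := X.toUSet hX) (W := X₁) (g := fun N x => e N.mod x)
          (f := fun N p => p.1.1) (DefMap.lift (U := X.toUSet hX) (V := X₁) (f := fun N x => e N x) he)
          (DefMap.fst' DefMap.fst)
      · exact hV.reindex (U := ((X.toUSet hX).prod D').prod X₀) (f := fun N p => (p.2, p.1.2))
          (.pair (.snd' .id) (.snd' (.fst' .id))))
  have hαuniq : ∀ N x d d', α.Holds N (pt1 x) (pt1 d) → α.Holds N (pt1 x) (pt1 d') → d = d' := by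
    intro N x d d' h h'
    obtain ⟨p, ⟨hp, hpx⟩, hpd⟩ := (hα N x d).1 h
    obtain ⟨q, ⟨hq, hqx⟩, hqd⟩ := (hα N x d').1 h'
    -- Two members of one class have a common value, so the value descends to the quotient.
    have h₁ : R₁ N.mod (q, p) := by
      have : p ∈ (e N.mod x).1 := hpx ▸ hp
      rwa [hqx] at this
    obtain ⟨d'', h₂, h₃⟩ := (hRR N (q, p)).2 h₁
    exact (hVuniq N p _ _ hpd h₃).trans (hVuniq N q _ _ h₂ hqd)
  refine ⟨X, hX, α, fun N x => ?_, fun N d => ?_, fun N γ x x' d d' hd hd' hγx => ?_⟩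
  · obtain ⟨p, hp, hpx⟩ := (e N.mod x).2
    obtain ⟨d, hd, -⟩ := (hRR N (p, p)).2 hp
    have h₁ := (hα N x d).2 ⟨p, ⟨hp, hpx⟩, hd⟩
    exact ⟨d, h₁, fun d' hd' => hαuniq N x _ _ hd' h₁⟩
  · obtain ⟨p, hp⟩ := hVsurj N d
    have hpp : R₁ N.mod (p, p) := (hRR N (p, p)).1 ⟨d, hp, hp⟩
    refine ⟨(e N.mod).symm ⟨_, p, hpp, rfl⟩, (hα N _ _).2 ⟨p, ⟨hpp, by simp⟩, hp⟩,
      fun x hx => ?_⟩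
    obtain ⟨q, ⟨hq, hqx⟩, hqd⟩ := (hα N _ _).1 hx
    refine (Equiv.eq_symm_apply _).2 (Subtype.ext (hqx.trans (Set.ext fun z => ?_)))
    refine (hRR N (q, z)).symm.trans (Iff.trans ?_ (hRR N (p, z)))
    constructor
    · rintro ⟨d', h, h'⟩
      obtain rfl := hVuniq N q _ _ h hqd
      exact ⟨_, hp, h'⟩
    · rintro ⟨d', h, h'⟩
      obtain rfl := hVuniq N p _ _ h hp
      exact ⟨_, hqd, h'⟩
  · obtain ⟨f, hf, hfγ⟩ := G.exists_aut N.N N.models γ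
    obtain rfl := (hfγ X hX x x').1 hγx
    obtain ⟨p, ⟨hp, hpx⟩, hpd⟩ := (hα N x d).1 hd
    obtain ⟨d'', h'', -⟩ := (hact N).isFn ((θ.θ N γ).1 a.k) d
    have h₁ : α.Holds N (pt1 (f.onPt x)) (pt1 d'') := by
      refine (hα N _ _).2 ⟨f.app (N := N.mod) X₀ p, ?_, hVaut N γ f hf hfγ p d d'' hpd h''⟩
      have h₂ := (f.app_iff (N := N.mod) (hr (C := Ctx.triv M.thry)) (p, e N.mod x)).2 ⟨hp, hpx⟩
      rw [Aut.app_prod] at h₂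
      have h₃ := f.app_map (N := N.mod) he x
      rw [Aut.app_toUSet] at h₃
      rw [h₃]
      exact h₂
    exact hαuniq N _ _ _ hd' h₁ ▸ h''

end Interp

end MSLang

/-! ### Definable groups of permutations -/

namespace MSLang

variable {L₀ L : MSLang.{u}}

theorem Aut.app_surjective {T : L.Theory} {N : Mod T} (f : Aut N.1) (U : USet T) :
    Function.Surjective (f.app U) := by
  intro t
  obtain ⟨v, hv⟩ := U.surj N t
  have h : (fun a => f.map _ ((f.map (U.srt a)).symm (v a))) = v :=
    funext fun a => Equiv.apply_symm_apply _ _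
  obtain ⟨s, hs⟩ := (U.dom.aut f fun a => (f.map (U.srt a)).symm (v a)).1 ⟨t, by rwa [h]⟩
  exact ⟨s, f.app_eq hs (by rwa [h])⟩

/-- The action of an automorphism on a definable set, as a permutation. -/
noncomputable def Aut.perm {T : L.Theory} {N : Mod T} (f : Aut N.1) {X : DSet L}
    (hX : X.IsValid T) : Equiv.Perm (X.Pt N.1) :=
  Equiv.ofBijective f.onPt (by
    rw [show (f.onPt : X.Pt N.1 → X.Pt N.1) = f.app (X.toUSet hX) from
      funext fun x => (f.app_toUSet hX x).symm]
    exact ⟨f.app_injective _, f.app_surjective _⟩)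

theorem IsGroupLaw.of_injective {α : Type u} {Γ : Type*} [Group Γ] {ρ : α → Γ}
    (hρ : Function.Injective ρ) (H : Subgroup Γ) (hH : (H : Set Γ) = Set.range ρ) :
    IsGroupLaw (fun a b c => ρ a * ρ b = ρ c) := by
  let e : α ≃ H := (Equiv.ofInjective ρ hρ).trans (Equiv.setCongr hH.symm)
  have he : ∀ a, (e a : Γ) = ρ a := fun a => rfl
  refine ⟨e.group, fun a b c => ?_⟩
  let _ := e.group
  have h : a * b = c ↔ e a * e b = e c := by
    rw [Equiv.mul_def]
    exact Equiv.symm_apply_eq e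
  rw [h, Subtype.ext_iff]
  rfl

theorem IsActionLaw.of_injective {α β : Type u} {Γ : Type*} [Group Γ] {ρ : α → Γ}
    (hρ : Function.Injective ρ) (H : Subgroup Γ) (hH : (H : Set Γ) = Set.range ρ)
    (π : Γ →* Equiv.Perm β) :
    IsActionLaw (fun a b c => ρ a * ρ b = ρ c) (fun a x y => π (ρ a) x = y) := by
  let e : α ≃ H := (Equiv.ofInjective ρ hρ).trans (Equiv.setCongr hH.symm)
  let _ := e.group
  have hm : ∀ a b : α, ρ (a * b) = ρ a * ρ b := fun a b => by
    show ((e (a * b) : H) : Γ) = ((e a * e b : H) : Γ)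
    rw [Equiv.mul_def, Equiv.apply_symm_apply]
  have ho : ρ (1 : α) = 1 := by
    show ((e 1 : H) : Γ) = ((1 : H) : Γ)
    rw [Equiv.one_def, Equiv.apply_symm_apply]
  let A : MulAction α β :=
    { smul := fun a x => π (ρ a) x
      one_smul := fun x => by
        show π (ρ 1) x = x
        rw [ho, map_one]
        rfl
      mul_smul := fun a b x => by
        show π (ρ (a * b)) x = π (ρ a) (π (ρ b) x)
        rw [hm, map_mul]
        rfl }
  refine ⟨e.group, A, fun a b c => ?_, fun a x y => Iff.rfl⟩
  show ρ a * ρ b = ρ c ↔ a * b = c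
  rw [← hm]
  exact hρ.eq_iff

namespace Interp

variable {i : Interp L₀ L} {M : L.Str}

/-- Definable groups of permutations of finitely many definable sets that contain all
automorphisms over the base. -/
structure PermGroup (i : Interp L₀ L) (M : L.Str) where
  Q : Set (DSet L)
  fin : Q.Finite
  validQ : ∀ X ∈ Q, X.IsValid M.thry
  G : DSet L
  valid : G.IsValid M.thry
  act : (X : Q) → DRel ![G, X.1, X.1]
  spec : ∀ N : Mod M.thry, ∃ ρ : G.Pt N.1 → (X : Q) → Equiv.Perm (X.1.Pt N.1),
    Function.Injective ρ ∧
    (∃ H : Subgroup ((X : Q) → Equiv.Perm (X.1.Pt N.1)), (H : Set _) = Set.range ρ) ∧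
    (∀ X g x y, (act X).Holds N.1 (pt3 g x y) ↔ ρ g X x = y) ∧
    ∀ f : Aut N.1, i.FixesBase f → ∃ g, ∀ X x, ρ g X x = f.onPt x

namespace PermGroup

variable (k l : i.PermGroup M) (N : Mod M.thry)

/-- The permutations given by the elements of the group. -/
noncomputable def perm : k.G.Pt N.1 → (X : k.Q) → Equiv.Perm (X.1.Pt N.1) := (k.spec N).choose

theorem perm_injective : Function.Injective (k.perm N) := (k.spec N).choose_spec.1

theorem exists_subgroup : ∃ H : Subgroup ((X : k.Q) → Equiv.Perm (X.1.Pt N.1)),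
    (H : Set _) = Set.range (k.perm N) := (k.spec N).choose_spec.2.1

theorem act_iff (X : k.Q) (g : k.G.Pt N.1) (x y : X.1.Pt N.1) :
    (k.act X).Holds N.1 (pt3 g x y) ↔ k.perm N g X x = y := (k.spec N).choose_spec.2.2.1 X g x y

theorem exists_perm_eq {f : Aut N.1} (hf : i.FixesBase f) :
    ∃ g, ∀ X x, k.perm N g X x = f.onPt x := (k.spec N).choose_spec.2.2.2 f hf

/-- The group, as a uniformly definable set. -/
@[reducible] def set : USet M.thry := k.G.toUSet k.valid

theorem defMap_perm (X : k.Q) : DefMap (Ctx.triv M.thry)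
    (k.set.prod (X.1.toUSet (k.validQ X.1 X.2))) (X.1.toUSet (k.validQ X.1 X.2))
    (fun N p => k.perm N p.1 X p.2) :=
  Def.congr (C := Ctx.triv M.thry) (U := (k.set.prod (X.1.toUSet (k.validQ X.1 X.2))).prod
      (X.1.toUSet (k.validQ X.1 X.2)))
    (R := fun (N : Mod M.thry) p => (k.act X).Holds N.1 (pt3 p.1.1 p.1.2 p.2))
    ((k.act X).def_holds₃.reindex (U := (k.set.prod (X.1.toUSet (k.validQ X.1 X.2))).prod
      (X.1.toUSet (k.validQ X.1 X.2))) (f := fun N p => (p.1.1, (p.1.2, p.2)))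
      (.pair (.fst' (.fst' .id)) (.pair (.snd' (.fst' .id)) (.snd' .id))))
    fun N p => k.act_iff N X _ _ _

/-- Permutation groups from uniformly definable sets. -/
theorem exists_of_uset {Q : Set (DSet L)} (hQ : Q.Finite) (hQv : ∀ X ∈ Q, X.IsValid M.thry)
    (S : USet M.thry)
    (ρ : (N : Mod M.thry) → S.car N → (X : Q) → Equiv.Perm (X.1.Pt N.1))
    (hρ : ∀ N, Function.Injective (ρ N))
    (hH : ∀ N, ∃ H : Subgroup ((X : Q) → Equiv.Perm (X.1.Pt N.1)), (H : Set _) = Set.range (ρ N))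
    (hd : ∀ X : Q, DefMap (Ctx.triv M.thry) (S.prod (X.1.toUSet (hQv X.1 X.2)))
      (X.1.toUSet (hQv X.1 X.2)) (fun N p => ρ N p.1 X p.2))
    (ha : ∀ (N : Mod M.thry) (f : Aut N.1), i.FixesBase f → ∃ s, ∀ X x, ρ N s X x = f.onPt x) :
    ∃ (k : i.PermGroup M) (h : k.Q = Q), ∀ N g, ∃ s, ∀ X (hX : X ∈ Q),
      k.perm N g ⟨X, h ▸ hX⟩ = ρ N s ⟨X, hX⟩ := by
  obtain ⟨G, hG, e, he⟩ := S.exists_dset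
  have hd' : ∀ X : Q, ∃ a : DRel ![G, X.1, X.1], ∀ (N : Mod M.thry) g x y,
      a.Holds N.1 (pt3 g x y) ↔ ρ N (e N g) X x = y := fun X =>
    Def.exists_drel₃ (hX := hG) (hY := hQv X.1 X.2) (hZ := hQv X.1 X.2)
      (R := fun N g x y => ρ N (e N g) X x = y) (by
        refine Def.comp3 (C := Ctx.triv M.thry) (U := (G.toUSet hG).prod
          ((X.1.toUSet (hQv X.1 X.2)).prod (X.1.toUSet (hQv X.1 X.2)))) (V := S) (W := X.1.toUSet (hQv X.1 X.2))
          (X := X.1.toUSet (hQv X.1 X.2)) (R := fun N s x y => ρ N s X x = y)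
          (f := fun N p => e N p.1) (g := fun N p => p.2.1) (h := fun N p => p.2.2)
          ?_ (DefMap.comp he DefMap.fst) (DefMap.fst' DefMap.snd) (DefMap.snd' DefMap.snd)
        exact (hd X).reindex (U := S.prod ((X.1.toUSet (hQv X.1 X.2)).prod
          (X.1.toUSet (hQv X.1 X.2)))) (f := fun N p => ((p.1, p.2.1), p.2.2))
          (.pair (.pair (.fst' .id) (.fst' (.snd' .id))) (.snd' (.snd' .id))))
  choose a ha' using hd'
  let k : i.PermGroup M :=
    { Q := Q, fin := hQ, validQ := hQv, G := G, valid := hG, act := a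
      spec := fun N => by
        refine ⟨fun g => ρ N (e N g), (hρ N).comp (e N).injective, ?_, fun X g x y => ha' X N g x y,
          fun f hf => ?_⟩
        · obtain ⟨H, hH⟩ := hH N
          exact ⟨H, hH.trans ((e N).surjective.range_comp (ρ N)).symm⟩
        · obtain ⟨s, hs⟩ := ha N f hf
          exact ⟨(e N).symm s, by simpa using hs⟩ }
  refine ⟨k, rfl, fun N g => ⟨e N g, fun X hX => Equiv.ext fun x => ?_⟩⟩
  exact (k.act_iff N ⟨X, hX⟩ g x _).1 ((ha' ⟨X, hX⟩ N g x _).2 rfl)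

end PermGroup

end Interp

end MSLang

/-! ### Groups of permutations that respect a family of frames -/

namespace MSLang

variable {L₀ L : MSLang.{u}}

namespace Interp

variable {i : Interp L₀ L} {M : L.Str} {hv : ∀ s, (i.srt s).IsValid M.thry} {A : Set M.Elt}

/-- The group of the permutations that carry each of the frames `b p` to a frame, and each of the
frames from a frame. -/
def frameGroup {Q P : Type u} {Z D : Q → Type u} (b : P → (q : Q) → Z q ≃ D q) :
    Subgroup ((q : Q) → Equiv.Perm (Z q)) where
  carrier := {g | (∀ p, ∃ p', ∀ q x, b p q (g q x) = b p' q x) ∧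
    ∀ p, ∃ p', ∀ q x, b p' q (g q x) = b p q x}
  one_mem' := ⟨fun p => ⟨p, fun _ _ => rfl⟩, fun p => ⟨p, fun _ _ => rfl⟩⟩
  mul_mem' := by
    rintro g h ⟨hg, hg'⟩ ⟨hh, hh'⟩
    refine ⟨fun p => ?_, fun p => ?_⟩
    · obtain ⟨p', hp'⟩ := hg p
      obtain ⟨p'', hp''⟩ := hh p'
      exact ⟨p'', fun q x => (hp' q _).trans (hp'' q x)⟩
    · obtain ⟨p', hp'⟩ := hh' p
      obtain ⟨p'', hp''⟩ := hg' p'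
      exact ⟨p'', fun q x => (hp'' q _).trans (hp' q x)⟩
  inv_mem' := by
    rintro g ⟨hg, hg'⟩
    refine ⟨fun p => ?_, fun p => ?_⟩
    · obtain ⟨p', hp'⟩ := hg' p
      exact ⟨p', fun q x => (hp' q _).symm.trans (by simp)⟩
    · obtain ⟨p', hp'⟩ := hg p
      exact ⟨p', fun q x => (hp' q _).symm.trans (by simp)⟩

/-- A permutation g with b_p ∘ g = b_p' is determined by (p, p'). Replacing y = g x by b_p(y) =
b_p'(x) expresses membership as a definable condition on p and p'. -/
theorem mem_frameGroup_iff {Q P : Type u} {Z D : Q → Type u} (b : P → (q : Q) → Z q ≃ D q)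
    {p p' : P} {g : (q : Q) → Equiv.Perm (Z q)} (h : ∀ q x, b p q (g q x) = b p' q x) :
    g ∈ frameGroup b ↔
      (∀ r, ∃ r', ∀ q x y, b p q y = b p' q x → b r q y = b r' q x) ∧
      ∀ r, ∃ r', ∀ q x y, b p q y = b p' q x → b r' q y = b r q x := by
  have key : ∀ r r', (∀ q x, b r q (g q x) = b r' q x) ↔
      ∀ q x y, b p q y = b p' q x → b r q y = b r' q x := fun r r' =>
    forall_congr' fun q => forall_congr' fun x => by
      have : ∀ y, b p q y = b p' q x ↔ y = g q x := fun y => by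
        rw [← h, Equiv.apply_eq_iff_eq]
      simp [this]
  exact and_congr (forall_congr' fun r => exists_congr fun r' => key r r')
    (forall_congr' fun r => exists_congr fun r' => key r' r)

namespace PermGroup

/-- A definable family of frames gives a definable group of permutations. -/
theorem exists_of_frames {Q : Set (DSet L)} (hQ : Q.Finite) (hQv : ∀ X ∈ Q, X.IsValid M.thry)
    (P : USet M.thry) [∀ N, Nonempty (P.car N)] (D : Q → USet (i.pull M).thry)
    (b : (N : Mod M.thry) → P.car N → (X : Q) → X.1.Pt N.1 ≃ (D X).car (i.pullMod hv N))
    (hb : ∀ X : Q, DefMap (Ctx.triv M.thry) (P.prod (X.1.toUSet (hQv X.1 X.2)))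
      (i.pb hv (D X)) (fun N p => b N p.1 X p.2)) :
    ∃ (k : i.PermGroup M) (h : k.Q = Q), ∀ N g, ∃ p p', ∀ X (hX : X ∈ Q) x,
      b N p ⟨X, hX⟩ (k.perm N g ⟨X, h ▸ hX⟩ x) = b N p' ⟨X, hX⟩ x := by
  have : Finite Q := hQ
  let Z : Q → USet M.thry := fun X => X.1.toUSet (hQv X.1 X.2)
  have hbb : ∀ X : Q, Def (Ctx.triv M.thry) ((P.prod P).prod ((Z X).prod (Z X)))
      (fun N w => b N w.1.1 X w.2.2 = b N w.1.2 X w.2.1) := fun X => by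
    refine Def.eq2 (C := Ctx.triv M.thry) (U := (P.prod P).prod ((Z X).prod (Z X)))
      (V := i.pb hv (D X)) (f := fun N w => b N w.1.1 X w.2.2) (g := fun N w => b N w.1.2 X w.2.1)
      ?_ ?_
    · exact DefMap.comp (C := Ctx.triv M.thry) (U := (P.prod P).prod ((Z X).prod (Z X)))
        (V := P.prod (Z X)) (W := i.pb hv (D X)) (g := fun N p => b N p.1 X p.2)
        (f := fun N w => (w.1.1, w.2.2)) (hb X)
        (DefMap.pair (DefMap.fst' DefMap.fst) (DefMap.snd' DefMap.snd))
    · exact DefMap.comp (C := Ctx.triv M.thry) (U := (P.prod P).prod ((Z X).prod (Z X)))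
        (V := P.prod (Z X)) (W := i.pb hv (D X)) (g := fun N p => b N p.1 X p.2)
        (f := fun N w => (w.1.2, w.2.1)) (hb X)
        (DefMap.pair (DefMap.snd' DefMap.fst) (DefMap.fst' DefMap.snd))
  have h4 : ∀ X : Q, Def (Ctx.triv M.thry) (((P.prod P).prod P).prod P) (fun N w =>
      ∀ x y, b N w.1.1.1 X y = b N w.1.1.2 X x → b N w.1.2 X y = b N w.2 X x) := fun X => by
    refine Def.all (V := Z X) (Def.all (V := Z X) (Def.imp ?_ ?_))
    · exact (hbb X).reindex (U := ((((P.prod P).prod P).prod P).prod (Z X)).prod (Z X))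
        (f := fun N w => (w.1.1.1.1, (w.1.2, w.2)))
        (.pair (.fst' (.fst' (.fst' (.fst' .id)))) (.pair (.snd' (.fst' .id)) (.snd' .id)))
    · exact (hbb X).reindex (U := ((((P.prod P).prod P).prod P).prod (Z X)).prod (Z X))
        (f := fun N w => ((w.1.1.1.2, w.1.1.2), (w.1.2, w.2)))
        (.pair (.pair (.snd' (.fst' (.fst' (.fst' .id)))) (.snd' (.fst' (.fst' .id))))
          (.pair (.snd' (.fst' .id)) (.snd' .id)))
  have hdom : Def (Ctx.triv M.thry) (P.prod P) (fun N p =>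
      (∀ r, ∃ r', ∀ X x y, b N p.1 X y = b N p.2 X x → b N r X y = b N r' X x) ∧
      ∀ r, ∃ r', ∀ X x y, b N p.1 X y = b N p.2 X x → b N r' X y = b N r X x) := by
    refine Def.and (Def.all (V := P) (Def.ex (V := P) (Def.finite_all h4)))
      (Def.all (V := P) (Def.ex (V := P) (Def.finite_all fun X => ?_)))
    exact (h4 X).reindex (U := ((P.prod P).prod P).prod P)
      (f := fun N w => ((w.1.1, w.2), w.1.2))
      (.pair (.pair (.fst' (.fst' .id)) (.snd' .id)) (.snd' (.fst' .id)))
  -- Group elements are represented by pairs of frames, so the group is a definable subquotient of P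
  -- × P.
  let r : (N : Mod M.thry) → (P.prod P).car N → frameGroup (b N) → Prop := fun N p g =>
    ∀ X x, b N p.1 X (g.1 X x) = b N p.2 X x
  have hr : ∀ N p, (∃ g, r N p g) ↔
      (∀ r, ∃ r', ∀ X x y, b N p.1 X y = b N p.2 X x → b N r X y = b N r' X x) ∧
      ∀ r, ∃ r', ∀ X x y, b N p.1 X y = b N p.2 X x → b N r' X y = b N r X x := fun N p =>
    ⟨fun ⟨g, hg⟩ => (mem_frameGroup_iff (b N) hg).1 g.2, fun h =>
      ⟨⟨fun X => (b N p.2 X).trans (b N p.1 X).symm, (mem_frameGroup_iff (b N) (p := p.1)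
        (p' := p.2) fun X x => by simp).2 h⟩, fun X x => by simp⟩⟩
  have hfun : ∀ N p (s s' : frameGroup (b N)), r N p s → r N p s' → s = s' := fun N p s s' h h' =>
    Subtype.ext (funext fun X => Equiv.ext fun x =>
      (b N p.1 X).injective ((h X x).trans (h' X x).symm))
  have hdom' : Def (Ctx.triv M.thry) (P.prod P) (fun N p => ∃ s, r N p s) :=
    hdom.congr fun N p => (hr N p).symm
  let S : USet M.thry := (P.prod P).quot (fun N => frameGroup (b N)) r
    (fun N g => by
      obtain ⟨p'⟩ := (inferInstance : Nonempty (P.car N))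
      obtain ⟨p, hp⟩ := g.2.1 p'
      exact ⟨(p', p), hp⟩)
    hfun hdom' (by
      refine Def.congr (C := Ctx.triv M.thry) (U := (P.prod P).prod (P.prod P))
        (R := fun N w => (∃ s, r N w.1 s) ∧ ∀ X x y, b N w.1.1 X y = b N w.1.2 X x →
          b N w.2.1 X y = b N w.2.2 X x)
        (Def.and (hdom'.reindex (U := (P.prod P).prod (P.prod P)) (.fst' .id))
          (Def.finite_all fun X => ?_)) fun N w => ⟨?_, ?_⟩
      · exact (h4 X).reindex (U := (P.prod P).prod (P.prod P))
          (f := fun N w => ((w.1, w.2.1), w.2.2))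
          (.pair (.pair (.fst' .id) (.fst' (.snd' .id))) (.snd' (.snd' .id)))
      · rintro ⟨⟨s, hs⟩, h⟩
        exact ⟨s, hs, fun X x => h X x _ (hs X x)⟩
      · rintro ⟨s, hs, hs'⟩
        refine ⟨⟨s, hs⟩, fun X x y h => ?_⟩
        rw [← hs X x, Equiv.apply_eq_iff_eq] at h
        rw [h, hs' X x])
  have hd : ∀ X : Q, DefMap (Ctx.triv M.thry) (S.prod (Z X)) (Z X) (fun N p => p.1.1 X p.2) := by
    intro X
    refine Def.congr (C := Ctx.triv M.thry) (U := (S.prod (Z X)).prod (Z X))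
      (R := fun N w => ∃ p : P.car N × P.car N, r N p w.1.1 ∧ b N p.1 X w.2 = b N p.2 X w.1.2)
      (Def.ex (V := P.prod P) (Def.and ?_ ?_)) fun N w => ⟨?_, ?_⟩
    · exact (Def.quot_rel (P := P.prod P)).reindex (U := ((S.prod (Z X)).prod (Z X)).prod (P.prod P))
        (f := fun N w => (w.2, w.1.1.1)) (.pair (.snd' .id) (.fst' (.fst' (.fst' .id))))
    · exact (hbb X).reindex (U := ((S.prod (Z X)).prod (Z X)).prod (P.prod P))
        (f := fun N w => (w.2, (w.1.1.2, w.1.2)))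
        (.pair (.snd' .id) (.pair (.snd' (.fst' (.fst' .id))) (.snd' (.fst' .id))))
    · rintro ⟨p, hp, h⟩
      exact (b N p.1 X).injective ((hp X _).trans h.symm)
    · rintro h
      obtain ⟨p, hp⟩ := S.surj N w.1.1 |>.elim fun v hv => hv.imp fun _ h => h.2
      exact ⟨p, hp, h ▸ hp X _⟩
  have ha : ∀ (N : Mod M.thry) (f : Aut N.1), i.FixesBase f →
      ∃ s : S.car N, ∀ X x, s.1 X x = f.onPt x := by
    intro N f hf
    -- The values of a frame lie in the base and are fixed by `f`; hence b_{f p}(f x) = b_p(x), and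
    -- `f` permutes the frames.
    have hbf : ∀ p X x, b N (f.app P p) X (f.onPt x) = b N p X x := fun p X x => by
      have h := f.app_map (hb X) (p, x)
      rw [Aut.app_prod, Aut.app_toUSet, hf.app_pb] at h
      exact h
    refine ⟨⟨fun X => f.perm (hQv X.1 X.2), fun p => ?_, fun p => ?_⟩, fun X x => rfl⟩
    · obtain ⟨p', rfl⟩ := f.app_surjective P p
      exact ⟨p', fun X x => hbf p' X x⟩
    · exact ⟨f.app P p, fun X x => hbf p X x⟩
  obtain ⟨k, hk, h⟩ := exists_of_uset (i := i) hQ hQv S (fun N s => s.1)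
    (fun N => Subtype.val_injective) (fun N => ⟨frameGroup (b N), Subtype.range_coe.symm⟩) hd ha
  refine ⟨k, hk, fun N g => ?_⟩
  obtain ⟨s, hs⟩ := h N g
  obtain ⟨⟨p, p'⟩, hp⟩ := S.surj N s |>.elim fun v hv => hv.imp fun _ h => h.2
  exact ⟨p, p', fun X hX x => hs X hX ▸ hp ⟨X, hX⟩ x⟩

end PermGroup

end Interp

end MSLang

/-! ### Definable groups preserving a given relation -/

namespace MSLang

variable {L₀ L : MSLang.{u}}

theorem IsFn.exists_equiv {α β : Type u} {R : α → β → Prop} (h : IsFn R)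
    (h' : IsFn (fun b a => R a b)) : ∃ e : α ≃ β, ∀ a b, R a b ↔ e a = b := by
  choose f hf hf' using h
  have hR : ∀ a b, R a b ↔ f a = b := fun a b => ⟨fun e => (hf' a b e).symm, fun e => e ▸ hf a⟩
  refine ⟨Equiv.ofBijective f ⟨fun a a' e => (h' (f a)).unique (hf a) (e ▸ hf a'), fun b => ?_⟩, hR⟩
  obtain ⟨a, ha, -⟩ := h' b
  exact ⟨a, (hR a b).1 ha⟩

theorem Def.isFn_param {T : L.Theory} {C : Ctx T} {P U V : USet T}
    {R : (N : C.Md) → P.car (C.mod N) → U.car (C.mod N) → V.car (C.mod N) → Prop}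
    (hR : Def C (P.prod (U.prod V)) (fun N w => R N w.1 w.2.1 w.2.2)) :
    Def C P (fun N p => IsFn (R N p)) := by
  refine Def.all (V := U) (R := fun N p x => ∃! y, R N p x y) (Def.congr (C := C)
    (U := P.prod U)
    (R := fun N w => ∃ y : V.car (C.mod N), R N w.1 w.2 y ∧ ∀ y', R N w.1 w.2 y' → y' = y)
    (Def.ex (V := V) (Def.and ?_ (Def.all (V := V) (Def.imp ?_ ?_)))) fun _ _ => Iff.rfl)
  · exact hR.reindex (U := (P.prod U).prod V) (f := fun N w => (w.1.1, (w.1.2, w.2)))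
      (.pair (.fst' (.fst' .id)) (.pair (.snd' (.fst' .id)) (.snd' .id)))
  · exact hR.reindex (U := ((P.prod U).prod V).prod V)
      (f := fun N w => (w.1.1.1, (w.1.1.2, w.2)))
      (.pair (.fst' (.fst' (.fst' .id))) (.pair (.snd' (.fst' (.fst' .id))) (.snd' .id)))
  · exact Def.eq.reindex (U := ((P.prod U).prod V).prod V) (f := fun N w => (w.2, w.1.2))
      (.pair (.snd' .id) (.snd' (.fst' .id)))

namespace Interp

variable {i : Interp L₀ L} {M : L.Str} {hv : ∀ s, (i.srt s).IsValid M.thry} {A : Set M.Elt}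

/-- Bijections with sets of the base, as members of a family without parameters. -/
theorem IsInternalityParams.exists_frame (hA : i.IsInternalityParams A)
    (hA₀ : i.RestrictionTrivial A) (hs : i.IsCanonicallyEmbedded hv) (U : USet M.thry) :
    ∃ (D : USet (i.pull M).thry) (P : USet M.thry) (p : (N : AModel A) → P.car N.mod)
      (B : (N : Mod M.thry) → P.car N → U.car N → D.car (i.pullMod hv N) → Prop),
      (∀ V, DefMap (Ctx.par hA.valid) V P (fun N _ => p N)) ∧
      Def (Ctx.triv M.thry) (P.prod (U.prod (i.pb hv D))) (fun N w => B N w.1 w.2.1 w.2.2) ∧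
      ∀ N : AModel A, ∃ b : U.car N.mod ≃ D.car (i.pullMod hv N.mod),
        ∀ x y, B N.mod (p N) x y ↔ b x = y := by
  obtain ⟨D, b, hb⟩ := hA.exists_equiv hA₀ hs U
  obtain ⟨n, t, -, R', hR', h⟩ := Def.exists_injective hb
  exact ⟨D, USet.pi fun k => (t k).1.1.toUSet (hA.valid _ (t k).2), fun N k => N.e (t k),
    fun N p x y => R' N p (x, y),
    fun V => DefMap.tuple fun k => DefMap.param (C := Ctx.par hA.valid) (t k), hR',
    fun N => ⟨b N, fun x y => (h N (x, y)).symm⟩⟩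

/-- There are definable groups of permutations that preserve a given definable relation. -/
theorem IsInternalityParams.exists_permGroup (hA : i.IsInternalityParams A)
    (hA₀ : i.RestrictionTrivial A) (hs : i.IsCanonicallyEmbedded hv) {β : Type} [Finite β]
    {X : β → DSet L} (hX : ∀ j, (X j).IsValid M.thry)
    {R : (N : Mod M.thry) → Pts N.1 X → Prop}
    (hR : Def (Ctx.triv M.thry) (USet.pi fun j => (X j).toUSet (hX j)) R) :
    ∃ (k : i.PermGroup M) (h : ∀ j, X j ∈ k.Q), ∀ N g p,
      R N (fun j => k.perm N g ⟨X j, h j⟩ (p j)) ↔ R N p := by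
  have hQ : (Set.range X).Finite := Set.finite_range X
  have : Finite (Set.range X) := hQ
  have hQv : ∀ Y ∈ Set.range X, Y.IsValid M.thry := by
    rintro _ ⟨j, rfl⟩
    exact hX j
  let Z : Set.range X → USet M.thry := fun Y => Y.1.toUSet (hQv Y.1 Y.2)
  choose D P p B hp hB hb using fun Y => hA.exists_frame hA₀ hs (Z Y)
  -- Products of definable sets are indexed by types in the lowest universe, while `Set.range X`
  -- lives in universe `u`; hence the enumeration.
  obtain ⟨n, ⟨e⟩⟩ := Finite.exists_equiv_fin (Set.range X)
  let F : USet M.thry := USet.pi fun k : Fin n => P (e.symm k)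
  let c : (N : AModel A) → F.car N.mod := fun N k => p (e.symm k) N
  have hc : ∀ V, DefMap (Ctx.par hA.valid) V F (fun N _ => c N) := fun V =>
    DefMap.tuple fun k => hp (e.symm k) V
  have hB' : ∀ Y : Set.range X, ∃ B' : (N : Mod M.thry) → F.car N → (Z Y).car N →
      (D Y).car (i.pullMod hv N) → Prop,
      Def (Ctx.triv M.thry) (F.prod ((Z Y).prod (i.pb hv (D Y))))
        (fun N w => B' N w.1 w.2.1 w.2.2) ∧
      ∀ N : AModel A, ∃ b : (Z Y).car N.mod ≃ (D Y).car (i.pullMod hv N.mod),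
        ∀ x y, B' N.mod (c N) x y ↔ b x = y := by
    intro Y
    obtain ⟨k, rfl⟩ := e.symm.surjective Y
    exact ⟨fun N f => B (e.symm k) N (f k), (hB (e.symm k)).reindex
      (U := F.prod ((Z (e.symm k)).prod (i.pb hv (D (e.symm k)))))
      (f := fun N w => (w.1 k, w.2)) (.pair (.app (.fst' .id) k) (.snd' .id)), hb (e.symm k)⟩
  choose B' hB' hb' using hB'
  let q : β → Set.range X := fun j => ⟨X j, j, rfl⟩
  let V : USet (i.pull M).thry := USet.pi fun j => D (q j)
  let XX : USet M.thry := USet.pi fun j => Z (q j)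
  have hVj : ∀ {C : Ctx M.thry} j, DefMap C (i.pb hv V) (i.pb hv (D (q j))) (fun N v => v j) :=
    fun {C} j => defMap_pb (hv := hv) (U := V) (V := D (q j)) (f := fun N v => v j)
      (DefMap.of_struct (.app .id j))
  -- The frame given by `A` transports `R` to a relation of the base, which is ∅-definable because
  -- A₀ is trivial.
  obtain ⟨R₀, hR₀, h₀⟩ := hA₀.exists_base_def hA.valid hs (V := V)
    (R := fun N v => ∃ x : Pts N.N X, (∀ j, B' (q j) N.mod (c N) (x j) (v j)) ∧ R N.mod x) (by
      refine Def.ex (C := Ctx.par hA.valid) (U := i.pb hv V) (V := XX)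
        (R := fun N v x => (∀ j, B' (q j) N.mod (c N) (x j) (v j)) ∧ R N.mod x)
        (Def.and (Def.finite_all fun j => ?_) ?_)
      · exact Def.comp3 (C := Ctx.par hA.valid) (U := (i.pb hv V).prod XX) (V := F) (W := Z (q j))
          (X := i.pb hv (D (q j))) (R := fun N f x y => B' (q j) N.mod f x y)
          (f := fun N _ => c N) (g := fun N w => w.2 j) (h := fun N w => w.1 j)
          (Def.lift (hB' (q j))) (hc _) (DefMap.app (V := fun j => Z (q j)) DefMap.snd j)
          (DefMap.comp (C := Ctx.par hA.valid) (U := (i.pb hv V).prod XX) (V := i.pb hv V)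
            (W := i.pb hv (D (q j))) (g := fun N v => v j) (f := fun N w => w.1) (hVj j) DefMap.fst)
      · exact Def.reindex (C := Ctx.par hA.valid) (U := (i.pb hv V).prod XX) (V := XX)
          (R := fun N x => R N.mod x) (f := fun N w => w.2) (Def.lift hR) (.snd' .id))
  -- The frames are the parameters whose relations are bijections that carry `R` to the same `R₀`.
  -- This is a ∅-definable condition, satisfied by the tuple from `A`.
  let φ : (N : Mod M.thry) → F.car N → Prop := fun N f =>
    (∀ Y, IsFn (B' Y N f) ∧ IsFn (fun y x => B' Y N f x y)) ∧
      ∀ (x : XX.car N) (v : V.car (i.pullMod hv N)), (∀ j, B' (q j) N f (x j) (v j)) →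
        (R N x ↔ R₀ (i.pullMod hv N) v)
  have hφ : Def (Ctx.triv M.thry) F φ := by
    refine Def.and (Def.finite_all fun Y => Def.and (Def.isFn_param (hB' Y))
      (Def.isFn_param (C := Ctx.triv M.thry) (P := F) (U := i.pb hv (D Y)) (V := Z Y) (R := fun N f y x => B' Y N f x y) ?_))
      (Def.all (V := XX) (Def.all (V := i.pb hv V) (Def.imp (Def.finite_all fun j => ?_)
        (Def.iff ?_ ?_))))
    · exact (hB' Y).reindex (U := F.prod ((i.pb hv (D Y)).prod (Z Y)))
        (f := fun N w => (w.1, (w.2.2, w.2.1)))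
        (.pair (.fst' .id) (.pair (.snd' (.snd' .id)) (.fst' (.snd' .id))))
    · exact Def.comp3 (C := Ctx.triv M.thry) (U := (F.prod XX).prod (i.pb hv V)) (V := F)
        (W := Z (q j)) (X := i.pb hv (D (q j))) (R := fun N f x y => B' (q j) N f x y)
        (f := fun N w => w.1.1) (g := fun N w => w.1.2 j) (h := fun N w => w.2 j)
        (hB' (q j)) (DefMap.fst' DefMap.fst)
        (DefMap.app (V := fun j => Z (q j)) (DefMap.snd' DefMap.fst) j)
        (DefMap.comp (C := Ctx.triv M.thry) (U := (F.prod XX).prod (i.pb hv V)) (V := i.pb hv V)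
          (W := i.pb hv (D (q j))) (g := fun N v => v j) (f := fun N w => w.2) (hVj j) DefMap.snd)
    · exact hR.reindex (U := (F.prod XX).prod (i.pb hv V)) (f := fun N w => w.1.2)
        (.snd' (.fst' .id))
    · exact (def_pb (hv := hv) hR₀).reindex (U := (F.prod XX).prod (i.pb hv V)) (f := fun N w => w.2)
        (.snd' .id)
  have hself : φ M.self (c (AModel.self A)) := by
    refine ⟨fun Y => ?_, fun x v h => ?_⟩
    · obtain ⟨b, hb⟩ := hb' Y (AModel.self A)
      exact ⟨fun x => ⟨b x, (hb _ _).2 rfl, fun y h => ((hb _ _).1 h).symm⟩,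
        fun y => ⟨b.symm y, (hb _ _).2 (by simp), fun x h => ((hb _ _).1 h) ▸ (by simp)⟩⟩
    · rw [← h₀ (AModel.self A)]
      constructor
      · exact fun hx => ⟨x, h, hx⟩
      · rintro ⟨x', h', hx'⟩
        have hxx : x = x' := by
          funext j
          obtain ⟨b, hb⟩ := hb' (q j) (AModel.self A)
          exact b.injective (((hb _ _).1 (h j)).trans ((hb _ _).1 (h' j)).symm)
        exact hxx ▸ hx'
  have hne : ∀ N, Nonempty ((F.sub φ hφ).car N) := fun N =>
    ((Def.iff_self (R := fun N => ∃ f, φ N f) (Def.ex (V := F)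
      (hφ.reindex (U := (USet.unit M.thry).prod F) (f := fun N w => w.2) (.snd' .id))) N).2
      ⟨_, hself⟩).elim fun f hf => ⟨⟨f, hf⟩⟩
  have hbij : ∀ (N : Mod M.thry) (f : (F.sub φ hφ).car N) (Y : Set.range X),
      ∃ e : (Z Y).car N ≃ (D Y).car (i.pullMod hv N), ∀ x y, B' Y N f.1 x y ↔ e x = y :=
    fun N f Y => IsFn.exists_equiv (f.2.1 Y).1 (f.2.1 Y).2
  choose b hbB using hbij
  obtain ⟨k, hk, h⟩ := PermGroup.exists_of_frames (i := i) (hv := hv) hQ hQv (F.sub φ hφ) D b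
    fun Y => Def.congr (C := Ctx.triv M.thry)
      (U := ((F.sub φ hφ).prod (Z Y)).prod (i.pb hv (D Y)))
      (R := fun N w => B' Y N w.1.1.1 w.1.2 w.2)
      (Def.comp3 (C := Ctx.triv M.thry) (U := ((F.sub φ hφ).prod (Z Y)).prod (i.pb hv (D Y)))
        (V := F) (W := Z Y) (X := i.pb hv (D Y)) (R := fun N f x y => B' Y N f x y)
        (f := fun N w => w.1.1.1) (g := fun N w => w.1.2) (h := fun N w => w.2) (hB' Y)
        (DefMap.comp (C := Ctx.triv M.thry)
          (U := ((F.sub φ hφ).prod (Z Y)).prod (i.pb hv (D Y))) (V := F.sub φ hφ) (W := F) (g := fun N s => s.1)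
          (f := fun N w => w.1.1) DefMap.sub_val (DefMap.fst' DefMap.fst))
        (DefMap.snd' DefMap.fst) DefMap.snd) fun N w => hbB N w.1.1 Y _ _
  refine ⟨k, fun j => hk ▸ ⟨j, rfl⟩, fun N g x => ?_⟩
  -- An element g satisfies b_f ∘ g = b_f' for two frames. Hence R(gx) is R₀(b_f(gx)) = R₀(b_f'(x)),
  -- which is R(x).
  obtain ⟨f, f', hf⟩ := h N g
  have h₁ := f.2.2 (fun j => k.perm N g ⟨X j, hk ▸ ⟨j, rfl⟩⟩ (x j))
    (fun j => b N f' (q j) (x j)) fun j => (hbB N f (q j) _ _).2 (hf (X j) ⟨j, rfl⟩ (x j))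
  have h₂ := f'.2.2 x (fun j => b N f' (q j) (x j)) fun j => (hbB N f' (q j) _ _).2 rfl
  exact h₁.trans h₂.symm

end Interp

end MSLang

/-! ### The inverse system of definable permutation groups -/

namespace MSLang

variable {L₀ L : MSLang.{u}}

namespace Interp.PermGroup

variable {i : Interp L₀ L} {M : L.Str}

/-- Sets of the base with the trivial group. -/
theorem exists_trivial (hv : ∀ s, (i.srt s).IsValid M.thry) {Q : Set (DSet L)} (hQ : Q.Finite)
    (hr : Q ⊆ Set.range i.srt) :
    ∃ (k : i.PermGroup M) (h : k.Q = Q), ∀ N g X (hX : X ∈ Q), k.perm N g ⟨X, h ▸ hX⟩ = 1 := by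
  have hQv : ∀ X ∈ Q, X.IsValid M.thry := by
    intro X hX
    obtain ⟨s, rfl⟩ := hr hX
    exact hv s
  obtain ⟨k, hk, h⟩ := exists_of_uset (i := i) hQ hQv (USet.unit M.thry) (fun _ _ => 1)
    (fun N => fun a b _ => funext fun e => e.elim)
    (fun N => ⟨⊥, Set.ext fun g => ⟨fun h => ⟨fun e => e.elim, h.symm⟩, fun ⟨_, h⟩ => h.symm⟩⟩)
    (fun X => DefMap.snd) (fun N f hf => ⟨fun e => e.elim, by
      rintro ⟨X, hX⟩ x
      obtain ⟨s, rfl⟩ := hr hX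
      exact (hf s x).symm⟩)
  exact ⟨k, hk, fun N g => (h N g).elim fun _ h => h⟩

/-- A larger index moves more sets, and its permutations restrict to elements of the smaller group.
The restricted element is unique because a group element is determined by its permutations, so no
transition map need be stored. -/
instance : Preorder (i.PermGroup M) where
  le k l := ∃ h : k.Q ⊆ l.Q, ∀ N b, ∃ a, ∀ X : k.Q, k.perm N a X = l.perm N b ⟨X.1, h X.2⟩
  le_refl k := ⟨subset_rfl, fun _ b => ⟨b, fun _ => rfl⟩⟩
  le_trans k l m := by
    rintro ⟨h, hkl⟩ ⟨h', hlm⟩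
    refine ⟨h.trans h', fun N c => ?_⟩
    obtain ⟨b, hb⟩ := hlm N c
    obtain ⟨a, ha⟩ := hkl N b
    exact ⟨a, fun X => (ha X).trans (hb _)⟩

theorem subset_of_le {k l : i.PermGroup M} (h : k ≤ l) : k.Q ⊆ l.Q := h.1

theorem exists_of_le {k l : i.PermGroup M} (h : k ≤ l) (N : Mod M.thry) (b : l.G.Pt N.1) :
    ∃ a, ∀ X : k.Q, k.perm N a X = l.perm N b ⟨X.1, subset_of_le h X.2⟩ := h.2 N b

/-- The upper bound is the fibre product: pairs of elements that agree on the sets common to both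
groups, acting on the union of the two families. It contains all automorphisms over the base, since
these restrict to both groups compatibly. -/
theorem exists_ge (k l : i.PermGroup M) : ∃ m, k ≤ m ∧ l ≤ m := by
  classical
  have : Finite k.Q := k.fin
  have : Finite (k.Q ∩ l.Q : Set (DSet L)) := k.fin.inter_of_left l.Q
  let Q := k.Q ∪ l.Q
  have hQv : ∀ X ∈ Q, X.IsValid M.thry := fun X hX => hX.elim (k.validQ X) (l.validQ X)
  have hag : Def (Ctx.triv M.thry) (k.set.prod l.set) (fun N w =>
      ∀ X : (k.Q ∩ l.Q : Set (DSet L)), ∀ x : X.1.Pt N.1,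
        k.perm N w.1 ⟨X.1, X.2.1⟩ x = l.perm N w.2 ⟨X.1, X.2.2⟩ x) := by
    refine Def.finite_all fun X => Def.all (V := X.1.toUSet (k.validQ _ X.2.1)) ?_
    refine Def.eq2 (C := Ctx.triv M.thry) (U := (k.set.prod l.set).prod (X.1.toUSet (k.validQ _ X.2.1)))
      (V := X.1.toUSet (k.validQ _ X.2.1)) (f := fun N w => k.perm N w.1.1 ⟨X.1, X.2.1⟩ w.2)
      (g := fun N w => l.perm N w.1.2 ⟨X.1, X.2.2⟩ w.2) ?_ ?_
    · exact DefMap.comp (C := Ctx.triv M.thry)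
        (U := (k.set.prod l.set).prod (X.1.toUSet (k.validQ _ X.2.1)))
        (V := k.set.prod (X.1.toUSet (k.validQ _ X.2.1))) (W := X.1.toUSet (k.validQ _ X.2.1))
        (g := fun N w => k.perm N w.1 ⟨X.1, X.2.1⟩ w.2) (f := fun N w => (w.1.1, w.2))
        (k.defMap_perm ⟨X.1, X.2.1⟩) (DefMap.pair (DefMap.fst' DefMap.fst) DefMap.snd)
    · exact DefMap.comp (C := Ctx.triv M.thry)
        (U := (k.set.prod l.set).prod (X.1.toUSet (k.validQ _ X.2.1)))
        (V := l.set.prod (X.1.toUSet (k.validQ _ X.2.1))) (W := X.1.toUSet (k.validQ _ X.2.1))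
        (g := fun N w => l.perm N w.1 ⟨X.1, X.2.2⟩ w.2) (f := fun N w => (w.1.2, w.2))
        (l.defMap_perm ⟨X.1, X.2.2⟩) (DefMap.pair (DefMap.snd' DefMap.fst) DefMap.snd)
  let S := (k.set.prod l.set).sub _ hag
  -- On common sets the two components agree, so giving precedence to `k` is harmless.
  let ρ : (N : Mod M.thry) → S.car N → (X : Q) → Equiv.Perm (X.1.Pt N.1) := fun N s X =>
    if h : X.1 ∈ k.Q then k.perm N s.1.1 ⟨X.1, h⟩
    else l.perm N s.1.2 ⟨X.1, X.2.resolve_left h⟩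
  have hk : ∀ N s (X : k.Q), ρ N s ⟨X.1, Or.inl X.2⟩ = k.perm N s.1.1 X := fun N s X => by
    simp only [ρ, dif_pos X.2]
  have hl : ∀ N s (X : l.Q), ρ N s ⟨X.1, Or.inr X.2⟩ = l.perm N s.1.2 X := fun N s X => by
    by_cases h : X.1 ∈ k.Q
    · simp only [ρ, dif_pos h]
      exact Equiv.ext (s.2 ⟨X.1, h, X.2⟩)
    · simp only [ρ, dif_neg h]
  have hρ : ∀ N, Function.Injective (ρ N) := by
    intro N s s' h
    refine Subtype.ext (Prod.ext (k.perm_injective N (funext fun X => ?_))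
      (l.perm_injective N (funext fun X => ?_)))
    · rw [← hk, ← hk, h]
    · rw [← hl, ← hl, h]
  have hH : ∀ N, ∃ H : Subgroup ((X : Q) → Equiv.Perm (X.1.Pt N.1)),
      (H : Set _) = Set.range (ρ N) := by
    intro N
    obtain ⟨K, hK⟩ := k.exists_subgroup N
    obtain ⟨K', hK'⟩ := l.exists_subgroup N
    let r : ((X : Q) → Equiv.Perm (X.1.Pt N.1)) →* ((X : k.Q) → Equiv.Perm (X.1.Pt N.1)) :=
      MonoidHom.pi fun X : k.Q => Pi.evalMonoidHom (fun X : Q => Equiv.Perm (X.1.Pt N.1))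
        ⟨X.1, Or.inl X.2⟩
    let r' : ((X : Q) → Equiv.Perm (X.1.Pt N.1)) →* ((X : l.Q) → Equiv.Perm (X.1.Pt N.1)) :=
      MonoidHom.pi fun X : l.Q => Pi.evalMonoidHom (fun X : Q => Equiv.Perm (X.1.Pt N.1))
        ⟨X.1, Or.inr X.2⟩
    refine ⟨K.comap r ⊓ K'.comap r', Set.ext fun g => ⟨?_, ?_⟩⟩
    · rintro ⟨h, h'⟩
      obtain ⟨a, ha⟩ := hK.subset h
      obtain ⟨b, hb⟩ := hK'.subset h'
      have hs : ∀ X : (k.Q ∩ l.Q : Set (DSet L)), ∀ x : X.1.Pt N.1,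
          k.perm N a ⟨X.1, X.2.1⟩ x = l.perm N b ⟨X.1, X.2.2⟩ x := fun X x =>
        Equiv.congr_fun ((congrFun ha ⟨X.1, X.2.1⟩).trans (congrFun hb ⟨X.1, X.2.2⟩).symm) x
      refine ⟨⟨(a, b), hs⟩, funext fun X => ?_⟩
      obtain ⟨X, hX | hX⟩ := X
      · exact (hk N ⟨(a, b), hs⟩ ⟨X, hX⟩).trans (congrFun ha ⟨X, hX⟩)
      · exact (hl N ⟨(a, b), hs⟩ ⟨X, hX⟩).trans (congrFun hb ⟨X, hX⟩)
    · rintro ⟨s, rfl⟩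
      exact ⟨hK.superset ⟨s.1.1, funext fun X => (hk N s X).symm⟩,
        hK'.superset ⟨s.1.2, funext fun X => (hl N s X).symm⟩⟩
  have hd : ∀ X : Q, DefMap (Ctx.triv M.thry) (S.prod (X.1.toUSet (hQv X.1 X.2)))
      (X.1.toUSet (hQv X.1 X.2)) (fun N w => ρ N w.1 X w.2) := by
    have hS : DefMap (Ctx.triv M.thry) S (k.set.prod l.set) (fun N s => s.1) := DefMap.sub_val
    rintro ⟨X, hX⟩
    have hS' : DefMap (Ctx.triv M.thry) (S.prod (X.toUSet (hQv X hX))) (k.set.prod l.set)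
        (fun N w => w.1.1) := DefMap.comp (C := Ctx.triv M.thry) (V := S) (W := k.set.prod l.set)
          (g := fun N s => s.1) hS DefMap.fst
    by_cases h : X ∈ k.Q
    · exact (DefMap.comp (C := Ctx.triv M.thry) (U := S.prod (X.toUSet (hQv X hX)))
        (V := k.set.prod (X.toUSet (k.validQ X h))) (W := X.toUSet (k.validQ X h))
        (g := fun N w => k.perm N w.1 ⟨X, h⟩ w.2) (f := fun N w => (w.1.1.1, w.2))
        (k.defMap_perm ⟨X, h⟩) (DefMap.pair (DefMap.fst' hS') DefMap.snd)).congr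
        fun N w => Equiv.congr_fun (hk N w.1 ⟨X, h⟩).symm w.2
    · have h' := hX.resolve_left h
      exact (DefMap.comp (C := Ctx.triv M.thry) (U := S.prod (X.toUSet (hQv X hX)))
        (V := l.set.prod (X.toUSet (l.validQ X h'))) (W := X.toUSet (l.validQ X h'))
        (g := fun N w => l.perm N w.1 ⟨X, h'⟩ w.2) (f := fun N w => (w.1.1.2, w.2))
        (l.defMap_perm ⟨X, h'⟩) (DefMap.pair (DefMap.snd' hS') DefMap.snd)).congr
        fun N w => Equiv.congr_fun (hl N w.1 ⟨X, h'⟩).symm w.2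
  obtain ⟨m, hm, h⟩ := exists_of_uset (i := i) (k.fin.union l.fin) hQv S ρ hρ hH hd
    fun N f hf => by
      obtain ⟨a, ha⟩ := k.exists_perm_eq N hf
      obtain ⟨b, hb⟩ := l.exists_perm_eq N hf
      refine ⟨⟨(a, b), fun X x => (ha ⟨X.1, X.2.1⟩ x).trans
        (hb ⟨X.1, X.2.2⟩ x).symm⟩, ?_⟩
      rintro ⟨X, hX | hX⟩ x
      · exact (Equiv.congr_fun (hk N _ ⟨X, hX⟩) x).trans (ha ⟨X, hX⟩ x)
      · exact (Equiv.congr_fun (hl N _ ⟨X, hX⟩) x).trans (hb ⟨X, hX⟩ x)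
  refine ⟨m, ⟨hm ▸ Set.subset_union_left, fun N g => ?_⟩, ⟨hm ▸ Set.subset_union_right, fun N g => ?_⟩⟩
  · obtain ⟨s, hs⟩ := h N g
    exact ⟨s.1.1, fun X => ((hs X.1 (Or.inl X.2)).trans (hk N s X)).symm⟩
  · obtain ⟨s, hs⟩ := h N g
    exact ⟨s.1.2, fun X => ((hs X.1 (Or.inr X.2)).trans (hl N s X)).symm⟩

theorem exists_mul (k : i.PermGroup M) : ∃ φ : DRel ![k.G, k.G, k.G], ∀ (N : Mod M.thry) a b c,
    φ.Holds N.1 (pt3 a b c) ↔ k.perm N a * k.perm N b = k.perm N c := by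
  have : Finite k.Q := k.fin
  refine Def.exists_drel₃ (hX := k.valid) (hY := k.valid) (hZ := k.valid)
    (R := fun N a b c => k.perm N a * k.perm N b = k.perm N c) (Def.congr (C := Ctx.triv M.thry)
      (U := k.set.prod (k.set.prod k.set))
      (R := fun N w => ∀ X : k.Q, ∀ x : X.1.Pt N.1,
        k.perm N w.1 X (k.perm N w.2.1 X x) = k.perm N w.2.2 X x)
      (Def.finite_all fun X => Def.all (V := X.1.toUSet (k.validQ _ X.2)) ?_)
      fun N w => ⟨fun h => funext fun X => Equiv.ext (h X), fun h X x =>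
        Equiv.congr_fun (congrFun h X) x⟩)
  let U := (k.set.prod (k.set.prod k.set)).prod (X.1.toUSet (k.validQ _ X.2))
  have hp : ∀ {f : (N : Mod M.thry) → U.car N → k.G.Pt N.1}
      {g : (N : Mod M.thry) → U.car N → X.1.Pt N.1}, DefMap (Ctx.triv M.thry) U k.set f →
      DefMap (Ctx.triv M.thry) U (X.1.toUSet (k.validQ _ X.2)) g →
      DefMap (Ctx.triv M.thry) U (X.1.toUSet (k.validQ _ X.2))
        (fun N w => k.perm N (f N w) X (g N w)) := fun {f g} hf hg =>
    DefMap.comp (C := Ctx.triv M.thry) (U := U) (V := k.set.prod (X.1.toUSet (k.validQ X.1 X.2)))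
      (W := X.1.toUSet (k.validQ X.1 X.2))
      (g := fun N p => k.perm N p.1 X p.2) (f := fun N w => (f N w, g N w)) (k.defMap_perm X)
      (DefMap.pair hf hg)
  exact Def.eq2 (C := Ctx.triv M.thry) (U := U) (V := X.1.toUSet (k.validQ _ X.2))
    (hp (f := fun N w => w.1.1) (g := fun N w => k.perm N w.1.2.1 X w.2) (DefMap.fst' DefMap.fst)
      (hp (f := fun N w => w.1.2.1) (g := fun N w => w.2)
        (DefMap.fst' (DefMap.snd' DefMap.fst)) DefMap.snd))
    (hp (f := fun N w => w.1.2.2) (g := fun N w => w.2)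
      (DefMap.snd' (DefMap.snd' DefMap.fst)) DefMap.snd)

theorem exists_tr {k l : i.PermGroup M} (h : k.Q ⊆ l.Q) : ∃ φ : DRel ![l.G, k.G],
    ∀ (N : Mod M.thry) b a, φ.Holds N.1 (pt2 b a) ↔
      ∀ X : k.Q, k.perm N a X = l.perm N b ⟨X.1, h X.2⟩ := by
  have : Finite k.Q := k.fin
  refine Def.exists_drel₂ (hX := l.valid) (hY := k.valid)
    (R := fun N b a => ∀ X : k.Q, k.perm N a X = l.perm N b ⟨X.1, h X.2⟩)
    (Def.finite_all fun X => Def.congr (C := Ctx.triv M.thry) (U := l.set.prod k.set)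
      (R := fun N w => ∀ x : X.1.Pt N.1, k.perm N w.2 X x = l.perm N w.1 ⟨X.1, h X.2⟩ x)
      (Def.all (V := X.1.toUSet (k.validQ _ X.2)) ?_)
      fun N w => Equiv.ext_iff.symm)
  refine Def.eq2 (C := Ctx.triv M.thry)
    (U := (l.set.prod k.set).prod (X.1.toUSet (k.validQ _ X.2)))
    (V := X.1.toUSet (k.validQ _ X.2)) (f := fun N w => k.perm N w.1.2 X w.2)
    (g := fun N w => l.perm N w.1.1 ⟨X.1, h X.2⟩ w.2) ?_ ?_
  · exact DefMap.comp (C := Ctx.triv M.thry)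
      (U := (l.set.prod k.set).prod (X.1.toUSet (k.validQ _ X.2)))
      (V := k.set.prod (X.1.toUSet (k.validQ _ X.2))) (W := X.1.toUSet (k.validQ _ X.2))
      (g := fun N w => k.perm N w.1 X w.2) (f := fun N w => (w.1.2, w.2))
      (k.defMap_perm X) (DefMap.pair (DefMap.snd' DefMap.fst) DefMap.snd)
  · exact DefMap.comp (C := Ctx.triv M.thry)
      (U := (l.set.prod k.set).prod (X.1.toUSet (k.validQ _ X.2)))
      (V := l.set.prod (X.1.toUSet (k.validQ _ X.2))) (W := X.1.toUSet (k.validQ _ X.2))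
      (g := fun N w => l.perm N w.1 ⟨X.1, h X.2⟩ w.2) (f := fun N w => (w.1.1, w.2))
      (l.defMap_perm ⟨X.1, h X.2⟩) (DefMap.pair (DefMap.fst' DefMap.fst) DefMap.snd)

/-- The multiplication of a group of permutations. -/
noncomputable def mul (k : i.PermGroup M) : DRel ![k.G, k.G, k.G] := k.exists_mul.choose

theorem mul_iff (k : i.PermGroup M) (N : Mod M.thry) (a b c : k.G.Pt N.1) :
    k.mul.Holds N.1 (pt3 a b c) ↔ k.perm N a * k.perm N b = k.perm N c :=
  k.exists_mul.choose_spec N a b c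

/-- Restriction of permutations to fewer sets. -/
noncomputable def tr {k l : i.PermGroup M} (h : k ≤ l) : DRel ![l.G, k.G] :=
  (exists_tr (subset_of_le h)).choose

theorem tr_iff {k l : i.PermGroup M} (h : k ≤ l) (N : Mod M.thry) (b : l.G.Pt N.1)
    (a : k.G.Pt N.1) : (tr h).Holds N.1 (pt2 b a) ↔
      ∀ X : k.Q, k.perm N a X = l.perm N b ⟨X.1, subset_of_le h X.2⟩ :=
  (exists_tr (subset_of_le h)).choose_spec N b a

/-- The pro-group of all definable groups of permutations. -/
noncomputable def proGroup (i : Interp L₀ L) (M : L.Str) (hv : ∀ s, (i.srt s).IsValid M.thry) : ProGroup M.thry where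
  I := i.PermGroup M
  nonempty := ⟨(exists_trivial (i := i) hv Set.finite_empty (Set.empty_subset _)).choose⟩
  directed := exists_ge
  G k := k.G
  valid k := k.valid
  mul k := k.mul
  tr h := tr h
  isGroup N hN k := by
    obtain ⟨H, hH⟩ := k.exists_subgroup ⟨N, hN⟩
    simp only [k.mul_iff ⟨N, hN⟩]
    exact IsGroupLaw.of_injective (k.perm_injective ⟨N, hN⟩) H hH
  tr_fn N hN k l h b := by
    obtain ⟨a, ha⟩ := exists_of_le h ⟨N, hN⟩ b
    refine ⟨a, (tr_iff h ⟨N, hN⟩ b a).2 ha, fun a' ha' => k.perm_injective ⟨N, hN⟩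
      (funext fun X => ?_)⟩
    rw [ha X]
    exact (tr_iff h ⟨N, hN⟩ b a').1 ha' X
  tr_mul N hN k l h a b c a' b' c' ha hb hc hm := by
    rw [tr_iff h ⟨N, hN⟩] at ha hb hc
    rw [mul_iff _ ⟨N, hN⟩] at hm ⊢
    funext X
    rw [Pi.mul_apply, ha, hb, hc]
    exact congrFun hm _
  tr_refl N hN k a := (tr_iff _ ⟨N, hN⟩ _ _).2 fun _ => rfl
  tr_trans N hN k l m h h' a b c hab hbc := by
    rw [tr_iff _ ⟨N, hN⟩] at hab hbc ⊢
    exact fun X => (hbc X).trans (hab _)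

end Interp.PermGroup

end MSLang

/-! ### Points of the inverse limit as automorphisms -/

namespace MSLang

variable {L₀ L : MSLang.{u}}

theorem DSet.ofSrt_isValid {T : L.Theory} (s : L.Srt) : (DSet.ofSrt s).IsValid T := fun N _ =>
  (eq_equivalence (α := N.car s)).comap fun v : (DSet.ofSrt s).Rep N => v.1 (0 : Fin 1)

theorem DSet.ofElt_bijective (N : L.Str) (s : L.Srt) :
    Function.Bijective (DSet.ofElt : N.car s → (DSet.ofSrt s).Pt N) := by
  refine ⟨fun x y h => ?_, fun x => ?_⟩
  · exact ((DSet.ofSrt_isValid (T := ∅) s N fun _ h => h.elim).quot_mk_eq_iff _ _).1 h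
  · obtain ⟨⟨v, hv⟩, rfl⟩ := Quot.exists_rep x
    exact ⟨v (0 : Fin 1), Quot.sound rfl⟩

/-- The points of a sort are its elements. -/
noncomputable def DSet.eltEquiv (N : L.Str) (s : L.Srt) : N.car s ≃ (DSet.ofSrt s).Pt N :=
  Equiv.ofBijective _ (DSet.ofElt_bijective N s)

theorem DefMap.eltEquiv_symm {T : L.Theory} {C : Ctx T} (s : L.Srt) :
    DefMap C ((DSet.ofSrt s).toUSet (DSet.ofSrt_isValid s)) (USet.sort T s)
      (fun N x => (DSet.eltEquiv (C.mod N).1 s).symm x) := by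
  refine Def.congr (C := C)
    (U := ((DSet.ofSrt s).toUSet (DSet.ofSrt_isValid s)).prod (USet.sort T s))
    (R := fun N w => ∃ v : (C.mod N).1.Tup (DSet.ofSrt s).srt,
      (DSet.ofSrt s).Repr (C.mod N).1 v w.1 ∧ v (0 : Fin 1) = w.2)
    (Def.ex (V := USet.raw T (DSet.ofSrt s).srt) (Def.and ?_ ?_)) fun N w => ⟨?_, ?_⟩
  · exact Def.repr.reindex (U := (((DSet.ofSrt s).toUSet (DSet.ofSrt_isValid s)).prod
      (USet.sort T s)).prod (USet.raw T (DSet.ofSrt s).srt)) (f := fun N w => (w.2, w.1.1))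
      (.pair (.snd' .id) (.fst' (.fst' .id)))
  · exact (DefMap.coord (σ := (DSet.ofSrt s).srt) (0 : Fin 1)).reindex
      (U := (((DSet.ofSrt s).toUSet (DSet.ofSrt_isValid s)).prod
      (USet.sort T s)).prod (USet.raw T (DSet.ofSrt s).srt)) (f := fun N w => (w.2, w.1.2))
      (.pair (.snd' .id) (.snd' (.fst' .id)))
  · rintro ⟨v, ⟨h, hv⟩, h'⟩
    rw [Equiv.symm_apply_eq, ← h', ← hv]
    exact Quot.sound rfl
  · intro h
    refine ⟨fun _ => w.2, ⟨fun h => h, ?_⟩, rfl⟩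
    rw [Equiv.symm_apply_eq] at h
    exact h.symm

namespace Interp

variable {i : Interp L₀ L} {M : L.Str} {hv : ∀ s, (i.srt s).IsValid M.thry} {A : Set M.Elt}

namespace PermGroup

variable {N : Mod M.thry} (g : (proGroup i M hv).Pt N.1)

theorem perm_eq_of_le {k l : i.PermGroup M} (h : k ≤ l) (X : k.Q) :
    k.perm N (g.1 k) X = l.perm N (g.1 l) ⟨X.1, subset_of_le h X.2⟩ :=
  (tr_iff h N _ _).1 (g.2 k l h) X

/-- A point of the inverse limit acts on each definable set in one way, since any two indices that
involve the set have a common upper bound. -/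
theorem perm_eq (k l : i.PermGroup M) {X : DSet L} (hk : X ∈ k.Q) (hl : X ∈ l.Q) :
    k.perm N (g.1 k) ⟨X, hk⟩ = l.perm N (g.1 l) ⟨X, hl⟩ := by
  obtain ⟨m, h, h'⟩ := exists_ge k l
  rw [perm_eq_of_le g h, perm_eq_of_le g h']

/-- The points of the pro-group of permutations are automorphisms. -/
theorem exists_aut (hA : i.IsInternalityParams A) (hA₀ : i.RestrictionTrivial A)
    (hs : i.IsCanonicallyEmbedded hv) : ∃ f : Aut N.1, i.FixesBase f ∧
      ∀ (k : i.PermGroup M) (X : k.Q) x, k.perm N (g.1 k) X x = f.onPt x := by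
  have hex : ∀ X : DSet L, X.IsValid M.thry → ∃ k : i.PermGroup M, X ∈ k.Q := fun X hX => by
    obtain ⟨k, h, -⟩ := hA.exists_permGroup hA₀ hs (X := fun _ : Unit => X) (fun _ => hX) Def.top
    exact ⟨k, h ()⟩
  choose κ hκ using hex
  let π : (s : L.Srt) → Equiv.Perm ((DSet.ofSrt s).Pt N.1) := fun s =>
    (κ _ (DSet.ofSrt_isValid s)).perm N (g.1 _) ⟨_, hκ _ _⟩
  have hπ : ∀ (k : i.PermGroup M) s (h : DSet.ofSrt s ∈ k.Q), k.perm N (g.1 k) ⟨_, h⟩ = π s :=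
    fun k s h => perm_eq g k _ h _
  -- Each basic relation is preserved by some group of the system, and by compatibility that group
  -- induces the same permutations π of the sorts.
  let e : StrIso N.1 N.1 :=
    { map := fun s => ((DSet.eltEquiv N.1 s).trans (π s)).trans (DSet.eltEquiv N.1 s).symm
      rel_iff := fun R x => by
        obtain ⟨k, h, hk⟩ := hA.exists_permGroup hA₀ hs
          (X := fun j => DSet.ofSrt (L.arSrt R j)) (fun j => DSet.ofSrt_isValid _)
          (R := fun N p => N.1.rel R fun j => (DSet.eltEquiv N.1 _).symm (p j)) (by
            refine Def.comp (C := Ctx.triv M.thry)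
              (U := USet.pi fun j => (DSet.ofSrt (L.arSrt R j)).toUSet (DSet.ofSrt_isValid _))
              (V := USet.pi fun j => USet.sort _ (L.arSrt R j)) (R := fun N p => N.1.rel R p)
              (f := fun N p j => (DSet.eltEquiv N.1 _).symm (p j)) (Def.rel R)
              (DefMap.tuple fun j => ?_)
            exact DefMap.comp (C := Ctx.triv M.thry)
              (U := USet.pi fun j => (DSet.ofSrt (L.arSrt R j)).toUSet (DSet.ofSrt_isValid _))
              (V := (DSet.ofSrt (L.arSrt R j)).toUSet (DSet.ofSrt_isValid _))
              (W := USet.sort _ (L.arSrt R j)) (g := fun N x => (DSet.eltEquiv N.1 _).symm x)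
              (f := fun N p => p j) (DefMap.eltEquiv_symm _)
              (.of_struct (.app .id j)))
        have h' := hk N (g.1 k) fun j => DSet.eltEquiv N.1 _ (x j)
        simp only [hπ, Equiv.symm_apply_apply] at h'
        exact h' }
  have he : ∀ s x, π s (DSet.eltEquiv N.1 s x) = DSet.eltEquiv N.1 s (e.map s x) := fun s x => by
    simp [e]
  -- The relation "v represents x" between tuples of the sorts and points of X is preserved by some
  -- group of the system, so the permutation of X is the one induced by the permutations of the
  -- sorts.
  have hf : ∀ (k : i.PermGroup M) (X : k.Q) x,
      k.perm N (g.1 k) X x = (Aut.ofStrIso e).onPt x := by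
    intro k X x
    have hX := k.validQ X.1 X.2
    have hv' : ∀ j, ((Sum.elim (fun j => DSet.ofSrt (X.1.srt j)) (fun _ => X.1) :
        Fin X.1.n ⊕ Unit → DSet L) j).IsValid M.thry := by
      rintro (j | j)
      exacts [DSet.ofSrt_isValid _, hX]
    obtain ⟨l, h, hl⟩ := hA.exists_permGroup hA₀ hs hv'
      (R := fun N p => X.1.Repr N.1 (fun j => (DSet.eltEquiv N.1 _).symm (p (Sum.inl j)))
        (p (Sum.inr ()))) (by
          refine Def.comp2 (C := Ctx.triv M.thry)
            (U := USet.pi fun j => ((Sum.elim (fun j => DSet.ofSrt (X.1.srt j)) (fun _ => X.1) :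
              Fin X.1.n ⊕ Unit → DSet L) j).toUSet (hv' j))
            (V := USet.raw _ X.1.srt) (W := X.1.toUSet hX) (R := fun N v x => X.1.Repr N.1 v x)
            (f := fun N p j => (DSet.eltEquiv N.1 _).symm (p (Sum.inl j)))
            (g := fun N p => p (Sum.inr ())) Def.repr ?_ (.of_struct (.app .id (Sum.inr ())))
          refine DefMap.comp (C := Ctx.triv M.thry)
            (U := USet.pi fun j => ((Sum.elim (fun j => DSet.ofSrt (X.1.srt j)) (fun _ => X.1) :
              Fin X.1.n ⊕ Unit → DSet L) j).toUSet (hv' j))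
            (V := USet.pi fun j => USet.sort _ (X.1.srt j)) (W := USet.raw _ X.1.srt) (g := fun N p => p)
            (f := fun N p j => (DSet.eltEquiv N.1 _).symm (p (Sum.inl j)))
            DefMap.raw_of_sorts (DefMap.tuple fun j => ?_)
          exact DefMap.comp (C := Ctx.triv M.thry)
            (U := USet.pi fun j => ((Sum.elim (fun j => DSet.ofSrt (X.1.srt j)) (fun _ => X.1) :
              Fin X.1.n ⊕ Unit → DSet L) j).toUSet (hv' j))
            (V := (DSet.ofSrt (X.1.srt j)).toUSet (DSet.ofSrt_isValid _))
            (W := USet.sort _ (X.1.srt j)) (g := fun N x => (DSet.eltEquiv N.1 _).symm x)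
            (f := fun N p => p (Sum.inl j)) (DefMap.eltEquiv_symm _)
            (.of_struct (.app .id (Sum.inl j))))
    obtain ⟨v, hvx⟩ := X.1.exists_repr x
    have h' := (hl N (g.1 l) (fun j => match j with
      | .inl j => DSet.eltEquiv N.1 _ (v j)
      | .inr _ => x)).2 (by simpa using hvx)
    have h₁ := perm_eq g k l X.2 (h (Sum.inr ()))
    have h₂ : ∀ j, l.perm N (g.1 l) ⟨_, h (Sum.inl j)⟩ (DSet.eltEquiv N.1 _ (v j)) =
        DSet.eltEquiv N.1 _ (e.map _ (v j)) := fun j => by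
      rw [← he]
      exact Equiv.congr_fun (hπ l _ (h (Sum.inl j))) _
    have h₃ : X.1.Repr N.1 (fun j => e.map _ (v j)) (l.perm N (g.1 l) ⟨X.1, h (Sum.inr ())⟩ x) := by
      have h₄ : (fun j => (DSet.eltEquiv N.1 (X.1.srt j)).symm (l.perm N (g.1 l) ⟨_, h (Sum.inl j)⟩
          (DSet.eltEquiv N.1 _ (v j)))) = fun j => e.map _ (v j) :=
        funext fun j => (Equiv.symm_apply_eq _).2 (h₂ j)
      rw [← h₄]
      exact h'
    rw [h₁]
    obtain ⟨hd, rfl⟩ := hvx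
    obtain ⟨hd', h₄⟩ := h₃
    exact h₄.symm
  refine ⟨Aut.ofStrIso e, fun s x => ?_, hf⟩
  -- The system contains the trivial group on the set that interprets a sort of the base, so every
  -- point of the limit fixes that set.
  obtain ⟨k, hk, h⟩ := exists_trivial (i := i) hv (Set.finite_singleton (i.srt s))
    (Set.singleton_subset_iff.2 ⟨s, rfl⟩)
  have hsk : i.srt s ∈ k.Q := hk ▸ Set.mem_singleton _
  exact (hf k ⟨i.srt s, hsk⟩ x).symm.trans (Equiv.congr_fun (h N (g.1 k) _ rfl) x)

/-- The permutations induced by an automorphism over the base. -/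
theorem exists_pt {f : Aut N.1} (hf : i.FixesBase f) :
    ∃ g : (proGroup i M hv).Pt N.1, ∀ (k : i.PermGroup M) (X : k.Q) x,
      k.perm N (g.1 k) X x = f.onPt x := by
  choose g hg using fun k : i.PermGroup M => k.exists_perm_eq N hf
  exact ⟨⟨g, fun k l h => (tr_iff h N _ _).2 fun X => Equiv.ext fun x =>
    (hg k X x).trans (hg l ⟨X.1, subset_of_le h X.2⟩ x).symm⟩, hg⟩

end PermGroup

/-- Every valid definable set is acted on by some group of the system, as `exists_permGroup` with
the relation that always holds shows. Uniqueness of the point attached to an automorphism holds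
because its coordinates are determined by their permutations. -/
theorem IsInternalityParams.exists_galoisGroup (hA : i.IsInternalityParams A)
    (hA₀ : i.RestrictionTrivial A) (hs : i.IsCanonicallyEmbedded hv) :
    Nonempty (i.GaloisGroup M.thry) := by
  have hex : ∀ X : DSet L, X.IsValid M.thry → ∃ k : i.PermGroup M, X ∈ k.Q := fun X hX => by
    obtain ⟨k, h, -⟩ := hA.exists_permGroup hA₀ hs (X := fun _ : Unit => X) (fun _ => hX) Def.top
    exact ⟨k, h ()⟩
  choose κ hκ using hex
  let act : (X : DSet L) → X.IsValid M.thry → (PermGroup.proGroup i M hv).Act X := fun X hX =>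
    { k := κ X hX
      act := (κ X hX).act ⟨X, hκ X hX⟩
      isAct := fun N hN => by
        obtain ⟨H, hH⟩ := (κ X hX).exists_subgroup ⟨N, hN⟩
        have h := IsActionLaw.of_injective ((κ X hX).perm_injective ⟨N, hN⟩) H hH
          (Pi.evalMonoidHom (fun X : (κ X hX).Q => Equiv.Perm (X.1.Pt N)) ⟨X, hκ X hX⟩)
        show IsActionLaw (fun a b c : (κ X hX).G.Pt N => (κ X hX).mul.Holds N (pt3 a b c))
          (fun (a : (κ X hX).G.Pt N) (x y : X.Pt N) =>
            ((κ X hX).act ⟨X, hκ X hX⟩).Holds N (pt3 a x y))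
        simp only [(κ X hX).mul_iff ⟨N, hN⟩, (κ X hX).act_iff ⟨N, hN⟩]
        exact h }
  have hact : ∀ (N : Mod M.thry) (g : (PermGroup.proGroup i M hv).Pt N.1) X hX (x y : X.Pt N.1),
      (act X hX).Rel g x y ↔ (κ X hX).perm N (g.1 _) ⟨X, hκ X hX⟩ x = y := fun N g X hX x y =>
    (κ X hX).act_iff N _ _ _ _
  have hpt : ∀ (N : Mod M.thry) (f : Aut N.1), i.FixesBase f →
      ∃! g : (PermGroup.proGroup i M hv).Pt N.1, ∀ X (hX : X.IsValid M.thry) (x y : X.Pt N.1),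
        (act X hX).Rel g x y ↔ f.onPt x = y := by
    intro N f hf
    obtain ⟨g, hg⟩ := PermGroup.exists_pt (hv := hv) hf
    refine ⟨g, fun X hX x y => (hact N g X hX x y).trans (hg _ ⟨X, hκ X hX⟩ x ▸ Iff.rfl),
      fun g' hg' => Subtype.ext (funext fun (k : i.PermGroup M) => k.perm_injective N
        (funext fun X => Equiv.ext fun x => ?_))⟩
    rw [hg k X x, PermGroup.perm_eq g' k (κ X.1 (k.validQ _ X.2)) X.2 (hκ _ _)]
    exact (hact N g' X.1 (k.validQ _ X.2) x _).1 ((hg' X.1 (k.validQ _ X.2) x _).2 rfl)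
  refine ⟨⟨PermGroup.proGroup i M hv, act, fun N hN g => ?_, fun N hN => hpt ⟨N, hN⟩⟩⟩
  obtain ⟨f, hf, h⟩ := PermGroup.exists_aut (N := ⟨N, hN⟩) g hA hA₀ hs
  exact ⟨f, hf, fun X hX x y => (hact ⟨N, hN⟩ g X hX x y).trans (h _ ⟨X, hκ X hX⟩ x ▸ Iff.rfl)⟩

end Interp

end MSLang

/-! ### Copying a pro-group into the base -/

namespace MSLang

variable {L₀ L : MSLang.{u}}

/-- The axioms on the right are first-order in the graph alone, so being a group law becomes a
definable statement that transfers between models. -/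
theorem isGroupLaw_iff {α : Type u} {R : α → α → α → Prop} : IsGroupLaw R ↔
    (∀ a, IsFn (R a)) ∧ (∀ a b c d e f, R a b d → R d c f → R b c e → R a e f) ∧
      ∃ e, (∀ a, R e a a) ∧ ∀ a, ∃ b, R b a e := by
  constructor
  · rintro ⟨_, h⟩
    simp only [IsFn, h]
    refine ⟨fun a b => ⟨a * b, rfl, fun _ h => h.symm⟩, ?_, 1, one_mul, fun a => ⟨a⁻¹, by simp⟩⟩
    rintro a b c _ _ _ rfl rfl rfl
    exact (mul_assoc a b c).symm
  · rintro ⟨hf, ha, e, h1, hi⟩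
    choose m hm hm' using hf
    choose v hv using hi
    have hR : ∀ a b c, R a b c ↔ m a b = c := fun a b c =>
      ⟨fun h => (hm' a b c h).symm, fun h => h ▸ hm a b⟩
    simp only [hR] at ha h1 hv
    let _ : Mul α := ⟨m⟩
    let _ : Inv α := ⟨v⟩
    let _ : One α := ⟨e⟩
    exact ⟨Group.ofLeftAxioms (fun a b c => (ha a b c _ _ _ rfl rfl rfl).symm) h1 hv, hR⟩

theorem IsGroupLaw.of_equiv {α β : Type u} (e : α ≃ β) {R : α → α → α → Prop}
    {S : β → β → β → Prop} (h : ∀ a b c, S (e a) (e b) (e c) ↔ R a b c) (hR : IsGroupLaw R) :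
    IsGroupLaw S := by
  obtain ⟨_, hR⟩ := hR
  refine ⟨e.symm.group, fun a b c => ?_⟩
  obtain ⟨a, rfl⟩ := e.surjective a
  obtain ⟨b, rfl⟩ := e.surjective b
  obtain ⟨c, rfl⟩ := e.surjective c
  rw [h, hR, Equiv.mul_def]
  simp

theorem Def.isGroupLaw {T : L.Theory} {U : USet T}
    {R : (N : Mod T) → U.car N → U.car N → U.car N → Prop}
    (hR : Def (Ctx.triv T) (U.prod (U.prod U)) (fun N w => R N w.1 w.2.1 w.2.2)) :
    Def (Ctx.triv T) (USet.unit T) (fun N _ => IsGroupLaw (R N)) := by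
  have hc : ∀ {V : USet T} {f g h : (N : Mod T) → V.car N → U.car N}, StructMap V U f →
      StructMap V U g → StructMap V U h →
      Def (Ctx.triv T) V (fun N x => R N (f N x) (g N x) (h N x)) := fun {V f g h} hf hg hh =>
    hR.reindex (U := V) (f := fun N x => (f N x, (g N x, h N x))) (.pair hf (.pair hg hh))
  refine Def.congr (C := Ctx.triv T) (U := USet.unit T) (R := fun N _ => (∀ a, IsFn (R N a)) ∧
      (∀ a b c d e f, R N a b d → R N d c f → R N b c e → R N a e f) ∧
      ∃ e, (∀ a, R N e a a) ∧ ∀ a, ∃ b, R N b a e) ?_ fun N _ => isGroupLaw_iff.symm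
  refine Def.and (Def.all (V := U) ((Def.isFn_param hR).reindex (.snd' .id))) (Def.and
    (Def.all (V := U) (Def.all (V := U) (Def.all (V := U) (Def.all (V := U) (Def.all (V := U)
      (Def.all (V := U) (Def.imp ?_ (Def.imp ?_ (Def.imp ?_ ?_)))))))))
    (Def.ex (V := U) (Def.and (Def.all (V := U) ?_) (Def.all (V := U) (Def.ex (V := U) ?_)))))
  · exact hc (V := ((((((USet.unit T).prod U).prod U).prod U).prod U).prod U).prod U)
      (f := fun N x => x.1.1.1.1.1.2) (g := fun N x => x.1.1.1.1.2) (h := fun N x => x.1.1.2)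
      (.snd' (.fst' (.fst' (.fst' (.fst' (.fst' .id)))))) (.snd' (.fst' (.fst' (.fst' (.fst' .id)))))
      (.snd' (.fst' (.fst' .id)))
  · exact hc (V := ((((((USet.unit T).prod U).prod U).prod U).prod U).prod U).prod U)
      (f := fun N x => x.1.1.2) (g := fun N x => x.1.1.1.2) (h := fun N x => x.2)
      (.snd' (.fst' (.fst' .id))) (.snd' (.fst' (.fst' (.fst' .id)))) (.snd' .id)
  · exact hc (V := ((((((USet.unit T).prod U).prod U).prod U).prod U).prod U).prod U)
      (f := fun N x => x.1.1.1.1.2) (g := fun N x => x.1.1.1.2) (h := fun N x => x.1.2)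
      (.snd' (.fst' (.fst' (.fst' (.fst' .id))))) (.snd' (.fst' (.fst' (.fst' .id))))
      (.snd' (.fst' .id))
  · exact hc (V := ((((((USet.unit T).prod U).prod U).prod U).prod U).prod U).prod U)
      (f := fun N x => x.1.1.1.1.1.2) (g := fun N x => x.1.2) (h := fun N x => x.2)
      (.snd' (.fst' (.fst' (.fst' (.fst' (.fst' .id)))))) (.snd' (.fst' .id)) (.snd' .id)
  · exact hc (V := ((USet.unit T).prod U).prod U) (f := fun N x => x.1.2) (g := fun N x => x.2)
      (h := fun N x => x.2) (.snd' (.fst' .id)) (.snd' .id) (.snd' .id)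
  · exact hc (V := (((USet.unit T).prod U).prod U).prod U) (f := fun N x => x.2)
      (g := fun N x => x.1.2) (h := fun N x => x.1.1.2) (.snd' .id) (.snd' (.fst' .id))
      (.snd' (.fst' (.fst' .id)))

namespace Interp

variable {i : Interp L₀ L} {M : L.Str} {hv : ∀ s, (i.srt s).IsValid M.thry} {A : Set M.Elt}

theorem IsInternalityParams.exists_dset_equiv (hA : i.IsInternalityParams A)
    (hA₀ : i.RestrictionTrivial A) (hs : i.IsCanonicallyEmbedded hv) (U : USet M.thry) :
    ∃ (D : DSet L₀) (hD : D.IsValid (i.pull M).thry)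
      (b : (N : AModel A) → U.car N.mod ≃ D.Pt (i.pull N.N)),
      DefMap (Ctx.par hA.valid) U (i.pb hv (D.toUSet hD)) (fun N x => b N x) := by
  obtain ⟨V, b, hb⟩ := hA.exists_equiv hA₀ hs U
  obtain ⟨D, hD, e, he⟩ := V.exists_dset
  refine ⟨D, hD, fun N => (b N).trans (e (i.pullMod hv N.mod)).symm, ?_⟩
  exact DefMap.comp (C := Ctx.par hA.valid) (V := i.pb hv V) (W := i.pb hv (D.toUSet hD))
    (g := fun N y => (e (i.pullMod hv N.mod)).symm y) (f := fun N x => b N x)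
    (defMap_pb (hv := hv) (U := V) (V := D.toUSet hD) (f := fun N y => (e N).symm y)
      (DefMap.symm (U := D.toUSet hD) (f := fun N x => e N x) he
        fun N x y => eq_comm.trans (Equiv.symm_apply_eq _).symm)) hb

/-- Transport through an `A`-definable bijection turns an `A`-definable relation into one on a set
of the base, where no parameters are needed. -/
theorem RestrictionTrivial.exists_base_def_of_equiv (hA₀ : i.RestrictionTrivial A)
    (hA : ∀ x ∈ A, x.1.IsValid M.thry) (hs : i.IsCanonicallyEmbedded hv) {U : USet M.thry}
    {V : USet (i.pull M).thry} (b : (N : AModel A) → U.car N.mod ≃ V.car (i.pullMod hv N.mod))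
    (hb : DefMap (Ctx.par hA) U (i.pb hv V) (fun N x => b N x))
    {R : (N : AModel A) → U.car N.mod → Prop} (hR : Def (Ctx.par hA) U R) :
    ∃ R₀ : (N : Mod (i.pull M).thry) → V.car N → Prop, Def (Ctx.triv (i.pull M).thry) V R₀ ∧
      ∀ N x, R₀ (i.pullMod hv N.mod) (b N x) ↔ R N x := by
  obtain ⟨R₀, hR₀, h⟩ := hA₀.exists_base_def hA hs (V := V) (R := fun N v => R N ((b N).symm v))
    (Def.comp (C := Ctx.par hA) (U := i.pb hv V) (V := U) (f := fun N v => (b N).symm v) hR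
      (DefMap.symm (C := Ctx.par hA) (U := U) (V := i.pb hv V) (f := fun N x => b N x) hb
        fun N x y => eq_comm.trans (Equiv.symm_apply_eq _).symm))
  exact ⟨R₀, hR₀, fun N x => (h N _).symm.trans (by rw [Equiv.symm_apply_apply])⟩

theorem defMap_prodMap {C : Ctx M.thry} {U U' : USet M.thry} {V V' : USet (i.pull M).thry}
    {f : (N : C.Md) → U.car (C.mod N) → V.car (i.pullMod hv (C.mod N))}
    {f' : (N : C.Md) → U'.car (C.mod N) → V'.car (i.pullMod hv (C.mod N))}
    (hf : DefMap C U (i.pb hv V) f) (hf' : DefMap C U' (i.pb hv V') f') :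
    DefMap C (U.prod U') (i.pb hv (V.prod V')) (fun N x => (f N x.1, f' N x.2)) :=
  DefMap.comp (C := C) (U := U.prod U') (V := (i.pb hv V).prod (i.pb hv V'))
    (W := i.pb hv (V.prod V')) (g := fun N y => y) (f := fun N x => (f N x.1, f' N x.2))
    defMap_prod_pb (DefMap.pair
      (DefMap.comp (C := C) (U := U.prod U') (V := U) (W := i.pb hv V) (g := f)
        (f := fun N x => x.1) hf DefMap.fst)
      (DefMap.comp (C := C) (U := U.prod U') (V := U') (W := i.pb hv V') (g := f')
        (f := fun N x => x.2) hf' DefMap.snd))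

/-- Pro-groups are isomorphic, over the parameters, to pro-groups in the base. -/
theorem IsInternalityParams.exists_proIso (hA : i.IsInternalityParams A)
    (hA₀ : i.RestrictionTrivial A) (hs : i.IsCanonicallyEmbedded hv) (G : ProGroup M.thry) :
    ∃ H : ProGroup (i.pull M).thry, Nonempty (i.ProIso A G H) := by
  choose H hH b hb using fun k => hA.exists_dset_equiv hA₀ hs (G.set k)
  let HS : G.I → USet (i.pull M).thry := fun k => (H k).toUSet (hH k)
  have hbb : ∀ {U U' : USet M.thry} {V V' : USet (i.pull M).thry}
      {f : (N : AModel A) → U.car N.mod → V.car (i.pullMod hv N.mod)}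
      {f' : (N : AModel A) → U'.car N.mod → V'.car (i.pullMod hv N.mod)},
      DefMap (Ctx.par hA.valid) U (i.pb hv V) f → DefMap (Ctx.par hA.valid) U' (i.pb hv V') f' →
      DefMap (Ctx.par hA.valid) (U.prod U') (i.pb hv (V.prod V'))
        (fun N x => (f N x.1, f' N x.2)) := fun hf hf' => defMap_prodMap hf hf'
  have hmul : ∀ k, ∃ m : DRel ![H k, H k, H k], ∀ N x y z,
      m.Holds (i.pull N.N) (pt3 (b k N x) (b k N y) (b k N z)) ↔
        (G.mul k).Holds N.N (pt3 x y z) := by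
    intro k
    obtain ⟨R₀, hR₀, h⟩ := hA₀.exists_base_def_of_equiv hA.valid hs
      (U := (G.set k).prod ((G.set k).prod (G.set k))) (V := (HS k).prod ((HS k).prod (HS k)))
      (fun N => (b k N).prodCongr ((b k N).prodCongr (b k N)))
      (hbb (hb k) (hbb (hb k) (hb k)))
      (R := fun N w => (G.mul k).Holds N.N (pt3 w.1 w.2.1 w.2.2)) (G.mul k).def_holds₃
    obtain ⟨m, hm⟩ := Def.exists_drel₃ (hX := hH k) (hY := hH k) (hZ := hH k)
      (R := fun N x y z => R₀ N (x, (y, z))) hR₀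
    exact ⟨m, fun N x y z => (hm (i.pullMod hv N.mod) _ _ _).trans (h N (x, (y, z)))⟩
  have htr : ∀ k l (hkl : k ≤ l), ∃ t : DRel ![H l, H k], ∀ N x y,
      t.Holds (i.pull N.N) (pt2 (b l N x) (b k N y)) ↔ (G.tr hkl).Holds N.N (pt2 x y) := by
    intro k l hkl
    obtain ⟨R₀, hR₀, h⟩ := hA₀.exists_base_def_of_equiv hA.valid hs
      (U := (G.set l).prod (G.set k)) (V := (HS l).prod (HS k))
      (fun N => (b l N).prodCongr (b k N))
      (hbb (hb l) (hb k))
      (R := fun N w => (G.tr hkl).Holds N.N (pt2 w.1 w.2)) (G.tr hkl).def_holds₂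
    obtain ⟨m, hm⟩ := Def.exists_drel₂ (hX := hH l) (hY := hH k)
      (R := fun N x y => R₀ N (x, y)) hR₀
    exact ⟨m, fun N x y => (hm (i.pullMod hv N.mod) _ _).trans (h N (x, y))⟩
  choose m hm using hmul
  choose t ht using htr
  let T₀ := (i.pull M).thry
  let A' := AModel.self A
  have hmd : ∀ {V : USet T₀} k {f g h : (N : Mod T₀) → V.car N → (H k).Pt N.1},
      StructMap V (HS k) f → StructMap V (HS k) g → StructMap V (HS k) h →
      Def (Ctx.triv T₀) V (fun N x => (m k).Holds N.1 (pt3 (f N x) (g N x) (h N x))) :=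
    fun {V} k {f g h} hf hg hh => Def.reindex (C := Ctx.triv T₀) (U := V)
      (V := (HS k).prod ((HS k).prod (HS k)))
      (R := fun N w => (m k).Holds N.1 (pt3 w.1 w.2.1 w.2.2))
      (f := fun N x => (f N x, (g N x, h N x))) (m k).def_holds₃ (.pair hf (.pair hg hh))
  have htd : ∀ {V : USet T₀} {k l} (hkl : k ≤ l) {f : (N : Mod T₀) → V.car N → (H l).Pt N.1}
      {g : (N : Mod T₀) → V.car N → (H k).Pt N.1}, StructMap V (HS l) f → StructMap V (HS k) g →
      Def (Ctx.triv T₀) V (fun N x => (t k l hkl).Holds N.1 (pt2 (f N x) (g N x))) :=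
    fun {V} k l hkl {f g} hf hg => Def.reindex (C := Ctx.triv T₀) (U := V)
      (V := (HS l).prod (HS k)) (R := fun N w => (t k l hkl).Holds N.1 (pt2 w.1 w.2))
      (f := fun N x => (f N x, g N x)) (t k l hkl).def_holds₂ (.pair hf hg)
  -- A pro-group in the base requires its axioms in all models of the theory of M₀, including those
  -- not presented as N₀ with parameters. Each axiom is a definable statement, so it is checked in
  -- M₀, where the bijections reduce it to `G`, and then transferred; the same applies to the other
  -- axioms below.
  have hgrp : ∀ (N : Mod T₀) k, IsGroupLaw (fun x y z : (H k).Pt N.1 =>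
      (m k).Holds N.1 (pt3 x y z)) := fun N k =>
    (Def.iff_self (M := i.pull M) (R := fun N => IsGroupLaw (fun x y z : (H k).Pt N.1 =>
      (m k).Holds N.1 (pt3 x y z))) (Def.isGroupLaw (U := HS k) (hmd k
        (V := (HS k).prod ((HS k).prod (HS k))) (f := fun N w => w.1) (g := fun N w => w.2.1)
        (h := fun N w => w.2.2) (.fst' .id) (.fst' (.snd' .id)) (.snd' (.snd' .id)))) N).2
      ((G.isGroup M M.self.2 k).of_equiv (b k A') (hm k A'))
  have hfn : ∀ (N : Mod T₀) {k l} (hkl : k ≤ l), IsFn (fun (x : (H l).Pt N.1) (y : (H k).Pt N.1) =>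
      (t k l hkl).Holds N.1 (pt2 x y)) := fun N k l hkl =>
    (Def.iff_self (M := i.pull M) (R := fun N => IsFn (fun (x : (H l).Pt N.1) (y : (H k).Pt N.1) =>
      (t k l hkl).Holds N.1 (pt2 x y))) (Def.isFn (C := Ctx.triv T₀) (U := HS l) (V := HS k)
        (R := fun N x y => (t k l hkl).Holds N.1 (pt2 x y)) (t k l hkl).def_holds₂) N).2
      fun x => by
        obtain ⟨y, hy, hy'⟩ := G.tr_fn M M.self.2 hkl ((b l A').symm x)
        have key : ∀ z, (t k l hkl).Holds (i.pull M) (pt2 x z) ↔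
            (G.tr hkl).Holds M (pt2 ((b l A').symm x) ((b k A').symm z)) := fun z => by
          rw [← ht k l hkl A', Equiv.apply_symm_apply, Equiv.apply_symm_apply]
        refine ⟨b k A' y, (key _).2 (by rwa [Equiv.symm_apply_apply]), fun z hz => ?_⟩
        rw [← hy' _ ((key z).1 hz), Equiv.apply_symm_apply]
  have htm : ∀ (N : Mod T₀) {k l} (hkl : k ≤ l), ∀ (x y z : (H l).Pt N.1) (x' y' z' : (H k).Pt N.1),
      (t k l hkl).Holds N.1 (pt2 x x') → (t k l hkl).Holds N.1 (pt2 y y') →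
      (t k l hkl).Holds N.1 (pt2 z z') → (m l).Holds N.1 (pt3 x y z) →
      (m k).Holds N.1 (pt3 x' y' z') := by
    intro N k l hkl
    refine (Def.iff_self (M := i.pull M) (R := fun N =>
      ∀ (x y z : (H l).Pt N.1) (x' y' z' : (H k).Pt N.1),
      (t k l hkl).Holds N.1 (pt2 x x') → (t k l hkl).Holds N.1 (pt2 y y') →
      (t k l hkl).Holds N.1 (pt2 z z') → (m l).Holds N.1 (pt3 x y z) →
      (m k).Holds N.1 (pt3 x' y' z')) (Def.all (V := HS l) (Def.all (V := HS l)
        (Def.all (V := HS l) (Def.all (V := HS k) (Def.all (V := HS k) (Def.all (V := HS k)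
        (Def.imp ?_ (Def.imp ?_ (Def.imp ?_ (Def.imp ?_ ?_)))))))))) N).2 ?_
    · exact htd (V := ((((((USet.unit T₀).prod (HS l)).prod (HS l)).prod (HS l)).prod (HS k)).prod
        (HS k)).prod (HS k)) hkl (f := fun N w => w.1.1.1.1.1.2) (g := fun N w => w.1.1.2)
        (.snd' (.fst' (.fst' (.fst' (.fst' (.fst' .id)))))) (.snd' (.fst' (.fst' .id)))
    · exact htd (V := ((((((USet.unit T₀).prod (HS l)).prod (HS l)).prod (HS l)).prod (HS k)).prod
        (HS k)).prod (HS k)) hkl (f := fun N w => w.1.1.1.1.2) (g := fun N w => w.1.2)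
        (.snd' (.fst' (.fst' (.fst' (.fst' .id))))) (.snd' (.fst' .id))
    · exact htd (V := ((((((USet.unit T₀).prod (HS l)).prod (HS l)).prod (HS l)).prod (HS k)).prod
        (HS k)).prod (HS k)) hkl (f := fun N w => w.1.1.1.2) (g := fun N w => w.2)
        (.snd' (.fst' (.fst' (.fst' .id)))) (.snd' .id)
    · exact hmd (V := ((((((USet.unit T₀).prod (HS l)).prod (HS l)).prod (HS l)).prod (HS k)).prod
        (HS k)).prod (HS k)) l (f := fun N w => w.1.1.1.1.1.2) (g := fun N w => w.1.1.1.1.2)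
        (h := fun N w => w.1.1.1.2) (.snd' (.fst' (.fst' (.fst' (.fst' (.fst' .id))))))
        (.snd' (.fst' (.fst' (.fst' (.fst' .id))))) (.snd' (.fst' (.fst' (.fst' .id))))
    · exact hmd (V := ((((((USet.unit T₀).prod (HS l)).prod (HS l)).prod (HS l)).prod (HS k)).prod
        (HS k)).prod (HS k)) k (f := fun N w => w.1.1.2) (g := fun N w => w.1.2)
        (h := fun N w => w.2) (.snd' (.fst' (.fst' .id))) (.snd' (.fst' .id)) (.snd' .id)
    · rw [← (b l A').forall_congr_right]
      intro x
      rw [← (b l A').forall_congr_right]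
      intro y
      rw [← (b l A').forall_congr_right]
      intro z
      rw [← (b k A').forall_congr_right]
      intro x'
      rw [← (b k A').forall_congr_right]
      intro y'
      rw [← (b k A').forall_congr_right]
      intro z'
      rw [ht k l hkl A', ht k l hkl A', ht k l hkl A', hm l A', hm k A']
      exact G.tr_mul M M.self.2 hkl x y z x' y' z'
  have hrefl : ∀ (N : Mod T₀) k (x : (H k).Pt N.1), (t k k le_rfl).Holds N.1 (pt2 x x) := by
    intro N k
    refine (Def.iff_self (M := i.pull M) (R := fun N =>
      ∀ x : (H k).Pt N.1, (t k k le_rfl).Holds N.1 (pt2 x x)) (Def.all (V := HS k)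
        (htd (V := (USet.unit T₀).prod (HS k)) le_rfl (f := fun N w => w.2) (g := fun N w => w.2)
          (.snd' .id) (.snd' .id))) N).2 ?_
    rw [← (b k A').forall_congr_right]
    intro x
    exact (ht k k le_rfl A' x x).2 (G.tr_refl M M.self.2 k x)
  have htrans : ∀ (N : Mod T₀) {k l j} (hkl : k ≤ l) (hlj : l ≤ j), ∀ (x : (H j).Pt N.1)
      (y : (H l).Pt N.1) (z : (H k).Pt N.1), (t l j hlj).Holds N.1 (pt2 x y) →
      (t k l hkl).Holds N.1 (pt2 y z) → (t k j (hkl.trans hlj)).Holds N.1 (pt2 x z) := by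
    intro N k l j hkl hlj
    refine (Def.iff_self (M := i.pull M) (R := fun N => ∀ (x : (H j).Pt N.1)
      (y : (H l).Pt N.1) (z : (H k).Pt N.1), (t l j hlj).Holds N.1 (pt2 x y) →
      (t k l hkl).Holds N.1 (pt2 y z) → (t k j (hkl.trans hlj)).Holds N.1 (pt2 x z))
      (Def.all (V := HS j) (Def.all (V := HS l) (Def.all (V := HS k) (Def.imp ?_
        (Def.imp ?_ ?_))))) N).2 ?_
    · exact htd (V := (((USet.unit T₀).prod (HS j)).prod (HS l)).prod (HS k)) hlj
        (f := fun N w => w.1.1.2) (g := fun N w => w.1.2) (.snd' (.fst' (.fst' .id)))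
        (.snd' (.fst' .id))
    · exact htd (V := (((USet.unit T₀).prod (HS j)).prod (HS l)).prod (HS k)) hkl
        (f := fun N w => w.1.2) (g := fun N w => w.2) (.snd' (.fst' .id)) (.snd' .id)
    · exact htd (V := (((USet.unit T₀).prod (HS j)).prod (HS l)).prod (HS k)) (hkl.trans hlj)
        (f := fun N w => w.1.1.2) (g := fun N w => w.2) (.snd' (.fst' (.fst' .id))) (.snd' .id)
    · rw [← (b j A').forall_congr_right]
      intro x
      rw [← (b l A').forall_congr_right]
      intro y
      rw [← (b k A').forall_congr_right]
      intro z
      rw [ht l j hlj A', ht k l hkl A', ht k j _ A']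
      exact G.tr_trans M M.self.2 hkl hlj x y z
  let K : ProGroup (i.pull M).thry :=
    { I := G.I
      pre := G.pre
      nonempty := G.nonempty
      directed := G.directed
      G := H
      valid := hH
      mul := m
      tr := fun {k l} hkl => t k l hkl
      isGroup := fun N hN k => hgrp ⟨N, hN⟩ k
      tr_fn := fun N hN {_ _} hkl => hfn ⟨N, hN⟩ hkl
      tr_mul := fun N hN {_ _} hkl => htm ⟨N, hN⟩ hkl
      tr_refl := fun N hN k => hrefl ⟨N, hN⟩ k
      tr_trans := fun N hN {_ _ _} hkl hlj => htrans ⟨N, hN⟩ hkl hlj }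
  -- The isomorphism acts levelwise, so the same relation serves for both directions.
  choose φ hφ using fun k => exists_arel (i := i) (hv := hv) (hA := hA.valid) (hX := G.valid k)
    (hD := hH k) (R := fun N x d => b k N x = d) (hb k)
  exact ⟨K, ⟨{
    θ := fun N =>
      { toFun := fun g => ⟨fun k => b k N (g.1 k), fun k l h => (ht k l h N _ _).2 (g.2 k l h)⟩
        invFun := fun g => ⟨fun k => (b k N).symm (g.1 k), fun k l h => (ht k l h N _ _).1 (by
          rw [Equiv.apply_symm_apply, Equiv.apply_symm_apply]
          exact g.2 k l h)⟩
        left_inv := fun g => Subtype.ext (funext fun k => (b k N).symm_apply_apply _)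
        right_inv := fun g => Subtype.ext (funext fun k => (b k N).apply_symm_apply _) }
    map_mul := fun N x y z h k => (hm k N _ _ _).2 (h k)
    fwdIdx := fun k => k
    fwd := φ
    fwd_fn := fun N k x => ⟨b k N x, (hφ k N _ _).2 rfl, fun y h => ((hφ k N _ _).1 h).symm⟩
    fwd_spec := fun N k g => (hφ k N _ _).2 rfl
    bwdIdx := fun k => k
    bwd := φ
    bwd_fn := fun N k y => ⟨(b k N).symm y, (hφ k N _ _).2 ((b k N).apply_symm_apply y),
      fun x h => (Equiv.eq_symm_apply _).2 ((hφ k N _ _).1 h)⟩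
    bwd_spec := fun N k g => (hφ k N _ _).2 rfl }⟩⟩

end Interp

end MSLang

theorem mainTheorem5 {L₀ L : MSLang.{u}} (T₀ : L₀.Theory) (T : L.Theory)
    (i : MSLang.Interp L₀ L) (hi : i.IsInternalCover T₀ T) (hT : i.NoNewStructure T₀ T)
    (M : L.Str) (hM : M.Models T) (A : Set M.Elt) (hA : i.IsInternalityParams A)
    (hA₀ : i.RestrictionTrivial A) :
    (∃ (G : i.GaloisGroup M.thry) (GA : MSLang.ProGroup (i.pull M).thry),
      Nonempty (i.ProIso A G.grp GA)) ∧
    ∀ (G : i.GaloisGroup M.thry) (GA : MSLang.ProGroup (i.pull M).thry)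
      (θ : i.ProIso A G.grp GA),
      (∀ D : MSLang.DSet L₀, D.IsValid (i.pull M).thry → ∀ a : GA.Act D,
        ∃ (X : MSLang.DSet L) (hX : X.IsValid M.thry) (α : i.ARel A ![X] ![D]),
          MSLang.Interp.IsActIso G θ hX a α) ∧
      (∀ (D E : MSLang.DSet L₀), D.IsValid (i.pull M).thry → E.IsValid (i.pull M).thry →
        ∀ (a : GA.Act D) (a' : GA.Act E)
          (X Y : MSLang.DSet L) (hX : X.IsValid M.thry) (hY : Y.IsValid M.thry)
          (α : i.ARel A ![X] ![D]) (β : i.ARel A ![Y] ![E]),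
          MSLang.Interp.IsActIso G θ hX a α → MSLang.Interp.IsActIso G θ hY a' β →
          ∀ f : MSLang.DRel ![D, E], MSLang.IsEquivariantMap a a' f →
            ∃ F : MSLang.DRel ![X, Y],
              (∀ N : L.Str, N.Models M.thry →
                MSLang.IsFn (fun (x : X.Pt N) (y : Y.Pt N) => F.Holds N (MSLang.pt2 x y))) ∧
              ∀ (N : MSLang.AModel A) (x : X.Pt N.N) (y : Y.Pt N.N)
                (d : D.Pt (i.pull N.N)) (e : E.Pt (i.pull N.N)),
                α.Holds N (MSLang.pt1 x) (MSLang.pt1 d) →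
                β.Holds N (MSLang.pt1 y) (MSLang.pt1 e) →
                (F.Holds N.N (MSLang.pt2 x y) ↔
                  f.Holds (i.pull N.N) (MSLang.pt2 d e))) := by
  -- Since `M` is a model of T, every model of its theory is one too, so what is assumed in models
  -- of T is available there.
  have hv : ∀ s, (i.srt s).IsValid M.thry := fun s N hN => hi.interp.valid s N fun φ h => hN (hM h)
  have hs : i.IsCanonicallyEmbedded hv := hi.stab.isCanonicallyEmbedded hi.interp hM hv
  refine ⟨?_, fun G GA θ => ⟨fun D hD a => MSLang.Interp.exists_isActIso hA hA₀ hs G θ hD a, ?_⟩⟩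
  · obtain ⟨G⟩ := hA.exists_galoisGroup hA₀ hs
    obtain ⟨H, θ⟩ := hA.exists_proIso hA₀ hs G.grp
    exact ⟨G, H, θ⟩
  · intro D E hD hE a a' X Y hX hY α β hα hβ f hf
    exact MSLang.Interp.IsActIso.exists_map hA hA₀ hs hD hE hα hβ hf
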